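/- Let $M(v)=e^{-|v|^2}$ and $\langle v\rangle=(1+|v|^2)^{1/2}$ for $v\in\mathbb{R}^3$. Let $r_0:\mathbb{R}^3\times\mathbb{R}^3\to\mathbb{R}$ satisfy detailed balance, $r_0(u,v)=r_0(v,u)e^{|v|^2-|u|^2}$; the bounds $\frac1C e^{-|u|^2}\langle u-v\rangle\le r_0(u,v)\le Ce^{-|u|^2}\langle u-v\rangle$ for some $C>0$; and let $r_0$ be differentiable in $u$ and in $v$ with, for some $C_2>0$, $|\partial_u^k\partial_v^l r_0(u,v)|\le C_2e^{-|u|^2/2}(1+|u-v|^2)^{(1-l)/2}$ for $k+l\le1$. Let $C_\infty\ge0$ and $\kappa>0$. Define $$\nu_0(v)=\int_{\mathbb{R}^3} r_0(u,v)\,du,\qquad K_0f(v)=\int_{\mathbb{R}^3} r_0(v,u)f(u)\,du,\qquad \nu_1(v)=\int_{\mathbb{R}^3\times S^2}|(u-v)\cdot\omega|\,M(u)\,du\,d\omega,$$ $$K_1f(v)=\int_{\mathbb{R}^3\times S^2}|(u-v)\cdot\omega|\,\bigl[M(v)f(u)-M(u')f(v')-M(v')f(u')\bigr]\,du\,d\omega,$$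 where $u'=u-[(u-v)\cdot\omega]\omega$ and $v'=v+[(u-v)\cdot\omega]\omega$. Put $\nu=\nu_0+C_\infty\kappa\nu_1$ and $K=-K_0+C_\infty\kappa K_1$. For $n\in\mathbb{Z}^3$ let $L_n=\nu+i\,n\cdot v+K$ be the unbounded operator on the complex space $L^1(\mathbb{R}^3)$ with domain $\{f\in L^1:\langle v\rangle f\in L^1\}$, and let $P_0f=\pi^{-3/2}M\int_{\mathbb{R}^3}f(v)\,dv$. Then there are $\kappa_0,C_0,C_1>0$, depending only on $r_0$ and $C_\infty$ (in particular not on $\kappa$, $n$ or $t$), such that for all $0<\kappa\le\kappa_0$ and all $n\in\mathbb{Z}^3$ the operator $-L_n$ generates a strongly continuous semigroup $(e^{-tL_n})_{t\ge0}$ on $L^1(\mathbb{R}^3)$, and for all $t\ge0$ $$\|e^{-tL_n}\|_{L^1\to L^1}\le C_1(1+|n|)e^{-C_0t}\quad\text{if } n\ne0,\qquad \|e^{-tL_0}(1-P_0)\|_{L^1\to L^1}\le C_1e^{-C_0t}\quad\text{if } n=0 .$$ -/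

import Mathlib

open MeasureTheory Filter Topology

noncomputable section

namespace LinearBoltzmann

/-- Velocity space, with the Euclidean norm and Lebesgue measure. -/
abbrev V : Type := EuclideanSpace ℝ (Fin 3)

/-- The unit sphere of velocity space. -/
abbrev S2 : Type := Metric.sphere (0 : V) 1

/-- The complex Banach space `L¹(ℝ³)`. -/
abbrev L1V : Type := Lp ℂ 1 (volume : Measure V)

/-- The Maxwellian `M(v) = exp(-|v|²)`. -/
def maxwellian (v : V) : ℝ := Real.exp (-‖v‖ ^ 2)

/-- The weight `⟨v⟩ = (1 + |v|²)^(1/2)`. -/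
def bracket (v : V) : ℝ := Real.sqrt (1 + ‖v‖ ^ 2)

/-- The conditions on the kernel `r₀(u, v)`: detailed balance, two-sided bounds, and bounds on the
kernel and its first order derivatives in `u` and in `v`. -/
structure AdmissibleKernel (r : V → V → ℝ) : Prop where
  detailed_balance : ∀ u v : V, r u v = r v u * Real.exp (‖v‖ ^ 2 - ‖u‖ ^ 2)
  two_sided_bound : ∃ C : ℝ, 0 < C ∧ ∀ u v : V,
    1 / C * (Real.exp (-‖u‖ ^ 2) * bracket (u - v)) ≤ r u v ∧
      r u v ≤ C * (Real.exp (-‖u‖ ^ 2) * bracket (u - v))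
  differentiable_left : ∀ v : V, Differentiable ℝ fun u => r u v
  differentiable_right : ∀ u : V, Differentiable ℝ fun v => r u v
  derivative_bound : ∃ C₂ : ℝ, 0 < C₂ ∧ ∀ u v : V,
    |r u v| ≤ C₂ * Real.exp (-‖u‖ ^ 2 / 2) * bracket (u - v) ∧
      ‖fderiv ℝ (fun u' => r u' v) u‖ ≤ C₂ * Real.exp (-‖u‖ ^ 2 / 2) * bracket (u - v) ∧
      ‖fderiv ℝ (fun v' => r u v') v‖ ≤ C₂ * Real.exp (-‖u‖ ^ 2 / 2)

/-- `ν₀(v) = ∫ r₀(u, v) du`. -/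
def nu0 (r : V → V → ℝ) (v : V) : ℝ := ∫ u : V, r u v

/-- `(K₀ f)(v) = ∫ r₀(v, u) f(u) du`. -/
def K0 (r : V → V → ℝ) (f : V → ℂ) (v : V) : ℂ := ∫ u : V, (r v u : ℂ) * f u

/-- The measure `du dω` on `ℝ³ × S²`, with `dω` the surface measure of the sphere. -/
def collisionMeasure : Measure (V × S2) :=
  (volume : Measure V).prod (volume : Measure V).toSphere

/-- The hard sphere collision rate `|(u - v) · ω|`. -/
def rate (v : V) (p : V × S2) : ℝ := |inner ℝ (p.1 - v) (p.2 : V)|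

/-- `u' = u - [(u - v) · ω] ω`. -/
def uPost (v : V) (p : V × S2) : V := p.1 - inner ℝ (p.1 - v) (p.2 : V) • (p.2 : V)

/-- `v' = v + [(u - v) · ω] ω`. -/
def vPost (v : V) (p : V × S2) : V := v + inner ℝ (p.1 - v) (p.2 : V) • (p.2 : V)

/-- `ν₁(v) = ∫ |(u - v) · ω| M(u) du dω`. -/
def nu1 (v : V) : ℝ := ∫ p, rate v p * maxwellian p.1 ∂collisionMeasure

/-- The operator `K₁`; `ν₁ f + K₁ f` is minus the linearization at `M` of the hard sphere collision
operator. -/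
def K1 (f : V → ℂ) (v : V) : ℂ :=
  (∫ p, (rate v p * maxwellian v : ℝ) * f p.1 ∂collisionMeasure)
    - (∫ p, (rate v p * maxwellian (uPost v p) : ℝ) * f (vPost v p) ∂collisionMeasure)
    - ∫ p, (rate v p * maxwellian (vPost v p) : ℝ) * f (uPost v p) ∂collisionMeasure

/-- `ν = ν₀ + C_∞ κ ν₁`. -/
def nu (r : V → V → ℝ) (Cinf κ : ℝ) (v : V) : ℝ := nu0 r v + Cinf * κ * nu1 v

/-- `K = -K₀ + C_∞ κ K₁`. -/
def K (r : V → V → ℝ) (Cinf κ : ℝ) (f : V → ℂ) (v : V) : ℂ :=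
  -K0 r f v + (Cinf * κ : ℝ) * K1 f v

/-- The Fourier mode `n ∈ ℤ³` as a vector of Euclidean space. -/
def mode (n : Fin 3 → ℤ) : V := WithLp.toLp 2 fun i => (n i : ℝ)

/-- The expression `(ν(v) + i n · v) f(v) + (K f)(v)`. -/
def modeExpr (r : V → V → ℝ) (Cinf κ : ℝ) (n : Fin 3 → ℤ) (f : V → ℂ) (v : V) : ℂ :=
  ((nu r Cinf κ v : ℂ) + Complex.I * (inner ℝ (mode n) v : ℝ)) * f v + K r Cinf κ f v

/-- The graph of the unbounded operator `L_n = ν + i n · v + K` on `L¹(ℝ³)`, whose domain consists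
of all `f ∈ L¹` with `⟨v⟩ f ∈ L¹`. -/
def modeOperator (r : V → V → ℝ) (Cinf κ : ℝ) (n : Fin 3 → ℤ) : Set (L1V × L1V) :=
  {p | Integrable (fun v => (bracket v : ℂ) * p.1 v) ∧
    (p.2 : V → ℂ) =ᵐ[volume] modeExpr r Cinf κ n p.1}

/-- `S t = exp(-t A)` for `t ≥ 0`: `S` is a strongly continuous semigroup of bounded operators whose
infinitesimal generator is exactly `-A`. The unbounded operator `A` is given by its graph; the values
of `S` at negative times play no role. -/
structure IsExpNeg {X : Type*} [NormedAddCommGroup X] [NormedSpace ℂ X]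
    (S : ℝ → X →L[ℂ] X) (A : Set (X × X)) : Prop where
  zero : S 0 = 1
  add : ∀ s t : ℝ, 0 ≤ s → 0 ≤ t → S (s + t) = S s ∘L S t
  strongly_continuous : ∀ x : X, ContinuousOn (fun t => S t x) (Set.Ici 0)
  generator : ∀ x y : X, (x, y) ∈ A ↔
    Tendsto (fun t : ℝ => ((t : ℂ)⁻¹) • (x - S t x)) (𝓝[>] 0) (𝓝 y)

theorem integrable_maxwellian : Integrable fun v : V => (maxwellian v : ℂ) := by
  have h := GaussianFourier.integrable_cexp_neg_mul_sq_norm_add (V := V) (b := 1) (by simp) 0 0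
  refine h.congr (Eventually.of_forall fun v => ?_)
  simp [maxwellian]

/-- The bounded linear functional `f ↦ ∫ f` on `L¹(ℝ³)`. -/
def mass : L1V →L[ℂ] ℂ :=
  LinearMap.mkContinuous
    { toFun := fun f => ∫ u : V, f u
      map_add' := fun f g => by
        rw [← integral_add (L1.integrable_coeFn f) (L1.integrable_coeFn g)]
        exact integral_congr_ae (Lp.coeFn_add f g)
      map_smul' := fun c f => by
        rw [RingHom.id_apply, ← integral_smul]
        exact integral_congr_ae (Lp.coeFn_smul c f) }
    1 fun f => by
      rw [one_mul, L1.norm_eq_integral_norm]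
      exact norm_integral_le_integral_norm _

/-- The projection `P₀ f = π^(-3/2) M ∫ f` of `L¹(ℝ³)` onto the line of the Maxwellian. -/
def P0 : L1V →L[ℂ] L1V :=
  mass.smulRight (((Real.pi ^ (-(3 / 2) : ℝ) : ℝ) : ℂ) • integrable_maxwellian.toL1 _)

theorem P0_apply (f : L1V) :
    (P0 f : V → ℂ) =ᵐ[volume]
      fun v => ((Real.pi ^ (-(3 / 2) : ℝ) * maxwellian v : ℝ) : ℂ) * ∫ u, f u := by
  have h : P0 f = (∫ u, f u) •
      (((Real.pi ^ (-(3 / 2) : ℝ) : ℝ) : ℂ) • integrable_maxwellian.toL1 _) := rfl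
  rw [h]
  filter_upwards [Lp.coeFn_smul (∫ u, f u)
      (((Real.pi ^ (-(3 / 2) : ℝ) : ℝ) : ℂ) • integrable_maxwellian.toL1 _),
    Lp.coeFn_smul ((Real.pi ^ (-(3 / 2) : ℝ) : ℝ) : ℂ) (integrable_maxwellian.toL1 _),
    integrable_maxwellian.coeFn_toL1] with v h1 h2 h3
  rw [h1, Pi.smul_apply, h2, Pi.smul_apply, h3]
  simp only [smul_eq_mul, Complex.ofReal_mul]
  ring

end LinearBoltzmann

end

/-!
The semigroup is obtained from the Hille–Yosida theorem in an equivalent norm in which `L_n` is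
strictly dissipative (for `n = 0`, on functions of mass zero). The lower bound on the kernel gives
the Doeblin minorization `r₀(u, v) ≥ C⁻¹ M(u)`, and the norm is

`N(f) = ∫ (1 - (η + θ) / ν₀) |f| dv + θ ∫₀^∞ |∫ exp(-t (ν₀ + i n · v)) f dv| dt`

with small constants `0 < η < θ`. Each of its ingredients produces one gain.

* The weight `1 / ν₀`. Since `∫ r₀(v, u) / ν₀(v) dv ≥ c₂ ⟨u⟩`, the gain term `K₀` loses
  `η c₂ ∫ ⟨v⟩ |f|` in the weight `1 - η / ν₀` (`KernelBounds.integral_weight_mul_norm_K0_sub_le`).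
  This strict gain of a weight `⟨v⟩` absorbs the operator `C_∞ κ (ν₁ + K₁)`, which is bounded from
  the weighted space to `L¹` with norm `O(κ)`.
* The mixing seminorm `∫₀^∞ |∫ exp(-t (ν₀ + i n · v)) f dv| dt`. Multiplication by `ν₀ + i n · v`
  acts on it as the generator of a translation semigroup on `L¹(0, ∞)`, and translation loses mass
  at the rate given by the boundary value `|∫ f|`
  (`KernelBounds.mul_mixing_add_norm_integral_le`). The seminorm is at most `∫ |f| / ν₀`, so that
  the weight `(η + θ) / ν₀` pays for it.
* Phase mixing. The rank one part `C⁻¹ M ∫ f` of the gain term returns to the seminorm a multiple of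
  its value at `M`. For `n ≠ 0` that value is smaller than `∫ M / ν₀` by a constant independent of
  `n`, because `exp(-i t n · v)` oscillates against a Gaussian minorant of `exp(-t ν₀) M`
  (`KernelBounds.exists_mixing_maxwellian_add_le`). This makes up for the mass `∫ f` that the
  minorization cannot damp.

Together they give (`KernelBounds.exists_dissipation`), for `l ≥ 0`, that multiplication by
`l + ν₀ + i n · v` dominates the remaining terms of `L_n` in `N` with the surplus
`l N(f) + ε ∫ ⟨v⟩ |f|`, up to a multiple of `|∫ f|` when `n = 0`. For large `l` a Neumann series
then inverts `l + L_n`, and Hille–Yosida yields the semigroup with rate `ε` and a bound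
independent of `n`. For `n = 0` collisions conserve mass, so the resolvent preserves the closed
subspace of functions of mass zero, the range of `1 - P₀`, on which the extra term vanishes.

The unbounded operator is handled through the parametrization `g ↦ (g / ⟨v⟩, L_n (g / ⟨v⟩))` of its
graph by bounded operators on `L¹`.
-/

noncomputable section

namespace LinearBoltzmann

/-! ### The Hille–Yosida theorem in an equivalent seminorm -/

section HilleYosida

variable {X : Type*} [NormedAddCommGroup X] [NormedSpace ℂ X]

theorem Seminorm.continuous_of_le_norm (N : Seminorm ℂ X) (hN : ∀ x, N x ≤ ‖x‖) :
    Continuous N := by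
  refine Seminorm.continuous_of_continuousAt_zero ?_
  rw [ContinuousAt, map_zero]
  refine squeeze_zero (fun x => apply_nonneg N x) hN ?_
  simpa using (continuous_norm (E := X)).tendsto 0

/-- The Yosida approximation `λ² R - λ` of the generator, `R` being the resolvent at `λ`. -/
def yosida (R : X →L[ℂ] X) (l : ℝ) : X →L[ℂ] X := ((l ^ 2 : ℝ) : ℂ) • R - (l : ℂ) • 1

/-- The uniformly continuous semigroup generated by a bounded operator. -/
def expSemigroup (T : X →L[ℂ] X) (t : ℝ) : X →L[ℂ] X := NormedSpace.exp ((t : ℂ) • T)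

theorem expSemigroup_zero (T : X →L[ℂ] X) : expSemigroup T 0 = 1 := by
  simp [expSemigroup]

theorem expSemigroup_commute {T P : X →L[ℂ] X} (h : Commute T P) (t : ℝ) :
    Commute (expSemigroup T t) P := (h.smul_left _).exp_left

theorem hasDerivAt_apply {E : ℝ → X →L[ℂ] X} {E' : X →L[ℂ] X} {t : ℝ} (h : HasDerivAt E E' t)
    (x : X) : HasDerivAt (fun s => E s x) (E' x) t :=
  ((ContinuousLinearMap.apply ℂ X x).restrictScalars ℝ).hasFDerivAt.comp_hasDerivAt t h

variable [CompleteSpace X]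

/-- The exponential of a bounded operator preserves a closed invariant subspace, with the bound in
the seminorm read off from the exponential series. -/
theorem seminorm_exp_le (N : Seminorm ℂ X) (hN : Continuous N) (Y : Submodule ℂ X)
    (hY : IsClosed (Y : Set X)) (P : X →L[ℂ] X) (β : ℝ)
    (hP : ∀ y ∈ Y, P y ∈ Y ∧ N (P y) ≤ β * N y) (hβ : 0 ≤ β) (y : X) (hy : y ∈ Y) :
    NormedSpace.exp P y ∈ Y ∧ N (NormedSpace.exp P y) ≤ Real.exp β * N y := by
  have hs : HasSum (fun k : ℕ => (((k.factorial : ℂ)⁻¹) • P ^ k) y) (NormedSpace.exp P y) :=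
    (NormedSpace.exp_series_hasSum_exp' (𝕂 := ℂ) P).mapL (ContinuousLinearMap.apply ℂ X y)
  have hpow : ∀ k : ℕ, (P ^ k) y ∈ Y ∧ N ((P ^ k) y) ≤ β ^ k * N y := by
    intro k
    induction k with
    | zero => simpa using hy
    | succ k ih =>
      rw [pow_succ', mul_apply_eq_comp]
      refine ⟨(hP _ ih.1).1, (hP _ ih.1).2.trans ?_⟩
      rw [pow_succ', mul_assoc]
      exact mul_le_mul_of_nonneg_left ih.2 hβ
  have hexp : HasSum (fun k : ℕ => β ^ k / (k.factorial : ℝ)) (Real.exp β) := by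
    rw [Real.exp_eq_exp_ℝ]
    exact NormedSpace.expSeries_div_hasSum_exp β
  refine ⟨hY.mem_of_tendsto hs (Eventually.of_forall fun s =>
    Y.sum_mem fun k _ => Y.smul_mem _ (hpow k).1), ?_⟩
  refine le_of_tendsto_of_tendsto ((hN.tendsto _).comp hs) (hexp.mul_right (N y))
    (Eventually.of_forall fun s => ?_)
  refine (Finset.le_sum_of_subadditive N (map_zero N).le (map_add_le_add N) s _).trans
    (Finset.sum_le_sum fun k _ => ?_)
  rw [smul_apply, map_smul_eq_mul, norm_inv, Complex.norm_natCast]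
  calc ((k.factorial : ℝ)⁻¹) * N ((P ^ k) y)
      ≤ ((k.factorial : ℝ)⁻¹) * (β ^ k * N y) :=
        mul_le_mul_of_nonneg_left (hpow k).2 (by positivity)
    _ = β ^ k / (k.factorial : ℝ) * N y := by ring

theorem expSemigroup_add (T : X →L[ℂ] X) (s t : ℝ) :
    expSemigroup T (s + t) = expSemigroup T s * expSemigroup T t := by
  let : NormedAlgebra ℚ (X →L[ℂ] X) := NormedAlgebra.restrictScalars ℚ ℂ _
  rw [expSemigroup, Complex.ofReal_add, add_smul]
  exact NormedSpace.exp_add_of_commute ((Commute.refl T).smul_left _ |>.smul_right _)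

theorem hasDerivAt_expSemigroup (T : X →L[ℂ] X) (t : ℝ) :
    HasDerivAt (expSemigroup T) (expSemigroup T t * T) t := by
  have h := (hasDerivAt_exp_smul_const (𝕂 := ℂ) T (t : ℂ)).scomp t Complex.ofRealCLM.hasDerivAt
  rw [Complex.ofRealCLM_apply, Complex.ofReal_one, one_smul] at h
  exact h

/-- Growth of the semigroup of the Yosida approximation on a closed subspace where the resolvent
`R` is bounded by `β` in the seminorm `N`. -/
theorem seminorm_expSemigroup_yosida_le (N : Seminorm ℂ X) (hN : Continuous N) (Y : Submodule ℂ X)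
    (hY : IsClosed (Y : Set X)) (R : X →L[ℂ] X) (l β : ℝ) (hβ : 0 ≤ β)
    (hR : ∀ y ∈ Y, R y ∈ Y ∧ N (R y) ≤ β * N y) (y : X) (hy : y ∈ Y) (t : ℝ) (ht : 0 ≤ t) :
    N (expSemigroup (yosida R l) t y) ≤ Real.exp (t * (l ^ 2 * β - l)) * N y := by
  let : NormedAlgebra ℚ (X →L[ℂ] X) := NormedAlgebra.restrictScalars ℚ ℂ _
  have h1 : expSemigroup (yosida R l) t =
      Complex.exp (-(t * l : ℝ)) • NormedSpace.exp (((t * l ^ 2 : ℝ) : ℂ) • R) := by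
    have : ((t : ℂ) • yosida R l) =
        (-(t * l : ℝ) : ℂ) • (1 : X →L[ℂ] X) + ((t * l ^ 2 : ℝ) : ℂ) • R := by
      rw [yosida, smul_sub, smul_smul, smul_smul, sub_eq_neg_add, ← neg_smul]
      push_cast
      rfl
    rw [expSemigroup, this,
      NormedSpace.exp_add_of_commute ((Commute.one_left _).smul_left _),
      ← Algebra.algebraMap_eq_smul_one,
      ← NormedSpace.algebraMap_exp_comm, Algebra.algebraMap_eq_smul_one, smul_mul_assoc, one_mul,
      Complex.exp_eq_exp_ℂ]
  have hn : 0 ≤ t * l ^ 2 := by positivity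
  have h2 := (seminorm_exp_le N hN Y hY (((t * l ^ 2 : ℝ) : ℂ) • R) (t * l ^ 2 * β)
    (fun z hz => ⟨Y.smul_mem _ (hR z hz).1, by
      rw [smul_apply, map_smul_eq_mul, Complex.norm_real, Real.norm_of_nonneg hn,
        mul_assoc (t * l ^ 2) β]
      exact mul_le_mul_of_nonneg_left (hR z hz).2 hn⟩) (by positivity) y hy).2
  rw [h1, smul_apply, map_smul_eq_mul]
  have h3 : ‖Complex.exp (-(t * l : ℝ))‖ = Real.exp (-(t * l)) := by
    rw [← Complex.ofReal_neg, ← Complex.ofReal_exp, Complex.norm_real,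
      Real.norm_of_nonneg (Real.exp_pos _).le]
  rw [h3]
  calc _ ≤ Real.exp (-(t * l)) * (Real.exp (t * l ^ 2 * β) * N y) := by gcongr
    _ = _ := by rw [← mul_assoc, ← Real.exp_add]; congr 2; ring

/-- Two bounded semigroups with commuting generators differ by at most `t` times the difference of
their generators. -/
theorem norm_expSemigroup_sub_le {T P : X →L[ℂ] X} (h : Commute T P) (C₁ C₂ t : ℝ) (ht : 0 ≤ t)
    (hC₁ : 0 ≤ C₁)
    (h1 : ∀ s ∈ Set.Icc 0 t, ∀ x, ‖expSemigroup T s x‖ ≤ C₁ * ‖x‖)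
    (h2 : ∀ s ∈ Set.Icc 0 t, ∀ x, ‖expSemigroup P s x‖ ≤ C₂ * ‖x‖) (x : X) :
    ‖expSemigroup T t x - expSemigroup P t x‖ ≤ t * (C₁ * C₂ * ‖T x - P x‖) := by
  have hd : ∀ s : ℝ, HasDerivAt (fun s => expSemigroup T (t - s) (expSemigroup P s x))
      (expSemigroup T (t - s) (expSemigroup P s (P x - T x))) s := by
    intro s
    have e1 : HasDerivAt (fun s => expSemigroup T (t - s)) (-(expSemigroup T (t - s) * T)) s := by
      exact (hasDerivAt_expSemigroup T (t - s)).comp_const_sub t s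
    have e2 := hasDerivAt_apply (e1.mul (hasDerivAt_expSemigroup P s)) x
    refine e2.congr_deriv ?_
    have c := (expSemigroup_commute h.symm s).eq
    rw [neg_mul, mul_assoc, ← c, map_sub, map_sub]
    simp
    abel
  have := norm_image_sub_le_of_norm_deriv_le_segment' (f := fun s =>
    expSemigroup T (t - s) (expSemigroup P s x)) (a := 0) (b := t) (C := C₁ * C₂ * ‖T x - P x‖)
    (fun s _ => (hd s).hasDerivWithinAt) (fun s hs => by
      refine (h1 _ ⟨by linarith [hs.2], by linarith [hs.1]⟩ _).trans ?_
      rw [mul_assoc]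
      refine mul_le_mul_of_nonneg_left ((h2 s ⟨hs.1, hs.2.le⟩ _).trans ?_) hC₁
      rw [norm_sub_rev]) t ⟨ht, le_rfl⟩
  simp only [sub_self, sub_zero, expSemigroup_zero, one_apply_eq_self] at this
  rw [norm_sub_rev, mul_comm t]
  exact this

/-- A bounded semigroup is tangent to its generator, with an error controlled by its modulus of
continuity. -/
theorem norm_expSemigroup_sub_sub_le (T : X →L[ℂ] X) (t δ : ℝ) (ht : 0 ≤ t) (x : X)
    (h : ∀ s ∈ Set.Icc 0 t, ‖expSemigroup T s (T x) - T x‖ ≤ δ) :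
    ‖expSemigroup T t x - x - (t : ℂ) • T x‖ ≤ δ * t := by
  have hd : ∀ s : ℝ, HasDerivAt (fun s : ℝ => expSemigroup T s x - (s : ℂ) • T x)
      (expSemigroup T s (T x) - T x) s := by
    intro s
    have e2 := hasDerivAt_apply (hasDerivAt_expSemigroup T s) x
    have e3 : HasDerivAt (fun s : ℝ => (s : ℂ) • T x) (T x) s := by
      simpa using (Complex.ofRealCLM.hasDerivAt (x := s)).smul_const (T x)
    exact e2.sub e3
  have := norm_image_sub_le_of_norm_deriv_le_segment' (f := fun s : ℝ =>
    expSemigroup T s x - (s : ℂ) • T x) (a := 0) (b := t) (C := δ)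
    (fun s _ => (hd s).hasDerivWithinAt) (fun s hs => h s ⟨hs.1, hs.2.le⟩) t ⟨ht, le_rfl⟩
  simp only [sub_zero, expSemigroup_zero, one_apply_eq_self, Complex.ofReal_zero,
    zero_smul] at this
  rwa [sub_right_comm]

/-- Uniform equicontinuity at time zero of bounded semigroups whose generators converge on a dense
set. -/
theorem eventually_norm_expSemigroup_sub_le {T : ℕ → X →L[ℂ] X} {C : ℝ} (hC : 0 < C)
    (hbound : ∀ k, ∀ t ∈ Set.Icc (0 : ℝ) 1, ∀ x, ‖expSemigroup (T k) t x‖ ≤ C * ‖x‖)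
    {J G : X →L[ℂ] X} (hJ : DenseRange J)
    (hlim : ∀ g, Tendsto (fun k => T k (J g)) atTop (𝓝 (G g))) (y : X) {ε : ℝ} (hε : 0 < ε) :
    ∃ δ, 0 < δ ∧ δ ≤ 1 ∧ ∀ᶠ k in atTop, ∀ s ∈ Set.Icc 0 δ,
      ‖expSemigroup (T k) s y - y‖ ≤ ε := by
  obtain ⟨g, hg⟩ := hJ.exists_dist_lt y (show 0 < ε / (2 * (C + 1)) by positivity)
  have hb : ∀ᶠ k in atTop, ‖T k (J g)‖ < ‖G g‖ + 1 :=
    (hlim g).norm.eventually (gt_mem_nhds (by linarith))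
  refine ⟨min 1 (ε / (2 * (C * (‖G g‖ + 1)))), by positivity, min_le_left _ _, ?_⟩
  filter_upwards [hb] with k hk s hs
  have hs1 : s ≤ 1 := hs.2.trans (min_le_left _ _)
  have hs2 : s * (C * ‖G g‖ + C) ≤ ε / 2 := by
    have := hs.2.trans (min_le_right _ _)
    rw [le_div_iff₀ (by positivity)] at this
    linarith
  have h1 := norm_expSemigroup_sub_le (T := T k) (P := 0) (Commute.zero_right _) C 1 s hs.1 hC.le
    (fun u hu => hbound k u ⟨hu.1, hu.2.trans hs1⟩)
    (fun u _ x => by simp [expSemigroup]) (J g)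
  have h0 : expSemigroup (0 : X →L[ℂ] X) s (J g) = J g := by simp [expSemigroup]
  rw [h0, mul_one, zero_apply, sub_zero] at h1
  have h2 := hbound k s ⟨hs.1, hs1⟩ (y - J g)
  rw [dist_eq_norm] at hg
  have h3 : (C + 1) * ‖y - J g‖ ≤ ε / 2 := by
    have := hg.le
    rw [le_div_iff₀ (by positivity)] at this
    linarith
  calc ‖expSemigroup (T k) s y - y‖
      = ‖expSemigroup (T k) s (y - J g) + (expSemigroup (T k) s (J g) - J g) - (y - J g)‖ := by
        rw [map_sub]; congr 1; abel
    _ ≤ C * ‖y - J g‖ + s * (C * ‖T k (J g)‖) + ‖y - J g‖ :=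
        (norm_sub_le _ _).trans (add_le_add (norm_add_le_of_le h2 h1) le_rfl)
    _ ≤ C * ‖y - J g‖ + s * (C * (‖G g‖ + 1)) + ‖y - J g‖ := by
        have := hs.1
        gcongr
    _ ≤ ε := by linarith

/-- Commuting bounded semigroups with a common exponential bound, whose generators converge on a
dense set, converge strongly to a strongly continuous semigroup, and the limit of the generators is
a restriction of its generator. -/
theorem exists_tendsto_expSemigroup {T : ℕ → X →L[ℂ] X} (hT : ∀ k l, Commute (T k) (T l))
    {C w : ℝ} (hC : 0 < C) (hw : 0 ≤ w)
    (hbound : ∀ k, ∀ t, 0 ≤ t → ∀ x, ‖expSemigroup (T k) t x‖ ≤ C * Real.exp (w * t) * ‖x‖)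
    {J G : X →L[ℂ] X} (hJ : DenseRange J)
    (hlim : ∀ g, Tendsto (fun k => T k (J g)) atTop (𝓝 (G g))) :
    ∃ S : ℝ → X →L[ℂ] X,
      (∀ t, 0 ≤ t → ∀ x, Tendsto (fun k => expSemigroup (T k) t x) atTop (𝓝 (S t x))) ∧
      S 0 = 1 ∧ (∀ s t : ℝ, 0 ≤ s → 0 ≤ t → S (s + t) = S s ∘L S t) ∧
      (∀ x : X, ContinuousOn (fun t => S t x) (Set.Ici 0)) ∧
      ∀ g, Tendsto (fun t : ℝ => ((t : ℂ)⁻¹) • (J g - S t (J g))) (𝓝[>] 0) (𝓝 (-G g)) := by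
  have hmono : ∀ t, 0 ≤ t → ∀ s ∈ Set.Icc 0 t, C * Real.exp (w * s) ≤ C * Real.exp (w * t) :=
    fun t _ s hs => by have := hs.2; gcongr
  have hcauchy : ∀ t, 0 ≤ t → ∀ x, CauchySeq fun k => expSemigroup (T k) t x := by
    intro t ht x
    set D := C * Real.exp (w * t) with hD
    have hDpos : 0 < D := by positivity
    have hbd : ∀ k, ∀ s ∈ Set.Icc 0 t, ∀ x, ‖expSemigroup (T k) s x‖ ≤ D * ‖x‖ := fun k s hs x =>
      (hbound k s hs.1 x).trans (mul_le_mul_of_nonneg_right (hmono t ht s hs) (norm_nonneg _))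
    rw [Metric.cauchySeq_iff']
    intro ε hε
    obtain ⟨g, hg⟩ := hJ.exists_dist_lt x (show 0 < ε / (4 * D) by positivity)
    rw [dist_eq_norm, lt_div_iff₀ (by positivity)] at hg
    obtain ⟨n, hn⟩ := Metric.cauchySeq_iff'.1 (hlim g).cauchySeq
      (ε / (2 * (t * (D * D) + 1))) (by positivity)
    refine ⟨n, fun k hk => ?_⟩
    have h1 := hn k hk
    rw [dist_eq_norm, lt_div_iff₀ (by positivity)] at h1
    have h2 := norm_expSemigroup_sub_le (hT k n) D D t ht hDpos.le (hbd k) (hbd n) (J g)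
    have h3 := hbd k t ⟨ht, le_rfl⟩ (x - J g)
    have h4 := hbd n t ⟨ht, le_rfl⟩ (x - J g)
    rw [dist_eq_norm]
    calc ‖expSemigroup (T k) t x - expSemigroup (T n) t x‖
        = ‖expSemigroup (T k) t (x - J g) - expSemigroup (T n) t (x - J g)
            + (expSemigroup (T k) t (J g) - expSemigroup (T n) t (J g))‖ := by
          rw [map_sub, map_sub]; congr 1; abel
      _ ≤ D * ‖x - J g‖ + D * ‖x - J g‖ + t * (D * D * ‖T k (J g) - T n (J g)‖) :=
          norm_add_le_of_le ((norm_sub_le _ _).trans (add_le_add h3 h4)) h2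
      _ < ε := by nlinarith [norm_nonneg (T k (J g) - T n (J g))]
  have hex : ∀ t : ℝ, ∃ P : X →L[ℂ] X, 0 ≤ t → ∀ x,
      Tendsto (fun k => expSemigroup (T k) t x) atTop (𝓝 (P x)) := by
    intro t
    by_cases ht : 0 ≤ t
    · choose f hf using fun x => cauchySeq_tendsto_of_complete (hcauchy t ht x)
      exact ⟨continuousLinearMapOfTendsto (fun k => expSemigroup (T k) t) (tendsto_pi_nhds.2 hf),
        fun _ => hf⟩
    · exact ⟨0, fun h => absurd h ht⟩
  choose S hS using hex
  have hSbound : ∀ t, 0 ≤ t → ∀ x, ‖S t x‖ ≤ C * Real.exp (w * t) * ‖x‖ := fun t ht x =>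
    le_of_tendsto (hS t ht x).norm (Eventually.of_forall fun k => hbound k t ht x)
  have hS0 : S 0 = 1 := by
    ext x
    refine tendsto_nhds_unique (hS 0 le_rfl x) ?_
    simp [expSemigroup_zero]
  have hSadd : ∀ s t : ℝ, 0 ≤ s → 0 ≤ t → S (s + t) = S s ∘L S t := by
    intro s t hs ht
    ext x
    refine tendsto_nhds_unique (hS _ (add_nonneg hs ht) x) ?_
    have h1 : Tendsto (fun k => expSemigroup (T k) s (expSemigroup (T k) t x - S t x)) atTop
        (𝓝 0) := by
      refine squeeze_zero_norm (fun k => hbound k s hs _) ?_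
      have := ((hS t ht x).sub_const (S t x)).norm.const_mul (C * Real.exp (w * s))
      simpa using this
    have h2 := h1.add (hS s hs (S t x))
    rw [zero_add] at h2
    refine h2.congr fun k => ?_
    rw [expSemigroup_add, map_sub, sub_add_cancel, mul_apply_eq_comp]
  have hunif : ∀ y ε, 0 < ε → ∃ δ, 0 < δ ∧ δ ≤ 1 ∧ ∀ᶠ k in atTop, ∀ s ∈ Set.Icc 0 δ,
      ‖expSemigroup (T k) s y - y‖ ≤ ε := fun y ε hε =>
    eventually_norm_expSemigroup_sub_le (C := C * Real.exp (w * 1)) (by positivity)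
      (fun k t ht x => (hbound k t ht.1 x).trans
        (mul_le_mul_of_nonneg_right (hmono 1 zero_le_one t ht) (norm_nonneg _))) hJ hlim y hε
  refine ⟨S, hS, hS0, hSadd, fun x => ?_, fun g => ?_⟩
  · have hsub : ∀ s t, 0 ≤ s → s ≤ t →
        ‖S t x - S s x‖ ≤ C * Real.exp (w * s) * ‖S (t - s) x - x‖ := by
      intro s t hs hst
      have : S t x - S s x = S s (S (t - s) x - x) := by
        conv_lhs => rw [show t = s + (t - s) by ring, hSadd s (t - s) hs (by linarith)]
        rw [map_sub]
        rfl
      rw [this]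
      exact hSbound s hs _
    rw [Metric.continuousOn_iff]
    intro t ht ε hε
    set D := C * Real.exp (w * (t + 1)) with hD
    have hDpos : 0 < D := by positivity
    obtain ⟨δ, hδ, hδ1, hk⟩ := hunif x (ε / (2 * D)) (by positivity)
    have hsmall : ∀ h, 0 ≤ h → h ≤ δ → ‖S h x - x‖ ≤ ε / (2 * D) := fun h h0 h1 =>
      le_of_tendsto ((hS h h0 x).sub_const x).norm (hk.mono fun k hk => hk h ⟨h0, h1⟩)
    have key : ∀ s u, 0 ≤ s → s ≤ u → s ≤ t + 1 → u - s ≤ δ → ‖S u x - S s x‖ < ε := by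
      intro s u hs hsu hst hd
      calc ‖S u x - S s x‖ ≤ C * Real.exp (w * s) * ‖S (u - s) x - x‖ := hsub s u hs hsu
        _ ≤ D * (ε / (2 * D)) := by
          gcongr
          · exact hmono (t + 1) (by linarith [ht.out]) s ⟨hs, hst⟩
          · exact hsmall _ (by linarith) hd
        _ = ε / 2 := by field_simp
        _ < ε := by linarith
    refine ⟨δ, hδ, fun s hs hst => ?_⟩
    rw [Real.dist_eq, abs_lt] at hst
    rw [dist_eq_norm]
    rcases le_total s t with h | h
    · rw [norm_sub_rev]
      exact key s t hs h (by linarith) (by linarith)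
    · exact key t s ht h (by linarith) (by linarith)
  · rw [Metric.tendsto_nhdsWithin_nhds]
    intro ε hε
    obtain ⟨δ, hδ, hδ1, hk⟩ := hunif (G g) (ε / 4) (by positivity)
    refine ⟨δ, hδ, fun {t} ht htδ => ?_⟩
    have ht : 0 < t := ht
    rw [Real.dist_eq, sub_zero, abs_of_pos ht] at htδ
    have h1 : ‖S t (J g) - J g - (t : ℂ) • G g‖ ≤ ε / 2 * t := by
      have hl : Tendsto (fun k => ‖expSemigroup (T k) t (J g) - J g - (t : ℂ) • T k (J g)‖) atTop
          (𝓝 ‖S t (J g) - J g - (t : ℂ) • G g‖) :=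
        (((hS t ht.le (J g)).sub_const (J g)).sub ((hlim g).const_smul (t : ℂ))).norm
      refine le_of_tendsto hl ?_
      have hsm : ∀ᶠ k in atTop, ‖T k (J g) - G g‖ <
          ε / (4 * (C * Real.exp (w * 1) + 1)) := by
        have := (tendsto_iff_norm_sub_tendsto_zero.1 (hlim g))
        exact this.eventually (gt_mem_nhds (by positivity))
      filter_upwards [hk, hsm] with k hk hsm
      refine norm_expSemigroup_sub_sub_le (T k) t (ε / 2) ht.le (J g) fun s hs => ?_
      have hsδ : s ≤ δ := hs.2.trans htδ.le
      have e1 := hk s ⟨hs.1, hsδ⟩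
      have e2 := (hbound k s hs.1 (T k (J g) - G g)).trans (mul_le_mul_of_nonneg_right
        (hmono 1 zero_le_one s ⟨hs.1, hsδ.trans hδ1⟩) (norm_nonneg _))
      rw [lt_div_iff₀ (by positivity)] at hsm
      calc ‖expSemigroup (T k) s (T k (J g)) - T k (J g)‖
          = ‖expSemigroup (T k) s (T k (J g) - G g) + (expSemigroup (T k) s (G g) - G g)
              - (T k (J g) - G g)‖ := by rw [map_sub]; congr 1; abel
        _ ≤ C * Real.exp (w * 1) * ‖T k (J g) - G g‖ + ε / 4 + ‖T k (J g) - G g‖ :=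
            (norm_sub_le _ _).trans (add_le_add (norm_add_le_of_le e2 e1) le_rfl)
        _ ≤ ε / 2 := by linarith
    have ht0 : (t : ℂ) ≠ 0 := by exact_mod_cast ht.ne'
    rw [dist_eq_norm]
    calc ‖((t : ℂ)⁻¹) • (J g - S t (J g)) - -G g‖
        = ‖-((t : ℂ)⁻¹ • (S t (J g) - J g - (t : ℂ) • G g))‖ := by
          congr 1
          rw [smul_sub _ _ ((t : ℂ) • G g), smul_smul, inv_mul_cancel₀ ht0, one_smul, neg_sub,
            smul_sub, smul_sub]
          abel
      _ = t⁻¹ * ‖S t (J g) - J g - (t : ℂ) • G g‖ := by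
          rw [norm_neg, norm_smul, norm_inv, Complex.norm_real, Real.norm_of_nonneg ht.le]
      _ ≤ t⁻¹ * (ε / 2 * t) := by gcongr
      _ = ε / 2 := by field_simp
      _ < ε := by linarith

/-- **Hille–Yosida theorem** in an equivalent seminorm. The operator is given in the parametrized
form `J g ↦ B g`, with `J`, `B` bounded, and is quasi-dissipative for `N`. On closed subspaces that
are invariant under the resolvent, a better dissipation rate gives a better growth bound. -/
theorem hille_yosida (N : Seminorm ℂ X) {c : ℝ} (hc : 0 < c) (hcN : ∀ x, c * ‖x‖ ≤ N x)
    (hN : ∀ x, N x ≤ ‖x‖) (J B : X →L[ℂ] X) (hJ : DenseRange J) (l₀ w : ℝ) (hw : 0 ≤ w)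
    (hunit : ∀ l : ℝ, l₀ < l → IsUnit ((l : ℂ) • J + B))
    (hdiss : ∀ l : ℝ, l₀ < l → ∀ g, (l - w) * N (J g) ≤ N ((l : ℂ) • J g + B g)) :
    ∃ S : ℝ → X →L[ℂ] X, IsExpNeg S {p : X × X | ∃ g, J g = p.1 ∧ B g = p.2} ∧
      ∀ (Y : Submodule ℂ X) (m : ℝ), IsClosed (Y : Set X) →
        (∀ l : ℝ, l₀ < l → ∀ g, (l : ℂ) • J g + B g ∈ Y →
          J g ∈ Y ∧ (l + m) * N (J g) ≤ N ((l : ℂ) • J g + B g)) →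
        ∀ y ∈ Y, ∀ t, 0 ≤ t → N (S t y) ≤ Real.exp (-m * t) * N y := by
  have hNc : Continuous N := Seminorm.continuous_of_le_norm N hN
  -- `l ≥ 2 w` makes `l² / (l - w) - l ≤ 2 w`, a growth bound common to all Yosida approximations
  set l₁ : ℝ := max l₀ (2 * w) + 1 with hl₁
  set l : ℕ → ℝ := fun k => l₁ + k with hl
  have hll₀ : ∀ k, l₀ < l k := fun k => by
    have := le_max_left l₀ (2 * w)
    have : (0 : ℝ) ≤ k := k.cast_nonneg
    simp only [hl, hl₁]; linarith
  have hlw : ∀ k, 2 * w + 1 ≤ l k := fun k => by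
    have := le_max_right l₀ (2 * w)
    have : (0 : ℝ) ≤ k := k.cast_nonneg
    simp only [hl, hl₁]; linarith
  have hltop : Tendsto l atTop atTop :=
    tendsto_atTop_add_const_left _ _ tendsto_natCast_atTop_atTop
  choose U hU using fun k => hunit (l k) (hll₀ k)
  set R : ℕ → X →L[ℂ] X := fun k => J * ↑(U k)⁻¹ with hR
  have hUapp : ∀ k g, (U k : X →L[ℂ] X) g = (l k : ℂ) • J g + B g := fun k g => by rw [hU k]; rfl
  have hUinv : ∀ k y, (U k : X →L[ℂ] X) ((↑(U k)⁻¹ : X →L[ℂ] X) y) = y := fun k y => by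
    rw [← mul_apply_eq_comp, Units.mul_inv, one_apply_eq_self]
  have hinvU : ∀ k y, (↑(U k)⁻¹ : X →L[ℂ] X) ((U k : X →L[ℂ] X) y) = y := fun k y => by
    rw [← mul_apply_eq_comp, Units.inv_mul, one_apply_eq_self]
  have hRU : ∀ k g, R k ((l k : ℂ) • J g + B g) = J g := fun k g => by
    rw [← hUapp, hR]; simp only [mul_apply_eq_comp]; rw [hinvU]
  have hRY : ∀ (Y : Submodule ℂ X) (m : ℝ), (∀ l : ℝ, l₀ < l → ∀ g, (l : ℂ) • J g + B g ∈ Y →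
      J g ∈ Y ∧ (l + m) * N (J g) ≤ N ((l : ℂ) • J g + B g)) → ∀ k, 0 < l k + m →
      ∀ y ∈ Y, R k y ∈ Y ∧ N (R k y) ≤ (l k + m)⁻¹ * N y := by
    intro Y m h k hk y hy
    have h1 : (l k : ℂ) • J ((↑(U k)⁻¹ : X →L[ℂ] X) y) + B ((↑(U k)⁻¹ : X →L[ℂ] X) y) = y := by
      rw [← hUapp, hUinv]
    have h2 := h (l k) (hll₀ k) ((↑(U k)⁻¹ : X →L[ℂ] X) y) (by rwa [h1])
    rw [h1] at h2
    refine ⟨h2.1, ?_⟩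
    rw [inv_mul_eq_div, le_div_iff₀ hk, mul_comm]
    exact h2.2
  have hRtop := hRY ⊤ (-w) (fun l hl g _ => ⟨trivial, by simpa [sub_eq_add_neg] using hdiss l hl g⟩)
  have hRcomm : ∀ k j, Commute (R k) (R j) := by
    intro k j
    rcases eq_or_ne k j with rfl | hkj
    · exact Commute.refl _
    have hne : ((l k - l j : ℝ) : ℂ) ≠ 0 := by
      rw [Ne, Complex.ofReal_eq_zero, sub_eq_zero]
      intro h
      exact hkj (by simpa [hl] using h)
    have hdiff : (U k : X →L[ℂ] X) - U j = ((l k - l j : ℝ) : ℂ) • J := by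
      rw [hU, hU, Complex.ofReal_sub, sub_smul]; abel
    -- the resolvent identity, multiplied by `l k - l j`
    have h1 : (↑(U k)⁻¹ : X →L[ℂ] X) * J * ↑(U j)⁻¹ = ↑(U j)⁻¹ * J * ↑(U k)⁻¹ := by
      have e1 : ((l k - l j : ℝ) : ℂ) • ((↑(U k)⁻¹ : X →L[ℂ] X) * J * ↑(U j)⁻¹) =
          ↑(U j)⁻¹ - ↑(U k)⁻¹ := by
        rw [← smul_mul_assoc, ← mul_smul_comm, ← hdiff, mul_sub, sub_mul, Units.inv_mul, one_mul,
          mul_assoc, Units.mul_inv, mul_one]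
      have e2 : ((l k - l j : ℝ) : ℂ) • ((↑(U j)⁻¹ : X →L[ℂ] X) * J * ↑(U k)⁻¹) =
          ↑(U j)⁻¹ - ↑(U k)⁻¹ := by
        rw [← smul_mul_assoc, ← mul_smul_comm, ← hdiff, mul_sub, sub_mul, Units.inv_mul, one_mul,
          mul_assoc, Units.mul_inv, mul_one]
      exact smul_right_injective _ hne (e1.trans e2.symm)
    simp only [hR, Commute, SemiconjBy]
    calc J * ↑(U k)⁻¹ * (J * ↑(U j)⁻¹) = J * (↑(U k)⁻¹ * J * ↑(U j)⁻¹) := by simp only [mul_assoc]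
      _ = J * ↑(U j)⁻¹ * (J * ↑(U k)⁻¹) := by rw [h1]; simp only [mul_assoc]
  set T : ℕ → X →L[ℂ] X := fun k => yosida (R k) (l k) with hT
  have hTcomm : ∀ k j, Commute (T k) (T j) := by
    intro k j
    simp only [hT, yosida]
    refine Commute.sub_left ?_ ((Commute.one_left _).smul_left _)
    refine Commute.sub_right ?_ ((Commute.one_right _).smul_right _)
    exact ((hRcomm k j).smul_left _).smul_right _
  have hNbound : ∀ k, ∀ t, 0 ≤ t → ∀ x,
      N (expSemigroup (T k) t x) ≤ Real.exp (2 * w * t) * N x := by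
    intro k t ht x
    have hk := hlw k
    have hpos : 0 < l k + -w := by linarith
    refine (seminorm_expSemigroup_yosida_le N hNc ⊤ isClosed_univ (R k) (l k) (l k + -w)⁻¹
      (by positivity) (hRtop k hpos) x trivial t ht).trans ?_
    refine mul_le_mul_of_nonneg_right (Real.exp_le_exp.2 ?_) (apply_nonneg N x)
    rw [mul_comm (2 * w)]
    refine mul_le_mul_of_nonneg_left ?_ ht
    rw [sub_le_iff_le_add, mul_inv_le_iff₀ hpos]
    nlinarith
  have hbound : ∀ k, ∀ t, 0 ≤ t → ∀ x,
      ‖expSemigroup (T k) t x‖ ≤ c⁻¹ * Real.exp (2 * w * t) * ‖x‖ := by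
    intro k t ht x
    rw [mul_assoc, inv_mul_eq_div, le_div_iff₀ hc, mul_comm]
    exact (hcN _).trans ((hNbound k t ht x).trans (by gcongr; exact hN x))
  -- `λ R_λ` tends strongly to the identity
  have hRlim : ∀ x, Tendsto (fun k => (l k : ℂ) • R k x) atTop (𝓝 x) := by
    intro x
    have hNR : ∀ k x, N ((l k : ℂ) • R k x) ≤ 2 * N x := by
      intro k x
      have hk := hlw k
      rw [map_smul_eq_mul, Complex.norm_real, Real.norm_of_nonneg (by linarith)]
      have := (hRtop k (by linarith) x trivial).2
      rw [inv_mul_eq_div, le_div_iff₀ (by linarith)] at this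
      nlinarith [apply_nonneg N (R k x)]
    rw [Metric.tendsto_atTop']
    intro ε hε
    obtain ⟨g, hg⟩ := hJ.exists_dist_lt x (show 0 < ε * c / 8 by positivity)
    rw [dist_eq_norm] at hg
    have hlim0 : Tendsto (fun k => (l k + -w)⁻¹ * N (B g)) atTop (𝓝 0) := by
      have := (tendsto_atTop_add_const_right _ (-w) hltop).inv_tendsto_atTop.mul_const (N (B g))
      simpa using this
    obtain ⟨n, hn⟩ := (hlim0.eventually
      (gt_mem_nhds (show 0 < ε * c / 4 by positivity))).exists_forall_of_atTop
    refine ⟨n, fun k hk => ?_⟩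
    have hk := hn k hk.le
    have e1 : (l k : ℂ) • R k x - x = (l k : ℂ) • R k (x - J g) - R k (B g) - (x - J g) := by
      have := hRU k g
      rw [map_add, map_smul] at this
      rw [map_sub, smul_sub, eq_sub_of_add_eq this]
      abel
    have e2 := (hRtop k (by linarith [hlw k]) (B g) trivial).2
    have e3 := hNR k (x - J g)
    have e4 := hN (x - J g)
    have e5 : N ((l k : ℂ) • R k x - x) ≤
        2 * N (x - J g) + (l k + -w)⁻¹ * N (B g) + N (x - J g) := by
      rw [e1]
      exact (map_sub_le_add N _ _).trans (add_le_add
        ((map_sub_le_add N _ _).trans (add_le_add e3 e2)) le_rfl)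
    rw [dist_eq_norm]
    have e6 := hcN ((l k : ℂ) • R k x - x)
    have : c * ‖(l k : ℂ) • R k x - x‖ < c * ε := by nlinarith
    exact lt_of_mul_lt_mul_left this hc.le
  have hlim : ∀ g, Tendsto (fun k => T k (J g)) atTop (𝓝 ((-B) g)) := by
    intro g
    have := (hRlim (B g)).neg
    refine this.congr fun k => ?_
    have h2 := hRU k g
    rw [map_add, map_smul] at h2
    simp only [hT, yosida, sub_apply, smul_apply, one_apply_eq_self]
    have h3 : (l k : ℂ) • J g = (l k : ℂ) • ((l k : ℂ) • R k (J g) + R k (B g)) := by rw [h2]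
    rw [h3, smul_add, smul_smul, Complex.ofReal_pow, sq]
    abel
  obtain ⟨S, hS, hS0, hSadd, hScont, hSgen⟩ := exists_tendsto_expSemigroup hTcomm
    (inv_pos.2 hc) (mul_nonneg zero_le_two hw) hbound hJ hlim
  refine ⟨S, ⟨hS0, hSadd, hScont, fun x y => ⟨?_, fun hxy => ?_⟩⟩, ?_⟩
  · rintro ⟨g, rfl, rfl⟩
    simpa using hSgen g
  · -- Subtract from `x` the solution `J g` of the resolvent equation; the difference `z` is an
    -- eigenvector for an eigenvalue above the growth bound.
    set g := (↑(U 0)⁻¹ : X →L[ℂ] X) ((l 0 : ℂ) • x + y) with hg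
    have hUg : (l 0 : ℂ) • J g + B g = (l 0 : ℂ) • x + y := by rw [← hUapp, hg, hUinv]
    set z := x - J g with hz
    have hBg : B g = (l 0 : ℂ) • z + y := by
      rw [hz, smul_sub, sub_add_eq_add_sub, ← hUg]; abel
    have hzgen : Tendsto (fun t : ℝ => ((t : ℂ)⁻¹) • (z - S t z)) (𝓝[>] 0)
        (𝓝 (-((l 0 : ℂ) • z))) := by
      have h1 := Tendsto.sub
        (show Tendsto (fun t : ℝ => ((t : ℂ)⁻¹) • (x - S t x)) (𝓝[>] 0) (𝓝 y) from hxy) (hSgen g)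
      have h2 : y - -(-B) g = -((l 0 : ℂ) • z) := by rw [neg_apply, neg_neg, hBg]; abel
      rw [h2] at h1
      refine h1.congr fun t => ?_
      rw [← smul_sub, hz, map_sub]
      congr 1
      abel
    have hz0 : z = 0 := by
      have hderiv : ∀ t ∈ Set.Ico (0 : ℝ) 1,
          HasDerivWithinAt (fun t : ℝ => Real.exp (-(l 0 * t)) • S t z) 0 (Set.Ici t) t := by
        intro t ht
        have d1 : HasDerivWithinAt (fun t => S t z) (l 0 • S t z) (Set.Ici t) t := by
          rw [← hasDerivWithinAt_Ioi_iff_Ici, hasDerivWithinAt_iff_tendsto_slope' (by simp)]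
          have hshift : Tendsto (fun s => s - t) (𝓝[>] t) (𝓝[>] 0) := by
            refine tendsto_nhdsWithin_iff.2 ⟨?_, ?_⟩
            · have := (continuous_sub_right t).tendsto t
              rw [sub_self] at this
              exact this.mono_left nhdsWithin_le_nhds
            · filter_upwards [self_mem_nhdsWithin] with s hs using sub_pos.2 (Set.mem_Ioi.1 hs)
          have h1 := (((S t).continuous.tendsto _).comp (hzgen.comp hshift)).neg
          rw [map_neg, neg_neg, map_smul, Complex.coe_smul] at h1
          refine h1.congr' ?_
          filter_upwards [self_mem_nhdsWithin] with s hs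
          have h2 : S s z = S t (S (s - t) z) := by
            conv_lhs => rw [show s = t + (s - t) by ring,
              hSadd t (s - t) ht.1 (sub_pos.2 (Set.mem_Ioi.1 hs)).le]
            rfl
          rw [slope_def_module, h2]
          simp only [Function.comp_apply, map_smul, map_sub]
          rw [← Complex.ofReal_inv, Complex.coe_smul, ← smul_neg, neg_sub]
        have d2 : HasDerivAt (fun t : ℝ => Real.exp (-(l 0 * t)))
            (Real.exp (-(l 0 * t)) * -(l 0)) t := by
          simpa using (((hasDerivAt_id t).const_mul (l 0)).neg).exp
        have d3 := d2.hasDerivWithinAt.smul d1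
        refine d3.congr_deriv ?_
        rw [smul_smul, ← add_smul]
        simp
      have hconst := constant_of_has_deriv_right_zero
        (f := fun t : ℝ => Real.exp (-(l 0 * t)) • S t z)
        (a := 0) (b := 1) ((show ContinuousOn (fun t : ℝ => Real.exp (-(l 0 * t))) (Set.Icc 0 1) by
          fun_prop).smul
          ((hScont z).mono fun t ht => ht.1)) hderiv 1 ⟨zero_le_one, le_rfl⟩
      simp only [mul_one, mul_zero, neg_zero, Real.exp_zero, one_smul, hS0, one_apply_eq_self]
        at hconst
      have h1 : N (S 1 z) ≤ Real.exp (2 * w * 1) * N z :=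
        le_of_tendsto ((hNc.tendsto _).comp (hS 1 zero_le_one z))
          (Eventually.of_forall fun k => hNbound k 1 zero_le_one z)
      have h2 : N z = Real.exp (-(l 0)) * N (S 1 z) := by
        conv_lhs => rw [← hconst]
        rw [← Complex.coe_smul, map_smul_eq_mul, Complex.norm_real,
          Real.norm_of_nonneg (Real.exp_pos _).le]
      have h3 : N z ≤ Real.exp (2 * w - l 0) * N z := by
        calc N z = Real.exp (-(l 0)) * N (S 1 z) := h2
          _ ≤ Real.exp (-(l 0)) * (Real.exp (2 * w * 1) * N z) := by gcongr
          _ = Real.exp (2 * w - l 0) * N z := by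
            rw [← mul_assoc, ← Real.exp_add]; congr 2; ring
      have h4 : Real.exp (2 * w - l 0) < 1 := by
        rw [Real.exp_lt_one_iff]; linarith [hlw 0]
      have h5 : N z ≤ 0 := by nlinarith [apply_nonneg N z]
      have h6 : ‖z‖ ≤ 0 := by nlinarith [hcN z, norm_nonneg z]
      exact norm_le_zero_iff.1 h6
    refine ⟨g, ?_, ?_⟩
    · exact (sub_eq_zero.1 (hz ▸ hz0)).symm
    · simpa [hz0] using hBg
  · intro Y m hY h y hy t ht
    have hev : ∀ᶠ k in atTop, 0 < l k + m := by
      filter_upwards [hltop.eventually_gt_atTop (-m)] with k hk using by linarith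
    have hlimexp : Tendsto (fun k => Real.exp (t * ((l k) ^ 2 * (l k + m)⁻¹ - l k)) * N y) atTop
        (𝓝 (Real.exp (-m * t) * N y)) := by
      refine Tendsto.mul_const _ (Real.continuous_exp.continuousAt.tendsto.comp ?_)
      have h1 : Tendsto (fun k => t * (-m + m ^ 2 * (l k + m)⁻¹)) atTop
          (𝓝 (t * (-m + m ^ 2 * 0))) :=
        ((tendsto_atTop_add_const_right _ m hltop).inv_tendsto_atTop.const_mul _ |>.const_add _
          |>.const_mul _)
      rw [mul_zero, add_zero, mul_comm] at h1
      refine h1.congr' ?_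
      filter_upwards [hev] with k hk
      field_simp
      ring
    refine le_of_tendsto_of_tendsto ((hNc.tendsto _).comp (hS t ht y)) hlimexp ?_
    filter_upwards [hev] with k hk
    exact seminorm_expSemigroup_yosida_le N hNc Y hY (R k) (l k) (l k + m)⁻¹
      (by positivity) (hRY Y m h k hk) y hy t ht

/-- Neumann series in an equivalent seminorm: a perturbation that is strictly dominated by an
invertible operator leaves it invertible. -/
theorem isUnit_add_of_seminorm_le (N : Seminorm ℂ X) {c : ℝ} (hc : 0 < c)
    (hcN : ∀ x, c * ‖x‖ ≤ N x) (hN : ∀ x, N x ≤ ‖x‖) {M P : X →L[ℂ] X} (hM : IsUnit M) {ε : ℝ}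
    (hε : 0 < ε) (h : ∀ g, N (P g) + ε * ‖g‖ ≤ N (M g)) : IsUnit (M + P) := by
  obtain ⟨U, rfl⟩ := hM
  set Q : X →L[ℂ] X := -(P * ↑U⁻¹) with hQ
  set b : ℝ := ‖(U : X →L[ℂ] X)‖ + 1 + ε with hb
  have hb1 : 0 < b := by positivity
  set q : ℝ := 1 - ε / b with hq
  have hq0 : 0 ≤ q := by
    rw [hq, sub_nonneg, div_le_one hb1, hb]
    linarith [norm_nonneg (U : X →L[ℂ] X)]
  have hq1 : q < 1 := by rw [hq]; linarith [div_pos hε hb1]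
  have hNQ : ∀ x, N (Q x) ≤ q * N x := by
    intro x
    have hUx : (U : X →L[ℂ] X) ((↑U⁻¹ : X →L[ℂ] X) x) = x := by
      rw [← mul_apply_eq_comp, Units.mul_inv, one_apply_eq_self]
    have h1 := h ((↑U⁻¹ : X →L[ℂ] X) x)
    have h2 : ‖x‖ ≤ b * ‖(↑U⁻¹ : X →L[ℂ] X) x‖ := by
      conv_lhs => rw [← hUx]
      refine ((U : X →L[ℂ] X).le_opNorm _).trans (mul_le_mul_of_nonneg_right ?_ (norm_nonneg _))
      rw [hb]; linarith
    rw [hUx] at h1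
    have h3 : N (Q x) = N (P ((↑U⁻¹ : X →L[ℂ] X) x)) := by
      rw [hQ, neg_apply, map_neg_eq_map, mul_apply_eq_comp]
    have h4 : ε / b * N x ≤ ε * ‖(↑U⁻¹ : X →L[ℂ] X) x‖ := by
      rw [div_mul_eq_mul_div, div_le_iff₀ hb1, mul_assoc]
      refine mul_le_mul_of_nonneg_left ?_ hε.le
      rw [mul_comm]
      exact (hN x).trans h2
    rw [h3, hq, sub_mul, one_mul]
    linarith
  have hpow : ∀ k : ℕ, ∀ x, N ((Q ^ k) x) ≤ q ^ k * N x := by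
    intro k
    induction k with
    | zero => simp
    | succ k ih =>
      intro x
      rw [pow_succ', mul_apply_eq_comp, pow_succ', mul_assoc]
      exact (hNQ _).trans (mul_le_mul_of_nonneg_left (ih x) hq0)
  -- `Q` contracts only `N`; in the norm a power of `Q` contracts, and `1 - Q` divides `1 - Q ^ k`
  obtain ⟨k, hk⟩ := exists_pow_lt_of_lt_one hc hq1
  have hnorm : ‖Q ^ k‖ < 1 := by
    refine lt_of_le_of_lt (ContinuousLinearMap.opNorm_le_bound _ (by positivity) fun x => ?_)
      ((div_lt_one hc).2 hk)
    rw [div_mul_eq_mul_div, le_div_iff₀ hc, mul_comm]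
    exact (hcN _).trans ((hpow k x).trans (mul_le_mul_of_nonneg_left (hN x) (by positivity)))
  have h1 : IsUnit (1 - Q ^ k) := isUnit_one_sub_of_norm_lt_one hnorm
  rw [← mul_neg_geom_sum] at h1
  have hcomm : Commute (1 - Q) (∑ i ∈ Finset.range k, Q ^ i) :=
    Commute.sum_right _ _ _ fun i _ => ((Commute.one_left Q).sub_left (Commute.refl Q)).pow_right i
  have h2 : IsUnit (1 - Q) := (hcomm.isUnit_mul_iff.1 h1).1
  have h3 : (U : X →L[ℂ] X) + P = (1 - Q) * U := by
    rw [hQ, sub_neg_eq_add, add_mul, one_mul, mul_assoc, Units.inv_mul, mul_one]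
  rw [h3]
  exact h2.mul U.isUnit

end HilleYosida

/-! ### Bounds for the background collision kernel -/

theorem one_le_bracket (v : V) : 1 ≤ bracket v := by
  rw [bracket, Real.one_le_sqrt]
  nlinarith [sq_nonneg ‖v‖]

theorem bracket_pos (v : V) : 0 < bracket v := zero_lt_one.trans_le (one_le_bracket v)

theorem bracket_sq (v : V) : bracket v ^ 2 = 1 + ‖v‖ ^ 2 := Real.sq_sqrt (by positivity)

theorem continuous_bracket : Continuous bracket := by
  unfold bracket
  fun_prop

theorem norm_le_bracket (v : V) : ‖v‖ ≤ bracket v :=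
  abs_le_of_sq_le_sq' (by rw [bracket_sq]; linarith) (bracket_pos v).le |>.2

theorem bracket_sub_le (u v : V) : bracket (u - v) ≤ 2 * bracket u * bracket v := by
  have hu := bracket_pos u
  have hv := bracket_pos v
  refine abs_le_of_sq_le_sq' ?_ (by positivity) |>.2
  have h1 : ‖u - v‖ ^ 2 ≤ (‖u‖ + ‖v‖) ^ 2 := by
    have := norm_sub_le u v
    gcongr
  rw [mul_pow, mul_pow, bracket_sq, bracket_sq, bracket_sq]
  nlinarith [sq_nonneg (‖u‖ - ‖v‖), mul_nonneg (sq_nonneg ‖u‖) (sq_nonneg ‖v‖)]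

theorem bracket_le_mul_bracket_sub (u v : V) : bracket v ≤ 2 * bracket u * bracket (u - v) := by
  simpa using bracket_sub_le u (u - v)

theorem maxwellian_pos (v : V) : 0 < maxwellian v := Real.exp_pos _

theorem continuous_maxwellian : Continuous maxwellian := by
  unfold maxwellian
  fun_prop

theorem integrable_exp_neg_mul_sq_norm {b : ℝ} (hb : 0 < b) :
    Integrable fun v : V => Real.exp (-b * ‖v‖ ^ 2) := by
  have h := (GaussianFourier.integrable_cexp_neg_mul_sq_norm_add (V := V) (b := b)
    (by simpa) 0 0).re
  refine h.congr (Eventually.of_forall fun v => ?_)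
  have : (-(b : ℂ) * (‖v‖ : ℂ) ^ 2 + 0 * (inner ℝ (0 : V) v : ℝ)) = ((-b * ‖v‖ ^ 2 : ℝ) : ℂ) := by
    push_cast; ring
  simp only [this, ← Complex.ofReal_exp]
  exact Complex.ofReal_re _

theorem integrable_maxwellian_real : Integrable maxwellian := by
  simpa [maxwellian] using! integrable_exp_neg_mul_sq_norm one_pos

theorem integrable_maxwellian_mul_bracket : Integrable fun v => maxwellian v * bracket v := by
  refine ((integrable_exp_neg_mul_sq_norm (b := 1 / 2) (by norm_num)).const_mul 2).mono'
    (continuous_maxwellian.mul continuous_bracket).aestronglyMeasurable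
    (Eventually.of_forall fun v => ?_)
  rw [Real.norm_of_nonneg (mul_pos (maxwellian_pos v) (bracket_pos v)).le]
  have h1 : bracket v ≤ 2 * Real.exp (1 / 2 * ‖v‖ ^ 2) := by
    have h2 := Real.add_one_le_exp (1 / 2 * ‖v‖ ^ 2)
    nlinarith [bracket_sq v, one_le_bracket v]
  calc maxwellian v * bracket v ≤ maxwellian v * (2 * Real.exp (1 / 2 * ‖v‖ ^ 2)) := by
        have := maxwellian_pos v
        gcongr
    _ = 2 * Real.exp (-(1 / 2) * ‖v‖ ^ 2) := by
        rw [maxwellian, mul_left_comm, ← Real.exp_add]; congr 2; ring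

theorem integral_pos_of_pos {g : V → ℝ} (hg : Integrable g)
    (hpos : ∀ v, 0 < g v) : 0 < ∫ v, g v := by
  rw [integral_pos_iff_support_of_nonneg (fun v => (hpos v).le) hg]
  have : Function.support g = Set.univ := Set.eq_univ_of_forall fun v => (hpos v).ne'
  rw [this]
  exact Measure.measure_univ_pos.2 (NeZero.ne _)

/-- The functions `f` with `⟨v⟩ f ∈ L¹`. -/
def WeightedIntegrable (f : V → ℂ) : Prop := Integrable fun v => (bracket v : ℂ) * f v

theorem WeightedIntegrable.aestronglyMeasurable {f : V → ℂ} (hf : WeightedIntegrable f) :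
    AEStronglyMeasurable f volume := by
  have h : f = fun v => ((bracket v)⁻¹ : ℂ) * ((bracket v : ℂ) * f v) := by
    ext v
    have : (bracket v : ℂ) ≠ 0 := by exact_mod_cast (bracket_pos v).ne'
    rw [inv_mul_cancel_left₀ this]
  rw [h]
  refine AEStronglyMeasurable.mul ?_ (Integrable.aestronglyMeasurable hf)
  exact ((Complex.continuous_ofReal.comp continuous_bracket).measurable.inv).aestronglyMeasurable

theorem WeightedIntegrable.integrable_bracket_mul_norm {f : V → ℂ} (hf : WeightedIntegrable f) :
    Integrable fun v => bracket v * ‖f v‖ := by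
  refine (Integrable.norm hf).congr (Eventually.of_forall fun v => ?_)
  simp [abs_of_pos (bracket_pos v)]

/-- Multiplication by a function of at most linear growth maps the weighted space to `L¹`. -/
theorem WeightedIntegrable.integrable_mul_norm {f : V → ℂ} (hf : WeightedIntegrable f) {g : V → ℝ}
    (hg : Measurable g) {D : ℝ} (hD : ∀ v, |g v| ≤ D * bracket v) :
    Integrable fun v => g v * ‖f v‖ := by
  refine (hf.integrable_bracket_mul_norm.const_mul D).mono'
    (hg.aestronglyMeasurable.mul hf.aestronglyMeasurable.norm) (Eventually.of_forall fun v => ?_)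
  rw [norm_mul, norm_norm, Real.norm_eq_abs, ← mul_assoc]
  exact mul_le_mul_of_nonneg_right (hD v) (norm_nonneg _)

theorem WeightedIntegrable.integrable_mul {f : V → ℂ} (hf : WeightedIntegrable f) {g : V → ℂ}
    (hg : Measurable g) {D : ℝ} (hD : ∀ v, ‖g v‖ ≤ D * bracket v) :
    Integrable fun v => g v * f v := by
  refine (hf.integrable_bracket_mul_norm.const_mul D).mono'
    (hg.aestronglyMeasurable.mul hf.aestronglyMeasurable) (Eventually.of_forall fun v => ?_)
  rw [norm_mul, ← mul_assoc]
  exact mul_le_mul_of_nonneg_right (hD v) (norm_nonneg _)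

theorem WeightedIntegrable.integrable {f : V → ℂ} (hf : WeightedIntegrable f) : Integrable f := by
  simpa using hf.integrable_mul (g := fun _ => 1) measurable_const (D := 1)
    (fun v => by simpa using one_le_bracket v)

/-- The consequences of admissibility that the argument uses: a jointly measurable kernel with
two-sided bounds. -/
structure KernelBounds (r : V → V → ℝ) (C : ℝ) : Prop where
  pos : 0 < C
  measurable : Measurable (Function.uncurry r)
  lower : ∀ u v, C⁻¹ * (maxwellian u * bracket (u - v)) ≤ r u v
  upper : ∀ u v, r u v ≤ C * (maxwellian u * bracket (u - v))

theorem AdmissibleKernel.exists_kernelBounds {r : V → V → ℝ} (hr : AdmissibleKernel r) :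
    ∃ C, KernelBounds r C := by
  obtain ⟨C, hC, h⟩ := hr.two_sided_bound
  refine ⟨C, hC, ?_, fun u v => ?_, fun u v => (h u v).2⟩
  · exact measurable_uncurry_of_continuous_of_measurable
      (fun v => (hr.differentiable_left v).continuous)
      (fun u => (hr.differentiable_right u).continuous.measurable)
  · have := (h u v).1
    rwa [one_div] at this

namespace KernelBounds

variable {r : V → V → ℝ} {C : ℝ} (hr : KernelBounds r C)
include hr

theorem nonneg (u v : V) : 0 ≤ r u v := by
  have h1 := hr.pos
  have h2 := maxwellian_pos u
  have h3 := bracket_pos (u - v)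
  exact le_trans (by positivity) (hr.lower u v)

/-- The Doeblin minorization: with positive probability a collision forgets the incoming
velocity. -/
theorem minorization (u v : V) : C⁻¹ * maxwellian u ≤ r u v := by
  refine le_trans ?_ (hr.lower u v)
  have h1 := hr.pos
  have h2 := maxwellian_pos u
  have h3 := one_le_bracket (u - v)
  gcongr
  exact le_mul_of_one_le_right h2.le h3

theorem upper_mul (u v : V) : r u v ≤ 2 * C * (maxwellian u * bracket u) * bracket v := by
  refine (hr.upper u v).trans ?_
  have h1 := hr.pos
  have h2 := maxwellian_pos u
  calc C * (maxwellian u * bracket (u - v)) ≤ C * (maxwellian u * (2 * bracket u * bracket v)) := by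
        gcongr
        exact bracket_sub_le u v
    _ = _ := by ring

theorem lower_mul (u v : V) : C⁻¹ / 2 * (maxwellian u / bracket u) * bracket v ≤ r u v := by
  refine le_trans ?_ (hr.lower u v)
  have h1 := hr.pos
  have h2 := maxwellian_pos u
  have h3 := bracket_pos u
  calc C⁻¹ / 2 * (maxwellian u / bracket u) * bracket v
      ≤ C⁻¹ / 2 * (maxwellian u / bracket u) * (2 * bracket u * bracket (u - v)) := by
        gcongr
        exact bracket_le_mul_bracket_sub u v
    _ = _ := by field_simp

theorem integrable_left (v : V) : Integrable fun u => r u v := by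
  refine (integrable_maxwellian_mul_bracket.const_mul (2 * C * bracket v)).mono'
    (hr.measurable.comp (measurable_id.prodMk measurable_const)).aestronglyMeasurable
    (Eventually.of_forall fun u => ?_)
  rw [Real.norm_of_nonneg (hr.nonneg _ _)]
  exact (hr.upper_mul u v).trans_eq (by ring)

theorem measurable_nu0 : Measurable (nu0 r) :=
  (hr.measurable.stronglyMeasurable.integral_prod_left').measurable

theorem nu0_le (v : V) : nu0 r v ≤ 2 * C * (∫ u, maxwellian u * bracket u) * bracket v := by
  have h := integral_mono (hr.integrable_left v)
    (integrable_maxwellian_mul_bracket.const_mul (2 * C * bracket v))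
    (fun u => (hr.upper_mul u v).trans_eq (by ring))
  rw [integral_const_mul] at h
  exact h.trans_eq (by ring)

/-- The minorization `r(u, v) ≥ C⁻¹ M(u)` bounds the collision frequency below. -/
theorem le_nu0 (v : V) : C⁻¹ * ∫ u, maxwellian u ≤ nu0 r v := by
  rw [← integral_const_mul]
  exact integral_mono (integrable_maxwellian_real.const_mul _) (hr.integrable_left v)
    (fun u => hr.minorization u v)

theorem minorization_mass_pos : 0 < C⁻¹ * ∫ u, maxwellian u :=
  mul_pos (inv_pos.2 hr.pos) (integral_pos_of_pos integrable_maxwellian_real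
    maxwellian_pos)

theorem nu0_pos (v : V) : 0 < nu0 r v := hr.minorization_mass_pos.trans_le (hr.le_nu0 v)

theorem inv_nu0_le (v : V) : (nu0 r v)⁻¹ ≤ (C⁻¹ * ∫ u, maxwellian u)⁻¹ :=
  inv_anti₀ hr.minorization_mass_pos (hr.le_nu0 v)

theorem integrable_mul_div_nu0 {g : V → ℝ} (hg : Integrable g) :
    Integrable fun v => g v / nu0 r v := by
  simp only [div_eq_mul_inv]
  refine hg.mul_bdd (c := (C⁻¹ * ∫ u, maxwellian u)⁻¹) hr.measurable_nu0.inv.aestronglyMeasurable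
    (Eventually.of_forall fun v => ?_)
  rw [norm_inv, Real.norm_of_nonneg (hr.nu0_pos v).le]
  exact hr.inv_nu0_le v

/-- An upper bound for the contribution of the rank one part `C⁻¹ M ∫ f` of the gain term to
`∫ · / ν₀`. -/
theorem inv_mul_integral_maxwellian_div_nu0_le_one : C⁻¹ * ∫ v, maxwellian v / nu0 r v ≤ 1 := by
  have h1 : ∫ v, maxwellian v / nu0 r v ≤ ∫ v, maxwellian v * (C⁻¹ * ∫ u, maxwellian u)⁻¹ :=
    integral_mono (hr.integrable_mul_div_nu0 integrable_maxwellian_real)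
      (integrable_maxwellian_real.mul_const _) fun v =>
        mul_le_mul_of_nonneg_left (hr.inv_nu0_le v) (maxwellian_pos v).le
  rw [integral_mul_const] at h1
  have h2 := mul_le_mul_of_nonneg_left h1 (inv_pos.2 hr.pos).le
  rwa [← mul_assoc, mul_inv_cancel₀ hr.minorization_mass_pos.ne'] at h2

/-- The weight `1 / ν₀`, integrated over the velocities `v` after a collision at velocity `u`, is at
least proportional to the collision frequency, that is, to `⟨u⟩`. -/
theorem exists_le_integral_div_nu0 : ∃ c₂, 0 < c₂ ∧ ∀ u, c₂ * bracket u ≤ ∫ v, r v u / nu0 r v := by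
  obtain ⟨D, hDpos, hD⟩ : ∃ D, 0 < D ∧ ∀ v, nu0 r v ≤ D * bracket v :=
    ⟨_, mul_pos (mul_pos two_pos hr.pos) (integral_pos_of_pos
      integrable_maxwellian_mul_bracket
      fun v => mul_pos (maxwellian_pos v) (bracket_pos v)), hr.nu0_le⟩
  have hgc : Continuous fun v => maxwellian v / bracket v ^ 2 :=
    continuous_maxwellian.div (continuous_bracket.pow 2) fun v => (pow_pos (bracket_pos v) 2).ne'
  have hgp : ∀ v, 0 < maxwellian v / bracket v ^ 2 := fun v =>
    div_pos (maxwellian_pos v) (pow_pos (bracket_pos v) 2)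
  have hgi : Integrable fun v => maxwellian v / bracket v ^ 2 := by
    refine integrable_maxwellian_real.mono' hgc.aestronglyMeasurable
      (Eventually.of_forall fun v => ?_)
    rw [Real.norm_of_nonneg (hgp v).le]
    exact div_le_self (maxwellian_pos v).le (one_le_pow₀ (one_le_bracket v))
  have hCpos := hr.pos
  refine ⟨C⁻¹ / 2 / D * ∫ v, maxwellian v / bracket v ^ 2,
    mul_pos (by positivity) (integral_pos_of_pos hgi hgp), fun u => ?_⟩
  rw [mul_right_comm, ← integral_const_mul]
  refine integral_mono (hgi.const_mul _) (hr.integrable_mul_div_nu0 (hr.integrable_left u))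
    fun v => ?_
  have h1 := hr.lower_mul v u
  have h2 := hD v
  rw [le_div_iff₀ (hr.nu0_pos v)]
  have hb := bracket_pos v
  have hu := bracket_pos u
  have hm := maxwellian_pos v
  calc C⁻¹ / 2 / D * bracket u * (maxwellian v / bracket v ^ 2) * nu0 r v
      ≤ C⁻¹ / 2 / D * bracket u * (maxwellian v / bracket v ^ 2) * (D * bracket v) := by
        gcongr
    _ = C⁻¹ / 2 * (maxwellian v / bracket v) * bracket u := by field_simp
    _ ≤ r v u := h1

theorem integrable_kernel_mul {f : V → ℂ} (hf : WeightedIntegrable f) :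
    Integrable (fun p : V × V => (r p.1 p.2 : ℂ) * f p.2) (volume.prod volume) := by
  refine ((integrable_maxwellian_mul_bracket.mul_prod hf.integrable_bracket_mul_norm).const_mul
    (2 * C)).mono' ((Complex.measurable_ofReal.comp hr.measurable).aestronglyMeasurable.mul
      hf.aestronglyMeasurable.comp_snd) (Eventually.of_forall fun p => ?_)
  rw [norm_mul, Complex.norm_real, Real.norm_of_nonneg (hr.nonneg _ _)]
  exact (mul_le_mul_of_nonneg_right (hr.upper_mul _ _) (norm_nonneg _)).trans_eq (by ring)

theorem integrable_K0 {f : V → ℂ} (hf : WeightedIntegrable f) : Integrable (K0 r f) :=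
  (hr.integrable_kernel_mul hf).integral_prod_left

/-- Collisions with the background conserve mass. -/
theorem integral_K0 {f : V → ℂ} (hf : WeightedIntegrable f) :
    ∫ v, K0 r f v = ∫ v, (nu0 r v : ℂ) * f v := by
  have := integral_integral_swap (f := fun v u => (r v u : ℂ) * f u) (hr.integrable_kernel_mul hf)
  simp only [K0]
  rw [this]
  refine integral_congr_ae (Eventually.of_forall fun u => ?_)
  simp only [nu0]
  rw [integral_mul_const, integral_complex_ofReal]

/-- The gain term without its rank one part `C⁻¹ M ∫ f`, estimated in the weight `1 - η / ν₀`. -/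
theorem integral_weight_mul_norm_K0_sub_le {c₂ : ℝ}
    (hc₂ : ∀ u, c₂ * bracket u ≤ ∫ v, r v u / nu0 r v) {η : ℝ} (hη : 0 ≤ η)
    (hη' : η ≤ C⁻¹ * ∫ u, maxwellian u) {f : V → ℂ} (hf : WeightedIntegrable f) :
    ∫ v, (1 - η / nu0 r v) * ‖K0 r f v - (C⁻¹ * maxwellian v : ℝ) * ∫ u, f u‖ ≤
      ∫ v, (nu0 r v - C⁻¹ * (∫ u, maxwellian u) - η * c₂ * bracket v + η) * ‖f v‖ := by
  set a := C⁻¹ * ∫ u, maxwellian u with ha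
  have hw0 : ∀ v, 0 ≤ 1 - η / nu0 r v := fun v => by
    rw [sub_nonneg, div_le_one (hr.nu0_pos v)]
    exact hη'.trans (hr.le_nu0 v)
  have hw1 : ∀ v, 1 - η / nu0 r v ≤ 1 := fun v =>
    sub_le_self _ (div_nonneg hη (hr.nu0_pos v).le)
  have hwm : Measurable fun v => 1 - η / nu0 r v := (hr.measurable_nu0.const_div η).const_sub 1
  have hrm : ∀ v u, 0 ≤ r v u - C⁻¹ * maxwellian v := fun v u => sub_nonneg.2 (hr.minorization v u)
  have hprod : Integrable (fun p : V × V => (1 - η / nu0 r p.1) *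
      ((r p.1 p.2 - C⁻¹ * maxwellian p.1) * ‖f p.2‖)) (volume.prod volume) := by
    refine (hr.integrable_kernel_mul hf).mono ?_ (Eventually.of_forall fun p => ?_)
    · exact (hwm.comp measurable_fst).aestronglyMeasurable.mul
        ((hr.measurable.sub ((continuous_maxwellian.measurable.comp measurable_fst).const_mul
          _)).aestronglyMeasurable.mul hf.aestronglyMeasurable.norm.comp_snd)
    · have hm := hrm p.1 p.2
      rw [Real.norm_of_nonneg (mul_nonneg (hw0 _) (mul_nonneg hm (norm_nonneg _))),
        norm_mul, Complex.norm_real, Real.norm_of_nonneg (hr.nonneg _ _)]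
      refine (mul_le_of_le_one_left (mul_nonneg hm (norm_nonneg _)) (hw1 _)).trans ?_
      refine mul_le_mul_of_nonneg_right ?_ (norm_nonneg _)
      have : 0 ≤ C⁻¹ * maxwellian p.1 := mul_nonneg (inv_pos.2 hr.pos).le (maxwellian_pos _).le
      linarith
  calc ∫ v, (1 - η / nu0 r v) * ‖K0 r f v - (C⁻¹ * maxwellian v : ℝ) * ∫ u, f u‖
      ≤ ∫ v, ∫ u, (1 - η / nu0 r v) * ((r v u - C⁻¹ * maxwellian v) * ‖f u‖) := by
        refine integral_mono_of_nonneg (Eventually.of_forall fun v => mul_nonneg (hw0 v)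
          (norm_nonneg _)) hprod.integral_prod_left ?_
        filter_upwards [(hr.integrable_kernel_mul hf).prod_right_ae] with v hv
        have h1 : K0 r f v - (C⁻¹ * maxwellian v : ℝ) * ∫ u, f u =
            ∫ u, ((r v u - C⁻¹ * maxwellian v : ℝ) : ℂ) * f u := by
          rw [K0, ← integral_const_mul, ← integral_sub hv (hf.integrable.const_mul _)]
          refine integral_congr_ae (Eventually.of_forall fun u => ?_)
          simp only [Complex.ofReal_sub]
          ring
        rw [integral_const_mul, h1]
        refine mul_le_mul_of_nonneg_left ((norm_integral_le_integral_norm _).trans_eq ?_) (hw0 v)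
        refine integral_congr_ae (Eventually.of_forall fun u => ?_)
        simp only
        rw [norm_mul, Complex.norm_real, Real.norm_of_nonneg (hrm v u)]
    _ = ∫ u, ∫ v, (1 - η / nu0 r v) * ((r v u - C⁻¹ * maxwellian v) * ‖f u‖) :=
        integral_integral_swap hprod
    _ ≤ _ := by
        refine integral_mono hprod.integral_prod_right ?_ fun u => ?_
        · refine hf.integrable_mul_norm (D := 2 * C * (∫ u, maxwellian u * bracket u) + a +
            |η * c₂| + η) ?_ fun v => ?_
          · exact ((hr.measurable_nu0.sub_const _).sub
              (continuous_bracket.measurable.const_mul _)).add_const _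
          · have h1 := hr.nu0_le v
            have h2 := one_le_bracket v
            have h3 := hr.nu0_pos v
            have h4 := hr.minorization_mass_pos
            calc |nu0 r v - a - η * c₂ * bracket v + η|
                ≤ |nu0 r v| + |a| + |η * c₂ * bracket v| + |η| := by
                  refine (abs_add_le _ _).trans (add_le_add ?_ le_rfl)
                  refine (abs_sub _ _).trans (add_le_add ?_ le_rfl)
                  exact abs_sub _ _
              _ ≤ _ := by
                  rw [abs_of_pos h3, abs_of_pos h4, abs_mul _ (bracket v),
                    abs_of_pos (bracket_pos v), abs_of_nonneg hη]
                  nlinarith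
        · have e1 : ∀ v, (1 - η / nu0 r v) * ((r v u - C⁻¹ * maxwellian v) * ‖f u‖) =
              (r v u - C⁻¹ * maxwellian v - η * (r v u / nu0 r v)
                + η * C⁻¹ * (maxwellian v / nu0 r v)) * ‖f u‖ := fun v => by
            have := (hr.nu0_pos v).ne'
            field_simp
            ring
          simp only [e1]
          rw [integral_mul_const]
          refine mul_le_mul_of_nonneg_right ?_ (norm_nonneg _)
          have i1 := hr.integrable_left u
          have i2 := integrable_maxwellian_real.const_mul C⁻¹
          have i3 := (hr.integrable_mul_div_nu0 i1).const_mul η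
          have i4 := (hr.integrable_mul_div_nu0 integrable_maxwellian_real).const_mul (η * C⁻¹)
          have i5 : Integrable fun v => r v u - C⁻¹ * maxwellian v := i1.sub i2
          have i6 : Integrable fun v => r v u - C⁻¹ * maxwellian v - η * (r v u / nu0 r v) :=
            i5.sub i3
          rw [integral_add i6 i4, integral_sub i5 i3, integral_sub i1 i2,
            integral_const_mul, integral_const_mul, integral_const_mul]
          have h1 := mul_le_mul_of_nonneg_left (hc₂ u) hη
          have h2 := hr.inv_mul_integral_maxwellian_div_nu0_le_one
          have h5 := mul_le_mul_of_nonneg_left h2 hη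
          have h6 : nu0 r u = ∫ v, r v u := rfl
          rw [← h6]
          nlinarith

end KernelBounds

/-! ### The linearized collision operator on weighted `L¹` -/

theorem rate_le (v : V) (p : V × S2) : rate v p ≤ 2 * bracket p.1 * bracket v := by
  refine (abs_real_inner_le_norm _ _).trans ?_
  have : ‖(p.2 : V)‖ = 1 := by simp
  rw [this, mul_one]
  exact (norm_le_bracket _).trans (bracket_sub_le _ _)

theorem rate_nonneg (v : V) (p : V × S2) : 0 ≤ rate v p := abs_nonneg _

theorem continuous_rate : Continuous fun q : V × (V × S2) => rate q.1 q.2 := by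
  unfold rate
  fun_prop

instance : SFinite collisionMeasure :=
  Measure.prod.instSFinite

/-- The density of `ν₁ f` on `(v, (u, ω))` space. -/
def lossDensity (f : V → ℂ) (q : V × (V × S2)) : ℂ :=
  ((rate q.1 q.2 * maxwellian q.2.1 : ℝ) : ℂ) * f q.1

/-- Exchange of the two collision partners. -/
def swapPartners (q : V × (V × S2)) : V × (V × S2) := (q.2.1, (q.1, q.2.2))

/-- The collision map `(v, (u, ω)) ↦ (v', (u', ω))`. -/
def collide (q : V × (V × S2)) : V × (V × S2) := (vPost q.1 q.2, (uPost q.1 q.2, q.2.2))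

/-- The collision map at fixed `ω`, as a linear map in `(v, u)`. -/
def collideLinear (w : V) : V × V →ₗ[ℝ] V × V where
  toFun q := (q.1 + inner ℝ (q.2 - q.1) w • w, q.2 - inner ℝ (q.2 - q.1) w • w)
  map_add' p q := by
    simp only [Prod.fst_add, Prod.snd_add, Prod.mk_add_mk, Prod.mk.injEq, inner_sub_left,
      inner_add_left]
    constructor <;> module
  map_smul' c q := by
    simp only [Prod.smul_fst, Prod.smul_snd, Prod.smul_mk, Prod.mk.injEq, inner_sub_left,
      real_inner_smul_left, RingHom.id_apply]
    constructor <;> module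

theorem inner_self_sphere (w : S2) : inner ℝ (w : V) (w : V) = 1 := by
  rw [real_inner_self_eq_norm_sq, norm_eq_of_mem_sphere, one_pow]

theorem collideLinear_comp_self (w : S2) : collideLinear w ∘ₗ collideLinear w = LinearMap.id := by
  refine LinearMap.ext fun q => ?_
  simp only [collideLinear, LinearMap.comp_apply, LinearMap.coe_mk, AddHom.coe_mk,
    LinearMap.id_apply]
  simp only [inner_sub_left, inner_add_left, real_inner_smul_left, inner_self_sphere]
  refine Prod.ext ?_ ?_ <;> simp only <;> module

/-- Being an involution, the collision map has determinant `±1`, so it preserves volume. -/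
theorem map_collideLinear (w : S2) :
    Measure.map (collideLinear w) ((volume : Measure V).prod volume) =
      (volume : Measure V).prod volume := by
  have hdet :
      LinearMap.det (collideLinear (w : V)) * LinearMap.det (collideLinear (w : V)) = 1 := by
    rw [← LinearMap.det_comp, collideLinear_comp_self, LinearMap.det_id]
  have habs : |LinearMap.det (collideLinear (w : V))| = 1 := by
    rcases mul_self_eq_one_iff.1 hdet with h | h <;> simp [h]
  have hne : LinearMap.det (collideLinear (w : V)) ≠ 0 := fun h => by simp [h] at habs
  rw [Measure.map_linearMap_addHaar_eq_smul_addHaar _ hne, abs_inv, habs]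
  simp

theorem measurePreserving_swapPartners :
    MeasurePreserving swapPartners ((volume : Measure V).prod collisionMeasure)
      ((volume : Measure V).prod collisionMeasure) := by
  have h1 := measurePreserving_prodAssoc (volume : Measure V) (volume : Measure V)
    (volume : Measure V).toSphere
  have h2 := (Measure.measurePreserving_swap (μ := (volume : Measure V))
    (ν := (volume : Measure V))).prod (MeasurePreserving.id (volume : Measure V).toSphere)
  exact (h1.comp h2).comp (h1.symm _)

theorem measurePreserving_collide :
    MeasurePreserving collide ((volume : Measure V).prod collisionMeasure)
      ((volume : Measure V).prod collisionMeasure) := by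
  have h1 := measurePreserving_prodAssoc (volume : Measure V) (volume : Measure V)
    (volume : Measure V).toSphere
  have h2 := Measure.measurePreserving_swap (μ := (volume : Measure V).prod (volume : Measure V))
    (ν := (volume : Measure V).toSphere)
  have h3 : MeasurePreserving (fun p : S2 × (V × V) => (id p.1, collideLinear (p.1 : V) p.2))
      ((volume : Measure V).toSphere.prod ((volume : Measure V).prod volume))
      ((volume : Measure V).toSphere.prod ((volume : Measure V).prod volume)) := by
    refine (MeasurePreserving.id _).skew_product (g := fun (w : S2) q => collideLinear (w : V) q) ?_
      (Eventually.of_forall map_collideLinear)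
    have : Continuous fun p : S2 × (V × V) => collideLinear (p.1 : V) p.2 := by
      simp only [collideLinear, LinearMap.coe_mk, AddHom.coe_mk]
      fun_prop
    exact this.measurable
  have h4 := Measure.measurePreserving_swap (μ := (volume : Measure V).toSphere)
    (ν := (volume : Measure V).prod (volume : Measure V))
  exact (((h1.comp h4).comp h3).comp h2).comp (h1.symm _)

theorem rate_swap (q : V × (V × S2)) :
    rate (swapPartners q).1 (swapPartners q).2 = rate q.1 q.2 := by
  simp only [rate, swapPartners]
  rw [← neg_sub, inner_neg_left, abs_neg]

theorem rate_collide (q : V × (V × S2)) : rate (collide q).1 (collide q).2 = rate q.1 q.2 := by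
  simp only [rate, collide, uPost, vPost, inner_sub_left, inner_add_left, real_inner_smul_left,
    inner_self_sphere]
  rw [← abs_neg]
  congr 1
  ring

/-- The three terms of `K₁` are fibre integrals of the density of `ν₁ f` transported by the measure
preserving maps that exchange the partners, collide them, and do both. -/
theorem K1_eq (f : V → ℂ) (v : V) :
    K1 f v = (∫ p, lossDensity f (swapPartners (v, p)) ∂collisionMeasure)
      - (∫ p, lossDensity f (collide (v, p)) ∂collisionMeasure)
      - ∫ p, lossDensity f (swapPartners (collide (v, p))) ∂collisionMeasure := by
  simp only [lossDensity, rate_swap, rate_collide]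
  rfl

section

variable {f : V → ℂ}

theorem integrable_maxwellian_mul_bracket_collisionMeasure :
    Integrable (fun p : V × S2 => maxwellian p.1 * bracket p.1) collisionMeasure :=
  integrable_maxwellian_mul_bracket.comp_fst _

theorem nu1_nonneg (v : V) : 0 ≤ nu1 v :=
  integral_nonneg fun _ => mul_nonneg (rate_nonneg _ _) (maxwellian_pos _).le

theorem exists_nu1_le : ∃ D, 0 ≤ D ∧ ∀ v, nu1 v ≤ D * bracket v := by
  refine ⟨2 * ∫ p : V × S2, maxwellian p.1 * bracket p.1 ∂collisionMeasure,
    mul_nonneg zero_le_two (integral_nonneg fun _ =>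
      (mul_pos (maxwellian_pos _) (bracket_pos _)).le), fun v => ?_⟩
  rw [mul_right_comm, ← integral_const_mul]
  refine integral_mono_of_nonneg (Eventually.of_forall fun p =>
    mul_nonneg (rate_nonneg _ _) (maxwellian_pos _).le)
    (integrable_maxwellian_mul_bracket_collisionMeasure.const_mul _)
    (Eventually.of_forall fun p => ?_)
  exact (mul_le_mul_of_nonneg_right (rate_le v p) (maxwellian_pos _).le).trans_eq (by ring)

theorem measurable_nu1 : Measurable nu1 :=
  ((continuous_rate.mul (continuous_maxwellian.comp
    (continuous_fst.comp continuous_snd))).stronglyMeasurable.integral_prod_right').measurable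

theorem integrable_lossDensity (hf : WeightedIntegrable f) :
    Integrable (lossDensity f) ((volume : Measure V).prod collisionMeasure) := by
  have hi := (hf.integrable_bracket_mul_norm.mul_prod
    integrable_maxwellian_mul_bracket_collisionMeasure).const_mul 2
  refine hi.mono' (AEStronglyMeasurable.mul ?_ hf.aestronglyMeasurable.comp_fst)
    (Eventually.of_forall fun q => ?_)
  · exact (Complex.continuous_ofReal.comp (continuous_rate.mul (continuous_maxwellian.comp
      (continuous_fst.comp continuous_snd)))).aestronglyMeasurable
  · rw [lossDensity, norm_mul, Complex.norm_real,
      Real.norm_of_nonneg (mul_nonneg (rate_nonneg _ _) (maxwellian_pos _).le)]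
    have h1 := mul_le_mul_of_nonneg_right (rate_le q.1 q.2) (maxwellian_pos q.2.1).le
    exact (mul_le_mul_of_nonneg_right h1 (norm_nonneg _)).trans_eq (by ring)

theorem integral_norm_lossDensity (hf : WeightedIntegrable f) :
    ∫ q, ‖lossDensity f q‖ ∂((volume : Measure V).prod collisionMeasure) =
      ∫ v, nu1 v * ‖f v‖ := by
  rw [integral_prod _ (integrable_lossDensity hf).norm]
  refine integral_congr_ae (Eventually.of_forall fun v => ?_)
  simp only [lossDensity, norm_mul, Complex.norm_real]
  rw [integral_mul_const]
  congr 1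
  refine integral_congr_ae (Eventually.of_forall fun p => ?_)
  simp only
  rw [← norm_mul, Real.norm_of_nonneg (mul_nonneg (rate_nonneg _ _) (maxwellian_pos _).le)]

theorem integral_lossDensity (hf : WeightedIntegrable f) :
    ∫ q, lossDensity f q ∂((volume : Measure V).prod collisionMeasure) =
      ∫ v, (nu1 v : ℂ) * f v := by
  rw [integral_prod _ (integrable_lossDensity hf)]
  refine integral_congr_ae (Eventually.of_forall fun v => ?_)
  simp only [lossDensity]
  rw [integral_mul_const, integral_complex_ofReal]
  rfl

theorem integrable_lossDensity_comp (hf : WeightedIntegrable f) {T : V × (V × S2) → V × (V × S2)}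
    (hT : MeasurePreserving T ((volume : Measure V).prod collisionMeasure)
      ((volume : Measure V).prod collisionMeasure)) :
    Integrable (fun q => lossDensity f (T q)) ((volume : Measure V).prod collisionMeasure) :=
  (hT.integrable_comp (integrable_lossDensity hf).aestronglyMeasurable).2
    (integrable_lossDensity hf)

theorem integral_norm_fibre_le (hf : WeightedIntegrable f) {T : V × (V × S2) → V × (V × S2)}
    (hT : MeasurePreserving T ((volume : Measure V).prod collisionMeasure)
      ((volume : Measure V).prod collisionMeasure)) :
    ∫ v, ‖∫ p, lossDensity f (T (v, p)) ∂collisionMeasure‖ ≤ ∫ v, nu1 v * ‖f v‖ := by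
  have h := integrable_lossDensity_comp hf hT
  calc _ ≤ ∫ v, ∫ p, ‖lossDensity f (T (v, p))‖ ∂collisionMeasure :=
        integral_mono h.integral_prod_left.norm h.norm.integral_prod_left
          fun v => norm_integral_le_integral_norm _
    _ = ∫ q, ‖lossDensity f (T q)‖ ∂((volume : Measure V).prod collisionMeasure) :=
        (integral_prod _ h.norm).symm
    _ = _ := by
        rw [← integral_norm_lossDensity hf]
        conv_rhs => rw [← hT.map_eq]
        rw [integral_map hT.measurable.aemeasurable]
        rw [hT.map_eq]
        exact (integrable_lossDensity hf).aestronglyMeasurable.norm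

theorem integral_fibre (hf : WeightedIntegrable f) {T : V × (V × S2) → V × (V × S2)}
    (hT : MeasurePreserving T ((volume : Measure V).prod collisionMeasure)
      ((volume : Measure V).prod collisionMeasure)) :
    ∫ v, ∫ p, lossDensity f (T (v, p)) ∂collisionMeasure = ∫ v, (nu1 v : ℂ) * f v := by
  rw [← integral_prod _ (integrable_lossDensity_comp hf hT), ← integral_lossDensity hf]
  conv_rhs => rw [← hT.map_eq]
  rw [integral_map hT.measurable.aemeasurable]
  rw [hT.map_eq]
  exact (integrable_lossDensity hf).aestronglyMeasurable

theorem fibre_congr {g : V → ℂ} (hfg : f =ᵐ[volume] g) {T : V × (V × S2) → V × (V × S2)}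
    (hT : MeasurePreserving T ((volume : Measure V).prod collisionMeasure)
      ((volume : Measure V).prod collisionMeasure)) :
    ∀ᵐ v, ∫ p, lossDensity f (T (v, p)) ∂collisionMeasure =
      ∫ p, lossDensity g (T (v, p)) ∂collisionMeasure := by
  have h1 : lossDensity f =ᵐ[(volume : Measure V).prod collisionMeasure] lossDensity g := by
    filter_upwards [Measure.quasiMeasurePreserving_fst.ae_eq_comp hfg] with q hq
    simp only [Function.comp_apply] at hq
    rw [lossDensity, lossDensity, hq]
  filter_upwards [Measure.ae_ae_of_ae_prod (hT.quasiMeasurePreserving.ae_eq_comp h1)] with v hv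
  exact integral_congr_ae hv

theorem integrable_K1 (hf : WeightedIntegrable f) : Integrable (K1 f) := by
  have h : K1 f = fun v => _ := funext (K1_eq f)
  rw [h]
  exact (((integrable_lossDensity_comp hf measurePreserving_swapPartners).integral_prod_left).sub
    (integrable_lossDensity_comp hf measurePreserving_collide).integral_prod_left).sub
    (integrable_lossDensity_comp hf
      (measurePreserving_swapPartners.comp measurePreserving_collide)).integral_prod_left

theorem integral_norm_K1_le (hf : WeightedIntegrable f) :
    ∫ v, ‖K1 f v‖ ≤ 3 * ∫ v, nu1 v * ‖f v‖ := by
  have i1 := (integrable_lossDensity_comp hf measurePreserving_swapPartners).integral_prod_left.norm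
  have i2 := (integrable_lossDensity_comp hf measurePreserving_collide).integral_prod_left.norm
  have i3 := (integrable_lossDensity_comp hf
    (measurePreserving_swapPartners.comp measurePreserving_collide)).integral_prod_left.norm
  have h := integral_mono (integrable_K1 hf).norm ((i1.add i2).add i3) fun v => by
    simp only [K1_eq, Pi.add_apply]
    exact (norm_sub_le _ _).trans (add_le_add (norm_sub_le _ _) le_rfl)
  refine h.trans ?_
  rw [integral_add' (i1.add i2) i3, integral_add' i1 i2]
  have h1 := integral_norm_fibre_le hf measurePreserving_swapPartners
  have h2 := integral_norm_fibre_le hf measurePreserving_collide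
  have h3 := integral_norm_fibre_le hf
    (measurePreserving_swapPartners.comp measurePreserving_collide)
  simp only [Function.comp_apply] at h3 ⊢
  linarith

/-- Collisions conserve mass. -/
theorem integral_K1 (hf : WeightedIntegrable f) : ∫ v, K1 f v = -∫ v, (nu1 v : ℂ) * f v := by
  have i1 := (integrable_lossDensity_comp hf measurePreserving_swapPartners).integral_prod_left
  have i2 := (integrable_lossDensity_comp hf measurePreserving_collide).integral_prod_left
  have i3 := (integrable_lossDensity_comp hf
    (measurePreserving_swapPartners.comp measurePreserving_collide)).integral_prod_left
  have h3 := integral_fibre hf (measurePreserving_swapPartners.comp measurePreserving_collide)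
  simp only [K1_eq]
  simp only [Function.comp_apply] at h3 i3
  have i12 : Integrable fun v => (∫ p, lossDensity f (swapPartners (v, p)) ∂collisionMeasure)
      - ∫ p, lossDensity f (collide (v, p)) ∂collisionMeasure := i1.sub i2
  rw [integral_sub i12 i3, integral_sub i1 i2, integral_fibre hf measurePreserving_swapPartners,
    integral_fibre hf measurePreserving_collide, h3]
  ring

theorem K1_congr {g : V → ℂ} (hfg : f =ᵐ[volume] g) : K1 f =ᵐ[volume] K1 g := by
  filter_upwards [fibre_congr hfg measurePreserving_swapPartners,
    fibre_congr hfg measurePreserving_collide,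
    fibre_congr hfg (measurePreserving_swapPartners.comp measurePreserving_collide)] with v h1 h2 h3
  simp only [Function.comp_apply] at h3
  rw [K1_eq, K1_eq, h1, h2, h3]

theorem K1_add {g : V → ℂ} (hf : WeightedIntegrable f) (hg : WeightedIntegrable g) :
    K1 (fun v => f v + g v) =ᵐ[volume] fun v => K1 f v + K1 g v := by
  have key : ∀ {T : V × (V × S2) → V × (V × S2)}, MeasurePreserving T
      ((volume : Measure V).prod collisionMeasure) ((volume : Measure V).prod collisionMeasure) →
      ∀ᵐ v, ∫ p, lossDensity (fun v => f v + g v) (T (v, p)) ∂collisionMeasure =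
        (∫ p, lossDensity f (T (v, p)) ∂collisionMeasure) +
          ∫ p, lossDensity g (T (v, p)) ∂collisionMeasure := by
    intro T hT
    filter_upwards [(integrable_lossDensity_comp hf hT).prod_right_ae,
      (integrable_lossDensity_comp hg hT).prod_right_ae] with v h1 h2
    rw [← integral_add h1 h2]
    simp only [lossDensity, mul_add]
  filter_upwards [key measurePreserving_swapPartners, key measurePreserving_collide,
    key (measurePreserving_swapPartners.comp measurePreserving_collide)] with v h1 h2 h3
  simp only [Function.comp_apply] at h3
  rw [K1_eq, K1_eq, K1_eq, h1, h2, h3]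
  ring

theorem K1_const_mul (c : ℂ) (f : V → ℂ) (v : V) : K1 (fun v => c * f v) v = c * K1 f v := by
  have key : ∀ T : V × (V × S2) → V × (V × S2),
      ∫ p, lossDensity (fun v => c * f v) (T (v, p)) ∂collisionMeasure =
        c * ∫ p, lossDensity f (T (v, p)) ∂collisionMeasure := fun T => by
    rw [← integral_const_mul]
    simp only [lossDensity, mul_left_comm c]
  have h3 := key (swapPartners ∘ collide)
  simp only [Function.comp_apply] at h3
  rw [K1_eq, K1_eq, key, key, h3]
  ring

end

/-! ### The mixing seminorm -/

/-- If `φ' = l φ - ψ` and `φ` vanishes at infinity, then `φ` is the resolvent at `l` of the left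
translation semigroup applied to `ψ`. In the norm of `L¹(0, ∞)` translation loses mass at the rate
`‖φ 0‖`, which improves the contraction estimate for the resolvent. -/
theorem integral_norm_resolvent_translation_le {φ ψ : ℝ → ℂ} {l : ℝ} (hl : 0 ≤ l)
    (hc : ContinuousOn φ (Set.Ici 0)) (hd : ∀ t, 0 < t → HasDerivAt φ (l • φ t - ψ t) t)
    (hφ : IntegrableOn φ (Set.Ioi 0)) (hψ : IntegrableOn ψ (Set.Ioi 0))
    (hlim : Tendsto φ atTop (𝓝 0)) :
    l * (∫ t in Set.Ioi 0, ‖φ t‖) + ‖φ 0‖ ≤ ∫ t in Set.Ioi 0, ‖ψ t‖ := by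
  have hIcc : ∀ T : ℝ, 0 ≤ T → ∀ {h : ℝ → ℂ}, IntegrableOn h (Set.Ioi 0) →
      IntegrableOn (fun t => ‖h t‖) (Set.Icc 0 T) := fun T _ h hh => by
    rw [integrableOn_Icc_iff_integrableOn_Ioc]
    exact (hh.mono_set Set.Ioc_subset_Ioi_self).norm
  have key : ∀ T, 0 ≤ T →
      l * (∫ t in (0)..T, ‖φ t‖) + ‖φ 0‖ ≤ ‖φ T‖ + ∫ t in (0)..T, ‖ψ t‖ := by
    intro T hT
    have iφ : IntervalIntegrable (fun t => ‖φ t‖) volume 0 T :=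
      (intervalIntegrable_iff_integrableOn_Icc_of_le hT).2 (hIcc T hT hφ)
    have iψ : IntervalIntegrable (fun t => ‖ψ t‖) volume 0 T :=
      (intervalIntegrable_iff_integrableOn_Icc_of_le hT).2 (hIcc T hT hψ)
    -- `‖φ‖` need not be differentiable where it vanishes; it is approximated by `√(‖φ‖² + ε²)`
    have hε : ∀ ε : ℝ, 0 < ε → l * (∫ t in (0)..T, ‖φ t‖) + ‖φ 0‖ ≤
        ‖φ T‖ + (∫ t in (0)..T, ‖ψ t‖) + ε * (1 + l * T) := by
      intro ε hε
      set g : ℝ → ℝ := fun t => Real.sqrt (‖φ t‖ ^ 2 + ε ^ 2) with hg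
      have hgpos : ∀ t, 0 < ‖φ t‖ ^ 2 + ε ^ 2 := fun t => by positivity
      have hgsq : ∀ t, g t ^ 2 = ‖φ t‖ ^ 2 + ε ^ 2 := fun t => Real.sq_sqrt (hgpos t).le
      have hg0 : ∀ t, 0 < g t := fun t => Real.sqrt_pos.2 (hgpos t)
      have hgle : ∀ t, g t ≤ ‖φ t‖ + ε := fun t => by
        rw [hg, Real.sqrt_le_left (by positivity)]
        nlinarith [norm_nonneg (φ t)]
      have hgge : ∀ t, ‖φ t‖ ≤ g t := fun t => Real.le_sqrt_of_sq_le (by nlinarith)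
      have hderiv : ∀ t ∈ Set.Ioo 0 T, HasDerivWithinAt g
          (2 * inner ℝ (φ t) (l • φ t - ψ t) / (2 * g t)) (Set.Ioi t) t := fun t ht =>
        (((hd t ht.1).norm_sq.add_const _).sqrt (hgpos t).ne').hasDerivWithinAt
      have hle := intervalIntegral.integral_le_sub_of_hasDeriv_right_of_le (g := g)
        (φ := fun t => l * (‖φ t‖ - ε) - ‖ψ t‖) hT
        ((((hc.mono Set.Icc_subset_Ici_self).norm.pow 2).add continuousOn_const).sqrt) hderiv
        (((((hIcc T hT hφ).sub (integrableOn_const (by simp))).const_mul l)).sub (hIcc T hT hψ))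
        (fun t ht => by
          rw [le_div_iff₀ (mul_pos two_pos (hg0 t)), inner_sub_right, inner_smul_right,
            real_inner_self_eq_norm_sq]
          have h1 := real_inner_le_norm (φ t) (ψ t)
          have h2 := hgge t
          have h3 := hgle t
          have h4 : ‖φ t‖ * ‖ψ t‖ ≤ g t * ‖ψ t‖ := by gcongr
          have h5 : (‖φ t‖ - ε) * g t ≤ ‖φ t‖ ^ 2 := by
            rcases le_total ‖φ t‖ ε with h | h
            · nlinarith [hg0 t, sq_nonneg ‖φ t‖]
            · nlinarith
          have h6 := mul_le_mul_of_nonneg_left h5 hl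
          nlinarith)
      have hint : ∫ t in (0)..T, (l * (‖φ t‖ - ε) - ‖ψ t‖) =
          l * (∫ t in (0)..T, ‖φ t‖) - l * (T * ε) - ∫ t in (0)..T, ‖ψ t‖ := by
        rw [intervalIntegral.integral_sub ((iφ.sub (by simp)).const_mul l) iψ,
          intervalIntegral.integral_const_mul, intervalIntegral.integral_sub iφ (by simp)]
        simp
        ring
      rw [hint] at hle
      have h1 := hgle T
      have h2 := hgge 0
      linarith
    refine le_of_forall_pos_le_add fun δ hδ => ?_
    have hpos : 0 < 1 + l * T := by positivity
    have := hε (δ / (1 + l * T)) (by positivity)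
    rwa [div_mul_cancel₀ _ hpos.ne'] at this
  have h1 := intervalIntegral_tendsto_integral_Ioi 0 hφ.norm tendsto_id
  have h2 := intervalIntegral_tendsto_integral_Ioi 0 hψ.norm tendsto_id
  have h3 := (h1.const_mul l).add_const ‖φ 0‖
  have h4 := hlim.norm.add h2
  rw [norm_zero, zero_add] at h4
  refine le_of_tendsto_of_tendsto h3 h4 ?_
  filter_upwards [eventually_ge_atTop 0] with T hT using key T hT

/-- The function `ν₀(v) + i ξ · v`. -/
def symbol (r : V → V → ℝ) (ξ v : V) : ℂ := (nu0 r v : ℂ) + Complex.I * (inner ℝ ξ v : ℝ)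

/-- The mass at time `t` of the solution of `∂ₜ f + (ν₀ + i ξ · v) f = 0`. -/
def streamMass (r : V → V → ℝ) (ξ : V) (f : V → ℂ) (t : ℝ) : ℂ :=
  ∫ v, Complex.exp (-(t : ℂ) * symbol r ξ v) * f v

/-- The seminorm `∫₀^∞ |∫ exp(-t(ν₀ + i ξ · v)) f dv| dt`, which measures how much of the mass of
`f` survives phase mixing. -/
def mixing (r : V → V → ℝ) (ξ : V) (f : V → ℂ) : ℝ := ∫ t in Set.Ioi (0 : ℝ), ‖streamMass r ξ f t‖

theorem symbol_re (r : V → V → ℝ) (ξ v : V) : (symbol r ξ v).re = nu0 r v := by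
  simp [symbol]

theorem norm_exp_symbol (r : V → V → ℝ) (ξ v : V) (t : ℝ) :
    ‖Complex.exp (-(t : ℂ) * symbol r ξ v)‖ = Real.exp (-t * nu0 r v) := by
  rw [Complex.norm_exp, ← Complex.ofReal_neg, Complex.re_ofReal_mul, symbol_re]

theorem streamMass_zero (r : V → V → ℝ) (ξ : V) (f : V → ℂ) : streamMass r ξ f 0 = ∫ v, f v := by
  simp [streamMass]

theorem mixing_nonneg (r : V → V → ℝ) (ξ : V) (f : V → ℂ) : 0 ≤ mixing r ξ f :=
  integral_nonneg fun _ => norm_nonneg _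

theorem mixing_congr (r : V → V → ℝ) (ξ : V) {f g : V → ℂ} (h : f =ᵐ[volume] g) :
    mixing r ξ f = mixing r ξ g := by
  have : streamMass r ξ f = streamMass r ξ g := funext fun t =>
    integral_congr_ae (h.mono fun v hv => by simp only [hv])
  rw [mixing, this, mixing]

theorem mixing_const_mul (r : V → V → ℝ) (ξ : V) (c : ℂ) (f : V → ℂ) :
    mixing r ξ (fun v => c * f v) = ‖c‖ * mixing r ξ f := by
  have : ∀ t, streamMass r ξ (fun v => c * f v) t = c * streamMass r ξ f t := fun t => by
    rw [streamMass, streamMass, ← integral_const_mul]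
    simp only [mul_left_comm c]
  simp only [mixing, this, norm_mul]
  rw [integral_const_mul]

theorem norm_streamMass_le (r : V → V → ℝ) (ξ : V) (f : V → ℂ) (t : ℝ) :
    ‖streamMass r ξ f t‖ ≤ ∫ v, Real.exp (-t * nu0 r v) * ‖f v‖ := by
  refine (norm_integral_le_integral_norm _).trans_eq ?_
  simp only [norm_mul, norm_exp_symbol]

namespace KernelBounds

variable {r : V → V → ℝ} {C : ℝ} (hr : KernelBounds r C)
include hr

theorem measurable_symbol (ξ : V) : Measurable (symbol r ξ) := by
  have h1 : Measurable fun v : V => (inner ℝ ξ v : ℝ) := by fun_prop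
  exact (Complex.measurable_ofReal.comp hr.measurable_nu0).add
    ((Complex.measurable_ofReal.comp h1).const_mul _)

theorem exists_norm_symbol_le (ξ : V) : ∃ D, 0 ≤ D ∧ ∀ v, ‖symbol r ξ v‖ ≤ D * bracket v := by
  refine ⟨2 * C * (∫ u, maxwellian u * bracket u) + ‖ξ‖, ?_, fun v => ?_⟩
  · have := hr.pos
    exact add_nonneg (mul_nonneg (by positivity) (integral_nonneg fun v =>
      (mul_pos (maxwellian_pos v) (bracket_pos v)).le)) (norm_nonneg _)
  · rw [add_mul]
    refine (norm_add_le _ _).trans (add_le_add ?_ ?_)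
    · rw [Complex.norm_real, Real.norm_of_nonneg (hr.nu0_pos v).le]
      exact hr.nu0_le v
    · rw [norm_mul, Complex.norm_I, one_mul, Complex.norm_real]
      exact (norm_inner_le_norm _ _).trans
        (mul_le_mul_of_nonneg_left (norm_le_bracket v) (norm_nonneg _))

theorem norm_exp_symbol_le_one (ξ v : V) {t : ℝ} (ht : 0 ≤ t) :
    ‖Complex.exp (-(t : ℂ) * symbol r ξ v)‖ ≤ 1 := by
  rw [norm_exp_symbol, Real.exp_le_one_iff]
  nlinarith [hr.nu0_pos v]

theorem aestronglyMeasurable_exp_symbol_mul (ξ : V) {f : V → ℂ}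
    (hf : AEStronglyMeasurable f volume) (t : ℝ) :
    AEStronglyMeasurable (fun v => Complex.exp (-(t : ℂ) * symbol r ξ v) * f v) volume :=
  ((hr.measurable_symbol ξ).const_mul _).cexp.aestronglyMeasurable.mul hf

theorem integrable_exp_symbol_mul (ξ : V) {f : V → ℂ} (hf : Integrable f) {t : ℝ} (ht : 0 ≤ t) :
    Integrable fun v => Complex.exp (-(t : ℂ) * symbol r ξ v) * f v := by
  refine hf.norm.mono' (hr.aestronglyMeasurable_exp_symbol_mul ξ hf.aestronglyMeasurable t)
    (Eventually.of_forall fun v => ?_)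
  rw [norm_mul]
  exact mul_le_of_le_one_left (norm_nonneg _) (hr.norm_exp_symbol_le_one ξ v ht)

theorem integrable_exp_symbol_mul_prod (ξ : V) {f : V → ℂ} (hf : Integrable f) :
    Integrable (fun p : ℝ × V => Complex.exp (-(p.1 : ℂ) * symbol r ξ p.2) * f p.2)
      ((volume.restrict (Set.Ioi 0)).prod volume) := by
  set a := C⁻¹ * ∫ u, maxwellian u
  have ha : 0 < a := hr.minorization_mass_pos
  have h1 : Integrable (fun t : ℝ => Real.exp (-a * t)) (volume.restrict (Set.Ioi 0)) :=
    exp_neg_integrableOn_Ioi 0 ha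
  refine (h1.mul_prod hf.norm).mono'
    (AEStronglyMeasurable.mul ?_ hf.aestronglyMeasurable.comp_snd) ?_
  · refine (Measurable.cexp ?_).aestronglyMeasurable
    exact (Complex.measurable_ofReal.comp measurable_fst).neg.mul
      ((hr.measurable_symbol ξ).comp measurable_snd)
  · have h2 : ∀ᵐ p : ℝ × V ∂((volume.restrict (Set.Ioi 0)).prod volume), p.1 ∈ Set.Ioi 0 :=
      Measure.quasiMeasurePreserving_fst.ae (ae_restrict_mem measurableSet_Ioi)
    filter_upwards [h2] with p hp
    rw [norm_mul, norm_exp_symbol]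
    refine mul_le_mul_of_nonneg_right (Real.exp_le_exp.2 ?_) (norm_nonneg _)
    nlinarith [mul_le_mul_of_nonneg_left (hr.le_nu0 p.2) (Set.mem_Ioi.1 hp).le]

theorem integrableOn_streamMass (ξ : V) {f : V → ℂ} (hf : Integrable f) :
    IntegrableOn (streamMass r ξ f) (Set.Ioi 0) :=
  (hr.integrable_exp_symbol_mul_prod ξ hf).integral_prod_left

theorem integral_integral_exp_neg_mul_nu0 {g : V → ℝ} (hg : Integrable g) :
    ∫ t in Set.Ioi (0 : ℝ), ∫ v, Real.exp (-t * nu0 r v) * |g v| = ∫ v, |g v| / nu0 r v := by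
  have h := (hr.integrable_exp_symbol_mul_prod 0 hg.ofReal).norm
  simp only [norm_mul, norm_exp_symbol] at h
  have e := integral_integral_swap (f := fun (t : ℝ) v => Real.exp (-t * nu0 r v) * |g v|)
    (by simpa [Function.uncurry_def] using! h)
  rw [e]
  refine integral_congr_ae (Eventually.of_forall fun v => ?_)
  simp only
  rw [integral_mul_const]
  have := integral_exp_mul_Ioi (a := -nu0 r v) (by linarith [hr.nu0_pos v]) 0
  have e2 : ∀ t : ℝ, -t * nu0 r v = -nu0 r v * t := fun t => by ring
  simp only [e2]
  rw [this]
  have := (hr.nu0_pos v).ne'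
  simp
  field_simp

theorem integrableOn_integral_exp_neg_mul {f : V → ℂ} (hf : Integrable f) :
    IntegrableOn (fun t : ℝ => ∫ v, Real.exp (-t * nu0 r v) * ‖f v‖) (Set.Ioi 0) := by
  have h := (hr.integrable_exp_symbol_mul_prod 0 hf).norm.integral_prod_left
  simp only [norm_mul, norm_exp_symbol] at h
  exact h

theorem mixing_le (ξ : V) {f : V → ℂ} (hf : Integrable f) :
    mixing r ξ f ≤ ∫ v, ‖f v‖ / nu0 r v := by
  have h1 := hr.integral_integral_exp_neg_mul_nu0 hf.norm
  simp only [abs_norm] at h1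
  rw [← h1]
  exact integral_mono (hr.integrableOn_streamMass ξ hf).norm
    (hr.integrableOn_integral_exp_neg_mul hf) fun t => norm_streamMass_le r ξ f t

theorem mixing_add_le (ξ : V) {f g : V → ℂ} (hf : Integrable f) (hg : Integrable g) :
    mixing r ξ (fun v => f v + g v) ≤ mixing r ξ f + mixing r ξ g := by
  have i1 := (hr.integrableOn_streamMass ξ hf).norm
  have i2 := (hr.integrableOn_streamMass ξ hg).norm
  rw [mixing, mixing, mixing, ← integral_add i1 i2]
  refine integral_mono_of_nonneg (Eventually.of_forall fun _ => norm_nonneg _) (i1.add i2) ?_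
  filter_upwards [ae_restrict_mem measurableSet_Ioi] with t ht
  have ht : (0 : ℝ) < t := ht
  have : streamMass r ξ (fun v => f v + g v) t = streamMass r ξ f t + streamMass r ξ g t := by
    rw [streamMass, streamMass, streamMass, ← integral_add
      (hr.integrable_exp_symbol_mul ξ hf ht.le) (hr.integrable_exp_symbol_mul ξ hg ht.le)]
    simp only [mul_add]
  simp only [this]
  exact norm_add_le _ _

/-- Dissipativity of multiplication by `ν₀ + i ξ · v` in the mixing seminorm, with a gain given by
the mass: on the function `streamMass r ξ f` this multiplication acts as `-d/dt`. -/
theorem mul_mixing_add_norm_integral_le (ξ : V) {f : V → ℂ} (hf : WeightedIntegrable f) {l : ℝ}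
    (hl : 0 ≤ l) :
    l * mixing r ξ f + ‖∫ v, f v‖ ≤ mixing r ξ (fun v => (l + symbol r ξ v) * f v) := by
  obtain ⟨D, hD, hsym⟩ := hr.exists_norm_symbol_le ξ
  have hfi := hf.integrable
  have hsf : Integrable fun v => symbol r ξ v * f v :=
    hf.integrable_mul (hr.measurable_symbol ξ) hsym
  have hg : Integrable fun v => ((l : ℂ) + symbol r ξ v) * f v := by
    simp only [add_mul]
    exact (hfi.const_mul _).add hsf
  have hbound : Integrable fun v => D * (bracket v * ‖f v‖) :=
    hf.integrable_bracket_mul_norm.const_mul D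
  rw [← streamMass_zero r ξ f]
  refine integral_norm_resolvent_translation_le hl ?_ (fun t ht => ?_)
    (hr.integrableOn_streamMass ξ hfi) (hr.integrableOn_streamMass ξ hg) ?_
  · refine continuousOn_of_dominated (bound := fun v => ‖f v‖)
      (fun t _ => hr.aestronglyMeasurable_exp_symbol_mul ξ hfi.aestronglyMeasurable t)
      (fun t ht => Eventually.of_forall fun v => ?_) hfi.norm
      (Eventually.of_forall fun v => by fun_prop)
    rw [norm_mul]
    exact mul_le_of_le_one_left (norm_nonneg _) (hr.norm_exp_symbol_le_one ξ v ht)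
  · have hder := (hasDerivAt_integral_of_dominated_loc_of_deriv_le (𝕜 := ℝ)
      (F := fun (t : ℝ) v => Complex.exp (-(t : ℂ) * symbol r ξ v) * f v)
      (F' := fun (t : ℝ) v => Complex.exp (-(t : ℂ) * symbol r ξ v) * -(symbol r ξ v * f v))
      (bound := fun v => D * (bracket v * ‖f v‖)) (Ioi_mem_nhds ht)
      (Eventually.of_forall fun s =>
        hr.aestronglyMeasurable_exp_symbol_mul ξ hfi.aestronglyMeasurable s)
      (hr.integrable_exp_symbol_mul ξ hfi ht.le)
      (hr.aestronglyMeasurable_exp_symbol_mul ξ hsf.aestronglyMeasurable.neg t)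
      (Eventually.of_forall fun v s hs => ?_) hbound
      (Eventually.of_forall fun v s _ => ?_)).2
    · refine hder.congr_deriv ?_
      have e1 : streamMass r ξ (fun v => (l + symbol r ξ v) * f v) t =
          l • streamMass r ξ f t + streamMass r ξ (fun v => symbol r ξ v * f v) t := by
        have i1 : Integrable fun v => l • (Complex.exp (-(t : ℂ) * symbol r ξ v) * f v) :=
          (hr.integrable_exp_symbol_mul ξ hfi ht.le).smul l
        rw [streamMass, streamMass, streamMass, ← integral_smul,
          ← integral_add i1 (hr.integrable_exp_symbol_mul ξ hsf ht.le)]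
        refine integral_congr_ae (Eventually.of_forall fun v => ?_)
        simp only [Complex.real_smul]
        ring
      rw [e1, sub_add_cancel_left, streamMass, ← integral_neg]
      simp only [mul_neg]
    · rw [norm_mul, norm_neg, norm_mul, ← mul_assoc D]
      refine (mul_le_of_le_one_left (by positivity)
        (hr.norm_exp_symbol_le_one ξ v (le_of_lt hs))).trans ?_
      exact mul_le_mul_of_nonneg_right (hsym v) (norm_nonneg _)
    · have h1 : HasDerivAt (fun s : ℝ => -(s : ℂ) * symbol r ξ v) (-(symbol r ξ v)) s := by
        simpa using ((Complex.ofRealCLM.hasDerivAt (x := s)).neg.mul_const (symbol r ξ v))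
      refine (h1.cexp.mul_const (f v)).congr_deriv ?_
      ring
  · set a := C⁻¹ * ∫ u, maxwellian u
    have ha : 0 < a := hr.minorization_mass_pos
    have hexp : Tendsto (fun t : ℝ => Real.exp (-a * t) * ∫ v, ‖f v‖) atTop (𝓝 0) := by
      have h1 : Tendsto (fun t : ℝ => -a * t) atTop atBot :=
        tendsto_id.const_mul_atTop_of_neg (neg_neg_iff_pos.2 ha)
      simpa using (Real.tendsto_exp_atBot.comp h1).mul_const (∫ v, ‖f v‖)
    refine squeeze_zero_norm' ?_ hexp
    filter_upwards [eventually_ge_atTop 0] with t ht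
    refine (norm_streamMass_le r ξ f t).trans ?_
    rw [← integral_const_mul]
    refine integral_mono_of_nonneg (Eventually.of_forall fun v => by positivity)
      (hfi.norm.const_mul _) (Eventually.of_forall fun v => ?_)
    refine mul_le_mul_of_nonneg_right (Real.exp_le_exp.2 ?_) (norm_nonneg _)
    nlinarith [mul_le_mul_of_nonneg_left (hr.le_nu0 v) ht]

end KernelBounds

/-! ### Gaussian phase mixing -/

theorem norm_integral_cexp_mul_gaussian (s : ℝ) (ξ : V) :
    ‖∫ v : V, Complex.exp (-(s : ℂ) * (Complex.I * (inner ℝ ξ v : ℝ))) *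
      (Real.exp (-2 * ‖v‖ ^ 2) : ℝ)‖ =
      (∫ v : V, Real.exp (-2 * ‖v‖ ^ 2)) * Real.exp (-(s ^ 2 * ‖ξ‖ ^ 2 / 8)) := by
  have h2 : (0 : ℝ) < (2 : ℂ).re := by norm_num
  have h := GaussianFourier.integral_cexp_neg_mul_sq_norm_add h2 (-(s : ℂ) * Complex.I) ξ
  have h0 := GaussianFourier.integral_cexp_neg_mul_sq_norm (V := V) h2
  have e1 : ∀ v : V, Complex.exp (-(s : ℂ) * (Complex.I * (inner ℝ ξ v : ℝ))) *
      (Real.exp (-2 * ‖v‖ ^ 2) : ℝ) =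
      Complex.exp (-2 * ‖v‖ ^ 2 + -(s : ℂ) * Complex.I * (inner ℝ ξ v : ℝ)) := fun v => by
    rw [Complex.ofReal_exp, ← Complex.exp_add]
    congr 1
    push_cast
    ring
  have e2 : (∫ v : V, Real.exp (-2 * ‖v‖ ^ 2)) = ‖∫ v : V, Complex.exp (-2 * (‖v‖ : ℂ) ^ 2)‖ := by
    have : ∀ v : V, Complex.exp (-2 * (‖v‖ : ℂ) ^ 2) = (Real.exp (-2 * ‖v‖ ^ 2) : ℝ) := fun v => by
      push_cast
      rfl
    simp only [this]
    rw [integral_complex_ofReal, Complex.norm_real,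
      Real.norm_of_nonneg (integral_nonneg fun v => (Real.exp_pos _).le)]
  simp only [e1]
  rw [h, e2, h0, norm_mul]
  congr 1
  rw [Complex.norm_exp]
  congr 1
  have : ((-(s : ℂ) * Complex.I) ^ 2 * (‖ξ‖ : ℂ) ^ 2 / (4 * 2)) =
      ((-(s ^ 2 * ‖ξ‖ ^ 2 / 8) : ℝ) : ℂ) := by
    rw [mul_pow, Complex.I_sq]
    push_cast
    ring
  rw [this, Complex.ofReal_re]

namespace KernelBounds

variable {r : V → V → ℝ} {C : ℝ} (hr : KernelBounds r C)
include hr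

/-- A quantitative form of phase mixing for the Maxwellian at times of order one: the damped
Maxwellian dominates a multiple of a Gaussian, whose oscillating integral is explicit. -/
theorem exists_norm_streamMass_maxwellian_add_le : ∃ δ, 0 < δ ∧ ∀ ξ : V, 1 ≤ ‖ξ‖ → ∀ t : ℝ,
    1 ≤ t → t ≤ 2 → ‖streamMass r ξ (fun v => (maxwellian v : ℂ)) t‖ + δ ≤
      ∫ v, Real.exp (-t * nu0 r v) * maxwellian v := by
  obtain ⟨D, hD⟩ : ∃ D, ∀ v, nu0 r v ≤ D * bracket v := ⟨_, hr.nu0_le⟩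
  -- `t ν₀ ≤ 2 D ⟨v⟩ ≤ D² + 1 + |v|²` for `t ≤ 2`, so that `β exp(-2|v|²) ≤ exp(-t ν₀) M`
  set β := Real.exp (-(D ^ 2 + 1)) with hβ
  have hβ0 : 0 < β := Real.exp_pos _
  set G : V → ℝ := fun v => Real.exp (-2 * ‖v‖ ^ 2) with hG
  have hGi : Integrable G := integrable_exp_neg_mul_sq_norm two_pos
  have hGpos : 0 < ∫ v, G v := integral_pos_of_pos hGi fun v => Real.exp_pos _
  have hexp : Real.exp (-(1 / 8)) < 1 := by rw [Real.exp_lt_one_iff]; norm_num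
  refine ⟨β * (∫ v, G v) * (1 - Real.exp (-(1 / 8))),
    mul_pos (mul_pos hβ0 hGpos) (sub_pos.2 hexp), fun ξ hξ t ht1 ht2 => ?_⟩
  have ht0 : 0 ≤ t := zero_le_one.trans ht1
  set E : V → ℝ := fun v => Real.exp (-t * nu0 r v) * maxwellian v with hE
  have hEi : Integrable E := by
    refine (hr.integrable_exp_symbol_mul 0 integrable_maxwellian ht0).norm.congr
      (Eventually.of_forall fun v => ?_)
    simp only [norm_mul, norm_exp_symbol, Complex.norm_real, Real.norm_eq_abs,
      abs_of_pos (maxwellian_pos _), hE]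
  have hEG : ∀ v, 0 ≤ E v - β * G v := by
    intro v
    rw [sub_nonneg, hβ, hG, hE]
    simp only [maxwellian]
    rw [← Real.exp_add, ← Real.exp_add]
    refine Real.exp_le_exp.2 ?_
    have h1 := hD v
    have h2 := hr.nu0_pos v
    have h3 := bracket_sq v
    nlinarith [sq_nonneg (D - bracket v), mul_le_mul_of_nonneg_right ht2 h2.le]
  set e : V → ℂ := fun v => Complex.exp (-(t : ℂ) * (Complex.I * (inner ℝ ξ v : ℝ))) with he
  have hen : ∀ v, ‖e v‖ = 1 := fun v => by
    rw [he]
    simp [Complex.norm_exp]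
  have hem : AEStronglyMeasurable e volume := by
    have : Continuous e := by
      rw [he]
      fun_prop
    exact this.aestronglyMeasurable
  have hei : ∀ {g : V → ℝ}, Integrable g → Integrable fun v => e v * (g v : ℂ) := fun {g} hg =>
    hg.ofReal.bdd_mul hem (Eventually.of_forall fun v => (hen v).le)
  have hEGi : Integrable fun v => E v - β * G v := hEi.sub (hGi.const_mul β)
  have hsplit : streamMass r ξ (fun v => (maxwellian v : ℂ)) t =
      (∫ v, e v * ((E v - β * G v : ℝ) : ℂ)) + β * ∫ v, e v * (G v : ℂ) := by
    rw [← integral_const_mul, ← integral_add (hei hEGi) ((hei hGi).const_mul _)]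
    refine integral_congr_ae (Eventually.of_forall fun v => ?_)
    simp only [hE, he, symbol]
    rw [mul_add, Complex.exp_add]
    push_cast
    ring
  have h1 : ‖∫ v, e v * ((E v - β * G v : ℝ) : ℂ)‖ ≤ (∫ v, E v) - β * ∫ v, G v := by
    refine (norm_integral_le_integral_norm _).trans_eq ?_
    rw [← integral_const_mul, ← integral_sub hEi (hGi.const_mul β)]
    refine integral_congr_ae (Eventually.of_forall fun v => ?_)
    simp only
    rw [norm_mul, hen, one_mul, Complex.norm_real, Real.norm_of_nonneg (hEG v)]
  have h2 : ‖(β : ℂ) * ∫ v, e v * (G v : ℂ)‖ ≤ β * ((∫ v, G v) * Real.exp (-(1 / 8))) := by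
    rw [norm_mul, Complex.norm_real, Real.norm_of_nonneg hβ0.le]
    refine mul_le_mul_of_nonneg_left ?_ hβ0.le
    refine (norm_integral_cexp_mul_gaussian t ξ).le.trans ?_
    refine mul_le_mul_of_nonneg_left (Real.exp_le_exp.2 ?_) hGpos.le
    have h3 : 1 ≤ t ^ 2 := one_le_pow₀ ht1
    have h4 : 1 ≤ ‖ξ‖ ^ 2 := one_le_pow₀ hξ
    have h5 := one_le_mul_of_one_le_of_one_le h3 h4
    linarith
  have h3 := (norm_add_le _ _).trans (add_le_add h1 h2)
  rw [← hsplit] at h3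
  linarith

/-- Uniform loss of mass of the Maxwellian by phase mixing at nonzero frequencies. -/
theorem exists_mixing_maxwellian_add_le : ∃ δ, 0 < δ ∧ ∀ ξ : V, 1 ≤ ‖ξ‖ →
    mixing r ξ (fun v => (maxwellian v : ℂ)) + δ ≤ ∫ v, maxwellian v / nu0 r v := by
  obtain ⟨δ, hδ, h⟩ := hr.exists_norm_streamMass_maxwellian_add_le
  refine ⟨δ, hδ, fun ξ hξ => ?_⟩
  have hM : Integrable fun v => (maxwellian v : ℂ) := integrable_maxwellian
  have hn : ∀ v, ‖(maxwellian v : ℂ)‖ = maxwellian v := fun v => by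
    rw [Complex.norm_real, Real.norm_of_nonneg (maxwellian_pos v).le]
  have i1 := (hr.integrableOn_streamMass ξ hM).norm
  have i2 := hr.integrableOn_integral_exp_neg_mul hM
  have hle := norm_streamMass_le r ξ (fun v => (maxwellian v : ℂ))
  simp only [hn] at i2 hle
  have hI := hr.integral_integral_exp_neg_mul_nu0 integrable_maxwellian_real
  simp only [abs_of_pos (maxwellian_pos _)] at hI
  have i3 : Integrable (Set.indicator (Set.Ioc (1 : ℝ) 2) fun _ => δ)
      (volume.restrict (Set.Ioi 0)) :=
    (integrable_indicator_iff measurableSet_Ioc).2 (integrableOn_const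
      ((Measure.restrict_apply_le _ _).trans_lt (by simp)).ne)
  have e3 : ∫ t in Set.Ioi (0 : ℝ), Set.indicator (Set.Ioc (1 : ℝ) 2) (fun _ => δ) t = δ := by
    rw [integral_indicator measurableSet_Ioc, Measure.restrict_restrict measurableSet_Ioc,
      Set.inter_eq_self_of_subset_left
        (show Set.Ioc (1 : ℝ) 2 ⊆ Set.Ioi 0 from
          fun t ht => Set.mem_Ioi.2 (zero_lt_one.trans ht.1))]
    norm_num
  rw [← hI]
  conv_lhs => rw [mixing, ← e3]
  rw [← integral_add i1 i3]
  refine integral_mono (i1.add i3) i2 fun t => ?_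
  by_cases ht : t ∈ Set.Ioc (1 : ℝ) 2
  · simp only [Set.indicator_of_mem ht]
    exact h ξ hξ t ht.1.le ht.2
  · simp only [Set.indicator_of_notMem ht, add_zero]
    exact hle t

end KernelBounds

theorem one_le_norm_mode {n : Fin 3 → ℤ} (hn : n ≠ 0) : 1 ≤ ‖mode n‖ := by
  obtain ⟨i, hi⟩ := Function.ne_iff.1 hn
  have h1 : (1 : ℝ) ≤ |(n i : ℝ)| := by
    exact_mod_cast Int.one_le_abs hi
  exact h1.trans (PiLp.norm_apply_le (mode n) i)

/-! ### Dissipation of the Lyapunov functional -/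

/-- The Lyapunov functional `∫ (1 - σ / ν₀) |f| dv + θ ∫₀^∞ |∫ exp(-t(ν₀ + i ξ · v)) f dv| dt`.
In the argument `σ = η + θ`, where `θ / ν₀` compensates the second term and `η / ν₀` gains a
weight. -/
def lyapunov (r : V → V → ℝ) (ξ : V) (σ θ : ℝ) (f : V → ℂ) : ℝ :=
  (∫ v, (1 - σ / nu0 r v) * ‖f v‖) + θ * mixing r ξ f

theorem lyapunov_congr (r : V → V → ℝ) (ξ : V) (σ θ : ℝ) {f g : V → ℂ} (h : f =ᵐ[volume] g) :
    lyapunov r ξ σ θ f = lyapunov r ξ σ θ g := by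
  rw [lyapunov, lyapunov, mixing_congr r ξ h]
  congr 1
  exact integral_congr_ae (h.mono fun v hv => by simp only [hv])

theorem lyapunov_const_mul (r : V → V → ℝ) (ξ : V) (σ θ : ℝ) (c : ℂ) (f : V → ℂ) :
    lyapunov r ξ σ θ (fun v => c * f v) = ‖c‖ * lyapunov r ξ σ θ f := by
  rw [lyapunov, lyapunov, mixing_const_mul, mul_add, ← integral_const_mul]
  simp only [norm_mul, mul_left_comm ‖c‖]

/-- The part of `L_n` beyond multiplication by `ν₀ + i n · v`, where `s = C_∞ κ`. -/
def perturbation (r : V → V → ℝ) (s : ℝ) (f : V → ℂ) (v : V) : ℂ :=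
  -K0 r f v + (s : ℂ) * ((nu1 v : ℂ) * f v + K1 f v)

theorem integrable_nu1_mul {f : V → ℂ} (hf : WeightedIntegrable f) :
    Integrable fun v => (nu1 v : ℂ) * f v := by
  obtain ⟨D, _, hD⟩ := exists_nu1_le
  exact hf.integrable_mul (Complex.measurable_ofReal.comp measurable_nu1) fun v => by
    rw [Complex.norm_real, Real.norm_of_nonneg (nu1_nonneg v)]
    exact hD v

/-- The linearized collision operator is bounded from the weighted space to `L¹`. -/
theorem exists_integral_norm_nu1_mul_add_K1_le : ∃ D, 0 ≤ D ∧ ∀ f, WeightedIntegrable f →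
    ∫ v, ‖(nu1 v : ℂ) * f v + K1 f v‖ ≤ D * ∫ v, bracket v * ‖f v‖ := by
  obtain ⟨D, hD0, hD⟩ := exists_nu1_le
  refine ⟨4 * D, by positivity, fun f hf => ?_⟩
  have i1 := (integrable_nu1_mul hf).norm
  have i2 := (integrable_K1 hf).norm
  have h1 := integral_mono ((integrable_nu1_mul hf).add (integrable_K1 hf)).norm (i1.add i2)
    fun v => norm_add_le _ _
  rw [integral_add' i1 i2] at h1
  have e1 : ∫ v, ‖(nu1 v : ℂ) * f v‖ = ∫ v, nu1 v * ‖f v‖ :=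
    integral_congr_ae (Eventually.of_forall fun v => by
      simp only
      rw [norm_mul, Complex.norm_real, Real.norm_of_nonneg (nu1_nonneg v)])
  have h2 := integral_norm_K1_le hf
  have h3 : ∫ v, nu1 v * ‖f v‖ ≤ D * ∫ v, bracket v * ‖f v‖ := by
    rw [← integral_const_mul]
    refine integral_mono_of_nonneg (Eventually.of_forall fun v =>
      mul_nonneg (nu1_nonneg v) (norm_nonneg _)) (hf.integrable_bracket_mul_norm.const_mul D)
      (Eventually.of_forall fun v => ?_)
    simp only
    rw [← mul_assoc]
    exact mul_le_mul_of_nonneg_right (hD v) (norm_nonneg _)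
  simp only [Pi.add_apply] at h1
  linarith

namespace KernelBounds

variable {r : V → V → ℝ} {C : ℝ} (hr : KernelBounds r C)
include hr

theorem integrable_weight_mul {g : V → ℝ} (hg : Integrable g) (σ : ℝ) :
    Integrable fun v => (1 - σ / nu0 r v) * g v := by
  have := hg.sub ((hr.integrable_mul_div_nu0 hg).const_mul σ)
  refine this.congr (Eventually.of_forall fun v => ?_)
  simp only [Pi.sub_apply]
  ring

theorem integral_weight_mul {g : V → ℝ} (hg : Integrable g) (σ : ℝ) :
    ∫ v, (1 - σ / nu0 r v) * g v = (∫ v, g v) - σ * ∫ v, g v / nu0 r v := by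
  rw [← integral_const_mul, ← integral_sub hg ((hr.integrable_mul_div_nu0 hg).const_mul σ)]
  refine integral_congr_ae (Eventually.of_forall fun v => ?_)
  simp only
  ring

theorem integrable_nu0_mul_norm {f : V → ℂ} (hf : WeightedIntegrable f) :
    Integrable fun v => nu0 r v * ‖f v‖ :=
  hf.integrable_mul_norm hr.measurable_nu0 fun v => by
    rw [abs_of_pos (hr.nu0_pos v)]
    exact hr.nu0_le v

theorem div_nu0_le_half {σ : ℝ} (hσ : σ ≤ C⁻¹ * (∫ u, maxwellian u) / 2) (v : V) :
    σ / nu0 r v ≤ 1 / 2 := by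
  rw [div_le_iff₀ (hr.nu0_pos v)]
  linarith [hr.le_nu0 v]

theorem lyapunov_le_integral_weight (ξ : V) {η θ : ℝ} (hθ : 0 ≤ θ) {f : V → ℂ}
    (hf : Integrable f) :
    lyapunov r ξ (η + θ) θ f ≤ ∫ v, (1 - η / nu0 r v) * ‖f v‖ := by
  rw [lyapunov, hr.integral_weight_mul hf.norm, hr.integral_weight_mul hf.norm]
  have := mul_le_mul_of_nonneg_left (hr.mixing_le ξ hf) hθ
  linarith

theorem lyapunov_le_integral_norm (ξ : V) {η θ : ℝ} (hη : 0 ≤ η) (hθ : 0 ≤ θ) {f : V → ℂ}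
    (hf : Integrable f) : lyapunov r ξ (η + θ) θ f ≤ ∫ v, ‖f v‖ := by
  refine (hr.lyapunov_le_integral_weight ξ hθ hf).trans ?_
  rw [hr.integral_weight_mul hf.norm]
  have : 0 ≤ ∫ v, ‖f v‖ / nu0 r v :=
    integral_nonneg fun v => div_nonneg (norm_nonneg _) (hr.nu0_pos v).le
  nlinarith

theorem integral_norm_le_lyapunov (ξ : V) {σ θ : ℝ} (hθ : 0 ≤ θ)
    (hσ : σ ≤ C⁻¹ * (∫ u, maxwellian u) / 2) {f : V → ℂ} (hf : Integrable f) :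
    1 / 2 * ∫ v, ‖f v‖ ≤ lyapunov r ξ σ θ f := by
  have h1 := mul_nonneg hθ (mixing_nonneg r ξ f)
  have h2 : 1 / 2 * ∫ v, ‖f v‖ ≤ ∫ v, (1 - σ / nu0 r v) * ‖f v‖ := by
    rw [← integral_const_mul]
    refine integral_mono (hf.norm.const_mul _) (hr.integrable_weight_mul hf.norm σ) fun v => ?_
    refine mul_le_mul_of_nonneg_right ?_ (norm_nonneg _)
    linarith [hr.div_nu0_le_half hσ v]
  rw [lyapunov]
  linarith

theorem lyapunov_add_le (ξ : V) {σ θ : ℝ} (hθ : 0 ≤ θ)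
    (hσ : σ ≤ C⁻¹ * (∫ u, maxwellian u) / 2) {f g : V → ℂ} (hf : Integrable f)
    (hg : Integrable g) :
    lyapunov r ξ σ θ (fun v => f v + g v) ≤ lyapunov r ξ σ θ f + lyapunov r ξ σ θ g := by
  have h1 := mul_le_mul_of_nonneg_left (hr.mixing_add_le ξ hf hg) hθ
  have i1 := hr.integrable_weight_mul hf.norm σ
  have i2 := hr.integrable_weight_mul hg.norm σ
  have h2 := integral_mono (hr.integrable_weight_mul (hf.add hg).norm σ) (i1.add i2) fun v => by
    simp only [Pi.add_apply]
    rw [← mul_add]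
    exact mul_le_mul_of_nonneg_left (norm_add_le _ _) (by linarith [hr.div_nu0_le_half hσ v])
  rw [integral_add' i1 i2] at h2
  simp only [Pi.add_apply] at h2
  rw [lyapunov, lyapunov, lyapunov]
  linarith

/-- Multiplication by `ν₀ + i ξ · v` dissipates the Lyapunov functional. -/
theorem le_lyapunov_symbol_mul (ξ : V) {σ θ : ℝ} (hθ : 0 ≤ θ)
    (hσ : σ ≤ C⁻¹ * (∫ u, maxwellian u) / 2) {l : ℝ} (hl : 0 ≤ l) {f : V → ℂ}
    (hf : WeightedIntegrable f) :
    l * lyapunov r ξ σ θ f + (∫ v, nu0 r v * ‖f v‖) - σ * (∫ v, ‖f v‖) + θ * ‖∫ v, f v‖ ≤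
      lyapunov r ξ σ θ fun v => (l + symbol r ξ v) * f v := by
  have hfi := hf.integrable
  have h1 := mul_le_mul_of_nonneg_left (hr.mul_mixing_add_norm_integral_le ξ hf hl) hθ
  obtain ⟨D, hD, hsym⟩ := hr.exists_norm_symbol_le ξ
  have hg : Integrable fun v => ((l : ℂ) + symbol r ξ v) * f v := by
    simp only [add_mul]
    exact (hfi.const_mul _).add (hf.integrable_mul (hr.measurable_symbol ξ) hsym)
  have i1 := (hr.integrable_weight_mul hfi.norm σ).const_mul l
  have i2 := hr.integrable_nu0_mul_norm hf
  have i3 := hfi.norm.const_mul σ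
  have i4 : Integrable fun v => l * ((1 - σ / nu0 r v) * ‖f v‖) + nu0 r v * ‖f v‖ := i1.add i2
  have h2 : l * (∫ v, (1 - σ / nu0 r v) * ‖f v‖) + (∫ v, nu0 r v * ‖f v‖) - σ * (∫ v, ‖f v‖) ≤
      ∫ v, (1 - σ / nu0 r v) * ‖((l : ℂ) + symbol r ξ v) * f v‖ := by
    rw [← integral_const_mul, ← integral_const_mul, ← integral_add i1 i2, ← integral_sub i4 i3]
    refine integral_mono (i4.sub i3) (hr.integrable_weight_mul hg.norm σ) fun v => ?_
    have e1 : l + nu0 r v ≤ ‖(l : ℂ) + symbol r ξ v‖ := by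
      refine le_trans (le_of_eq ?_) (Complex.re_le_norm _)
      rw [Complex.add_re, symbol_re, Complex.ofReal_re]
    have e2 : 0 ≤ 1 - σ / nu0 r v := by linarith [hr.div_nu0_le_half hσ v]
    have e3 := (hr.nu0_pos v).ne'
    calc l * ((1 - σ / nu0 r v) * ‖f v‖) + nu0 r v * ‖f v‖ - σ * ‖f v‖
        = (1 - σ / nu0 r v) * ((l + nu0 r v) * ‖f v‖) := by field_simp; ring
      _ ≤ (1 - σ / nu0 r v) * ‖((l : ℂ) + symbol r ξ v) * f v‖ := by
        rw [norm_mul]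
        gcongr
  rw [lyapunov, lyapunov]
  linarith

/-- The gain term in the Lyapunov functional: the part of it that forgets the incoming velocity
feels the loss of mass of the Maxwellian by phase mixing. -/
theorem lyapunov_K0_le (ξ : V) {η θ : ℝ} (hη : 0 ≤ η) (hθ : 0 ≤ θ)
    (hσ : η + θ ≤ C⁻¹ * (∫ u, maxwellian u) / 2) {δ : ℝ}
    (hδ : mixing r ξ (fun v => (maxwellian v : ℂ)) + δ ≤ ∫ v, maxwellian v / nu0 r v) {c₂ : ℝ}
    (hc₂ : ∀ u, c₂ * bracket u ≤ ∫ v, r v u / nu0 r v) {f : V → ℂ} (hf : WeightedIntegrable f) :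
    lyapunov r ξ (η + θ) θ (K0 r f) ≤
      (∫ v, nu0 r v * ‖f v‖) - (C⁻¹ * (∫ u, maxwellian u) - η) * (∫ v, ‖f v‖)
        - η * c₂ * (∫ v, bracket v * ‖f v‖)
        + (C⁻¹ * (∫ u, maxwellian u) - θ * (C⁻¹ * δ)) * ‖∫ v, f v‖ := by
  have ha := hr.minorization_mass_pos
  have hCi : 0 < C⁻¹ := inv_pos.2 hr.pos
  have hfi := hf.integrable
  have hMi : Integrable fun v => (maxwellian v : ℂ) := integrable_maxwellian
  have hKi := hr.integrable_K0 hf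
  set ρ := ∫ v, f v with hρ
  have hMρ : Integrable fun v => (C⁻¹ * maxwellian v : ℝ) * ρ := by
    refine (hMi.const_mul ((C⁻¹ : ℝ) * ρ)).congr (Eventually.of_forall fun v => ?_)
    simp only [Complex.ofReal_mul]
    ring
  have hsplit : K0 r f = fun v => (K0 r f v - (C⁻¹ * maxwellian v : ℝ) * ρ)
      + (((C⁻¹ : ℝ) : ℂ) * ρ) * (maxwellian v : ℂ) := by
    ext v
    push_cast
    ring
  have hsub := hKi.sub hMρ
  have h1 : lyapunov r ξ (η + θ) θ (K0 r f) ≤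
      lyapunov r ξ (η + θ) θ (fun v => K0 r f v - (C⁻¹ * maxwellian v : ℝ) * ρ)
        + C⁻¹ * ‖ρ‖ * lyapunov r ξ (η + θ) θ (fun v => (maxwellian v : ℂ)) := by
    conv_lhs => rw [hsplit]
    refine (hr.lyapunov_add_le ξ hθ hσ hsub (hMi.const_mul _)).trans_eq ?_
    rw [lyapunov_const_mul, norm_mul, Complex.norm_real, Real.norm_of_nonneg hCi.le]
    rfl
  have h2 : lyapunov r ξ (η + θ) θ (fun v => K0 r f v - (C⁻¹ * maxwellian v : ℝ) * ρ) ≤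
      ∫ v, (nu0 r v - C⁻¹ * (∫ u, maxwellian u) - η * c₂ * bracket v + η) * ‖f v‖ :=
    (hr.lyapunov_le_integral_weight ξ hθ hsub).trans
      (hr.integral_weight_mul_norm_K0_sub_le hc₂ hη (by linarith) hf)
  have h3 : ∫ v, (nu0 r v - C⁻¹ * (∫ u, maxwellian u) - η * c₂ * bracket v + η) * ‖f v‖ =
      (∫ v, nu0 r v * ‖f v‖) - (C⁻¹ * (∫ u, maxwellian u) - η) * (∫ v, ‖f v‖)
        - η * c₂ * (∫ v, bracket v * ‖f v‖) := by
    generalize C⁻¹ * (∫ u, maxwellian u) = a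
    have i1 := hr.integrable_nu0_mul_norm hf
    have i2 := hfi.norm.const_mul (a - η)
    have i3 := hf.integrable_bracket_mul_norm.const_mul (η * c₂)
    have i4 : Integrable fun v => nu0 r v * ‖f v‖ - (a - η) * ‖f v‖ := i1.sub i2
    rw [← integral_const_mul, ← integral_const_mul, ← integral_sub i1 i2, ← integral_sub i4 i3]
    refine integral_congr_ae (Eventually.of_forall fun v => ?_)
    simp only
    ring
  have h4 : C⁻¹ * lyapunov r ξ (η + θ) θ (fun v => (maxwellian v : ℂ)) ≤
      C⁻¹ * (∫ u, maxwellian u) - θ * (C⁻¹ * δ) := by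
    have hn : ∀ v, ‖(maxwellian v : ℂ)‖ = maxwellian v := fun v => by
      rw [Complex.norm_real, Real.norm_of_nonneg (maxwellian_pos v).le]
    have hp : 0 ≤ ∫ v, maxwellian v / nu0 r v :=
      integral_nonneg fun v => div_nonneg (maxwellian_pos v).le (hr.nu0_pos v).le
    have h5 : lyapunov r ξ (η + θ) θ (fun v => (maxwellian v : ℂ)) ≤
        (∫ u, maxwellian u) - θ * δ := by
      rw [lyapunov]
      simp only [hn]
      rw [hr.integral_weight_mul integrable_maxwellian_real]
      have := mul_le_mul_of_nonneg_left hδ hθ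
      have := mul_nonneg hη hp
      linarith
    have := mul_le_mul_of_nonneg_left h5 hCi.le
    linarith
  have h5 := mul_le_mul_of_nonneg_right h4 (norm_nonneg ρ)
  have h6 : C⁻¹ * ‖ρ‖ * lyapunov r ξ (η + θ) θ (fun v => (maxwellian v : ℂ)) =
      C⁻¹ * lyapunov r ξ (η + θ) θ (fun v => (maxwellian v : ℂ)) * ‖ρ‖ := by ring
  linarith

theorem integrable_perturbation {f : V → ℂ} (hf : WeightedIntegrable f) (s : ℝ) :
    Integrable (perturbation r s f) :=
  (hr.integrable_K0 hf).neg.add (((integrable_nu1_mul hf).add (integrable_K1 hf)).const_mul _)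

/-- The dissipation estimate for `L_n`, the parameters being independent of `κ ≤ κ₀` and `n`. The
spatially homogeneous mode `n = 0` has no phase mixing, and there the mass is not damped. -/
theorem exists_dissipation {Cinf : ℝ} (hCinf : 0 ≤ Cinf) : ∃ κ₀ ε η θ : ℝ, 0 < κ₀ ∧ 0 < ε ∧
    0 ≤ η ∧ 0 ≤ θ ∧ η + θ ≤ C⁻¹ * (∫ u, maxwellian u) / 2 ∧
    ∀ κ, 0 < κ → κ ≤ κ₀ → ∀ n : Fin 3 → ℤ, ∀ l : ℝ, 0 ≤ l → ∀ f, WeightedIntegrable f →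
      lyapunov r (mode n) (η + θ) θ (perturbation r (Cinf * κ) f)
        + l * lyapunov r (mode n) (η + θ) θ f + ε * (∫ v, bracket v * ‖f v‖)
        ≤ lyapunov r (mode n) (η + θ) θ (fun v => (l + symbol r (mode n) v) * f v)
          + (if n = 0 then C⁻¹ * ∫ u, maxwellian u else 0) * ‖∫ v, f v‖ := by
  obtain ⟨c₂, hc₂pos, hc₂⟩ := hr.exists_le_integral_div_nu0
  obtain ⟨D, hD0, hD⟩ := exists_integral_norm_nu1_mul_add_K1_le
  obtain ⟨δ, hδpos, hδ⟩ := hr.exists_mixing_maxwellian_add_le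
  have ha := hr.minorization_mass_pos
  have hCi : 0 < C⁻¹ := inv_pos.2 hr.pos
  have hM0 : mixing r (mode 0) (fun v => (maxwellian v : ℂ)) + 0 ≤ ∫ v, maxwellian v / nu0 r v := by
    have := hr.mixing_le (mode 0) integrable_maxwellian
    simpa only [Complex.norm_real, Real.norm_eq_abs, abs_of_pos (maxwellian_pos _), add_zero]
      using this
  have hone := hr.inv_mul_integral_maxwellian_div_nu0_le_one
  have hM1 : ∀ n, n ≠ 0 → mixing r (mode n) (fun v => (maxwellian v : ℂ)) + δ ≤
      ∫ v, maxwellian v / nu0 r v := fun n hn => hδ _ (one_le_norm_mode hn)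
  set a := C⁻¹ * ∫ u, maxwellian u with ha_def
  have hδ1 : C⁻¹ * δ ≤ 1 := by
    refine le_trans (mul_le_mul_of_nonneg_left ?_ hCi.le) hone
    have h := hM1 (fun _ => 1) (fun h => one_ne_zero (congrFun h 0))
    linarith [mixing_nonneg r (mode fun _ => 1) (fun v => (maxwellian v : ℂ))]
  -- `η` is chosen to balance the gain `θ C⁻¹ δ` from phase mixing
  set θ := a / 4 with hθ_def
  set η := θ * (C⁻¹ * δ) / 2 with hη_def
  have hθ : 0 < θ := by positivity
  have hη : 0 < η := by positivity
  have hησ : η ≤ θ / 2 := by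
    rw [hη_def]
    have := mul_le_mul_of_nonneg_left hδ1 hθ.le
    linarith
  have hσ : η + θ ≤ a / 2 := by linarith
  refine ⟨η * c₂ / (2 * (Cinf * D + 1)), η * c₂ / 2, η, θ, by positivity, by positivity, hη.le,
    hθ.le, hσ, fun κ hκ hκ₀ n l hl f hf => ?_⟩
  have hfi := hf.integrable
  set W := ∫ v, bracket v * ‖f v‖ with hW
  have hW0 : 0 ≤ W := integral_nonneg fun v => mul_nonneg (bracket_pos v).le (norm_nonneg _)
  have hρ : ‖∫ v, f v‖ ≤ ∫ v, ‖f v‖ := norm_integral_le_integral_norm _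
  have hκs : Cinf * κ * (D * W) ≤ η * c₂ / 2 * W := by
    rw [le_div_iff₀ (by positivity)] at hκ₀
    have h1 : Cinf * κ * D ≤ η * c₂ / 2 := by
      nlinarith [mul_nonneg hCinf hD0]
    nlinarith
  have hpert : lyapunov r (mode n) (η + θ) θ (perturbation r (Cinf * κ) f) ≤
      lyapunov r (mode n) (η + θ) θ (K0 r f) + Cinf * κ * (D * W) := by
    have i1 := (integrable_nu1_mul hf).add (integrable_K1 hf)
    have h1 := hr.lyapunov_add_le (mode n) hθ.le hσ (hr.integrable_K0 hf).neg
      (i1.const_mul ((Cinf * κ : ℝ) : ℂ))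
    have h2 : lyapunov r (mode n) (η + θ) θ (-K0 r f) = lyapunov r (mode n) (η + θ) θ (K0 r f) := by
      have := lyapunov_const_mul r (mode n) (η + θ) θ (-1) (K0 r f)
      rw [norm_neg, norm_one, one_mul] at this
      rw [← this]
      congr 1
      ext v
      simp
    have h3 : lyapunov r (mode n) (η + θ) θ (fun v => ((Cinf * κ : ℝ) : ℂ) *
        ((fun v => (nu1 v : ℂ) * f v) + K1 f) v) ≤ Cinf * κ * (D * W) := by
      have hs : 0 ≤ Cinf * κ := by positivity
      rw [lyapunov_const_mul, Complex.norm_real, Real.norm_of_nonneg hs]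
      refine mul_le_mul_of_nonneg_left ?_ hs
      exact (hr.lyapunov_le_integral_norm (mode n) hη.le hθ.le i1).trans (hD f hf)
    rw [h2] at h1
    exact h1.trans (add_le_add le_rfl h3)
  have hsym := hr.le_lyapunov_symbol_mul (mode n) hθ.le hσ hl hf
  by_cases hn : n = 0
  · subst hn
    have hK := hr.lyapunov_K0_le (mode 0) hη.le hθ.le hσ hM0 hc₂ hf
    rw [if_pos rfl]
    rw [← hW] at hK
    have hb : 0 ≤ a - θ - 2 * η := by linarith
    have h1 := mul_le_mul_of_nonneg_left hρ hb
    have h2 := mul_nonneg hη.le (norm_nonneg (∫ v, f v))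
    have h3 := mul_nonneg hθ.le (norm_nonneg (∫ v, f v))
    have h4 := mul_nonneg ha.le (norm_nonneg (∫ v, f v))
    have h5 := mul_nonneg hb (norm_nonneg (∫ v, f v))
    nlinarith
  · have hK := hr.lyapunov_K0_le (mode n) hη.le hθ.le hσ (hM1 n hn) hc₂ hf
    rw [if_neg hn]
    rw [← hW] at hK
    have e1 : θ * (C⁻¹ * δ) = 2 * η := by rw [hη_def]; ring
    rw [e1] at hK
    have hb : 0 ≤ a - θ - 2 * η := by linarith
    have h1 := mul_le_mul_of_nonneg_left hρ hb
    nlinarith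

end KernelBounds

/-! ### The operators on `L¹` and the semigroup -/

/-- The bounded operator on `L¹` given by a map into integrable functions that is linear up to null
sets and bounded. -/
def l1Operator (F : L1V → V → ℂ) (hF : ∀ g, Integrable (F g))
    (hadd : ∀ g h, F (g + h) =ᵐ[volume] fun v => F g v + F h v)
    (hsmul : ∀ (c : ℂ) g, F (c • g) =ᵐ[volume] fun v => c * F g v)
    (D : ℝ) (hD : ∀ g, ∫ v, ‖F g v‖ ≤ D * ‖g‖) : L1V →L[ℂ] L1V :=
  LinearMap.mkContinuous
    { toFun := fun g => (hF g).toL1 (F g)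
      map_add' := fun g h => by
        rw [← Integrable.toL1_add, Integrable.toL1_eq_toL1_iff]
        exact hadd g h
      map_smul' := fun c g => by
        rw [RingHom.id_apply, ← Integrable.toL1_smul, Integrable.toL1_eq_toL1_iff]
        exact hsmul c g }
    D fun g => by
      rw [L1.norm_eq_integral_norm]
      refine le_trans (le_of_eq (integral_congr_ae ?_)) (hD g)
      filter_upwards [(hF g).coeFn_toL1] with v hv
      exact congrArg norm hv

theorem coeFn_l1Operator (F : L1V → V → ℂ) (hF : ∀ g, Integrable (F g))
    (hadd : ∀ g h, F (g + h) =ᵐ[volume] fun v => F g v + F h v)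
    (hsmul : ∀ (c : ℂ) g, F (c • g) =ᵐ[volume] fun v => c * F g v)
    (D : ℝ) (hD : ∀ g, ∫ v, ‖F g v‖ ≤ D * ‖g‖) (g : L1V) :
    (l1Operator F hF hadd hsmul D hD g : V → ℂ) =ᵐ[volume] F g :=
  (hF g).coeFn_toL1

/-- Multiplication operators on `L¹`. -/
theorem exists_mulOperator {m : V → ℂ} (hm : Measurable m) {D : ℝ} (hD : ∀ v, ‖m v‖ ≤ D) :
    ∃ T : L1V →L[ℂ] L1V, ∀ g : L1V, (T g : V → ℂ) =ᵐ[volume] fun v => m v * g v := by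
  have hi : ∀ g : L1V, Integrable fun v => m v * g v := fun g =>
    (L1.integrable_coeFn g).bdd_mul hm.aestronglyMeasurable (Eventually.of_forall hD)
  refine ⟨l1Operator (fun g v => m v * g v) hi (fun g h => ?_) (fun c g => ?_) D fun g => ?_,
    coeFn_l1Operator _ _ _ _ _ _⟩
  · filter_upwards [Lp.coeFn_add g h] with v hv
    rw [hv, Pi.add_apply, mul_add]
  · filter_upwards [Lp.coeFn_smul c g] with v hv
    rw [hv, Pi.smul_apply, smul_eq_mul, mul_left_comm]
  · rw [L1.norm_eq_integral_norm, ← integral_const_mul]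
    refine integral_mono (hi g).norm ((L1.integrable_coeFn g).norm.const_mul D) fun v => ?_
    simp only
    rw [norm_mul]
    exact mul_le_mul_of_nonneg_right (hD v) (norm_nonneg _)

/-- The element `g / ⟨v⟩` of the weighted space. -/
def unweight (g : V → ℂ) (v : V) : ℂ := ((bracket v : ℂ))⁻¹ * g v

theorem bracket_mul_unweight (g : V → ℂ) (v : V) : (bracket v : ℂ) * unweight g v = g v :=
  mul_inv_cancel_left₀ (by exact_mod_cast (bracket_pos v).ne') _

theorem weightedIntegrable_unweight (g : L1V) : WeightedIntegrable (unweight g) := by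
  simp only [WeightedIntegrable, bracket_mul_unweight]
  exact L1.integrable_coeFn g

theorem integral_bracket_mul_norm_unweight (g : L1V) :
    ∫ v, bracket v * ‖unweight g v‖ = ‖g‖ := by
  rw [L1.norm_eq_integral_norm]
  refine integral_congr_ae (Eventually.of_forall fun v => ?_)
  simp only
  conv_rhs => rw [← bracket_mul_unweight g v]
  rw [norm_mul, Complex.norm_real, Real.norm_of_nonneg (bracket_pos v).le]

theorem unweight_add (g h : L1V) :
    unweight (g + h : L1V) =ᵐ[volume] fun v => unweight g v + unweight h v := by
  filter_upwards [Lp.coeFn_add g h] with v hv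
  rw [unweight, hv, Pi.add_apply, mul_add]
  rfl

theorem unweight_smul (c : ℂ) (g : L1V) :
    unweight (c • g : L1V) =ᵐ[volume] fun v => c * unweight g v := by
  filter_upwards [Lp.coeFn_smul c g] with v hv
  rw [unweight, hv, Pi.smul_apply, smul_eq_mul, mul_left_comm]
  rfl

theorem K0_congr (r : V → V → ℝ) {f g : V → ℂ} (h : f =ᵐ[volume] g) : K0 r f = K0 r g :=
  funext fun v => integral_congr_ae (h.mono fun u hu => by simp only [hu])

theorem perturbation_congr (r : V → V → ℝ) (s : ℝ) {f g : V → ℂ} (h : f =ᵐ[volume] g) :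
    perturbation r s f =ᵐ[volume] perturbation r s g := by
  filter_upwards [h, K1_congr h] with v h1 h2
  rw [perturbation, perturbation, K0_congr r h, h1, h2]

theorem perturbation_const_mul (r : V → V → ℝ) (s : ℝ) (c : ℂ) (f : V → ℂ) (v : V) :
    perturbation r s (fun v => c * f v) v = c * perturbation r s f v := by
  have : K0 r (fun v => c * f v) v = c * K0 r f v := by
    rw [K0, K0, ← integral_const_mul]
    simp only [mul_left_comm c]
  rw [perturbation, perturbation, this, K1_const_mul]
  ring

theorem modeExpr_eq (r : V → V → ℝ) (Cinf κ : ℝ) (n : Fin 3 → ℤ) (f : V → ℂ) (v : V) :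
    modeExpr r Cinf κ n f v = symbol r (mode n) v * f v + perturbation r (Cinf * κ) f v := by
  simp only [modeExpr, nu, K, symbol, perturbation]
  push_cast
  ring

theorem modeExpr_congr (r : V → V → ℝ) (Cinf κ : ℝ) (n : Fin 3 → ℤ) {f g : V → ℂ}
    (h : f =ᵐ[volume] g) : modeExpr r Cinf κ n f =ᵐ[volume] modeExpr r Cinf κ n g := by
  filter_upwards [h, perturbation_congr r (Cinf * κ) h] with v h1 h2
  rw [modeExpr_eq, modeExpr_eq, h1, h2]

/-- The bounded operator `g ↦ g / ⟨v⟩`, whose range is the domain of `L_n`. -/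
theorem exists_unweightOperator : ∃ J : L1V →L[ℂ] L1V,
    (∀ g : L1V, (J g : V → ℂ) =ᵐ[volume] unweight g) ∧ DenseRange J ∧ ∀ g, ‖J g‖ ≤ ‖g‖ := by
  have hm : Measurable fun v : V => ((bracket v : ℂ))⁻¹ :=
    (Complex.measurable_ofReal.comp continuous_bracket.measurable).inv
  obtain ⟨J, hJ⟩ := exists_mulOperator hm (D := 1) fun v => by
    rw [norm_inv, Complex.norm_real, Real.norm_of_nonneg (bracket_pos v).le]
    exact inv_le_one_of_one_le₀ (one_le_bracket v)
  have hJ' : ∀ g : L1V, (J g : V → ℂ) =ᵐ[volume] unweight g := hJ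
  refine ⟨J, hJ', fun h => ?_, fun g => ?_⟩
  · -- `k / (k + ⟨v⟩) h` lies in the range and tends to `h`
    have hpos : ∀ (k : ℕ) v, 0 < (k : ℝ) + bracket v := fun k v =>
      add_pos_of_nonneg_of_pos k.cast_nonneg (bracket_pos v)
    have hT : ∀ k : ℕ, ∃ T : L1V →L[ℂ] L1V, ∀ g : L1V, (T g : V → ℂ) =ᵐ[volume]
        fun v => (((k : ℝ) * bracket v / (k + bracket v) : ℝ) : ℂ) * g v := fun k => by
      refine exists_mulOperator (D := k) ?_ fun v => ?_
      · exact Complex.measurable_ofReal.comp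
          ((continuous_const.mul continuous_bracket).measurable.div
            (continuous_const.add continuous_bracket).measurable)
      · have h1 := hpos k v
        have h2 := bracket_pos v
        have h3 : (0 : ℝ) ≤ k := k.cast_nonneg
        rw [Complex.norm_real, Real.norm_of_nonneg (by positivity), div_le_iff₀ h1]
        nlinarith
    choose T hT using hT
    refine mem_closure_of_tendsto (f := fun k : ℕ => J (T k h)) (b := atTop) ?_
      (Eventually.of_forall fun k => ⟨_, rfl⟩)
    rw [tendsto_iff_norm_sub_tendsto_zero]
    have hn : ∀ k : ℕ, ‖J (T k h) - h‖ = ∫ v, bracket v / (k + bracket v) * ‖h v‖ := by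
      intro k
      rw [L1.norm_eq_integral_norm]
      refine integral_congr_ae ?_
      filter_upwards [Lp.coeFn_sub (J (T k h)) h, hJ' (T k h), hT k h] with v h1 h2 h3
      rw [h1, Pi.sub_apply, h2, unweight, h3]
      have e1 := hpos k v
      have e2 := bracket_pos v
      have e3 : ((bracket v : ℂ))⁻¹ *
          ((((k : ℝ) * bracket v / (k + bracket v) : ℝ) : ℂ) * h v) - h v =
          ((-(bracket v / (k + bracket v)) : ℝ) : ℂ) * h v := by
        have e4 : (bracket v : ℂ) ≠ 0 := by exact_mod_cast e2.ne'
        have e5 : (k : ℂ) + (bracket v : ℂ) ≠ 0 := by exact_mod_cast e1.ne'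
        push_cast
        field_simp
        ring
      rw [e3, norm_mul, Complex.norm_real, norm_neg, Real.norm_of_nonneg (by positivity)]
    simp only [hn]
    have hlim := tendsto_integral_of_dominated_convergence (μ := (volume : Measure V))
      (F := fun (k : ℕ) v => bracket v / (k + bracket v) * ‖h v‖) (f := fun _ => (0 : ℝ))
      (fun v => ‖h v‖)
      (fun k => ((continuous_bracket.measurable.div
        (continuous_const.add continuous_bracket).measurable).aestronglyMeasurable.mul
          (L1.integrable_coeFn h).norm.aestronglyMeasurable))
      (L1.integrable_coeFn h).norm
      (fun k => Eventually.of_forall fun v => by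
        have e1 := hpos k v
        have e2 := bracket_pos v
        rw [norm_mul, norm_norm, Real.norm_of_nonneg (by positivity)]
        refine mul_le_of_le_one_left (norm_nonneg _) ((div_le_one e1).2 ?_)
        have : (0 : ℝ) ≤ k := k.cast_nonneg
        linarith)
      (Eventually.of_forall fun v => by
        have h1 : Tendsto (fun k : ℕ => bracket v / ((k : ℝ) + bracket v)) atTop (𝓝 0) :=
          tendsto_const_nhds.div_atTop
            (tendsto_atTop_add_const_right _ _ tendsto_natCast_atTop_atTop)
        simpa using h1.mul_const ‖h v‖)
    simpa using hlim
  · rw [L1.norm_eq_integral_norm, L1.norm_eq_integral_norm]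
    refine integral_mono_ae (L1.integrable_coeFn _).norm (L1.integrable_coeFn _).norm ?_
    filter_upwards [hJ' g] with v hv
    rw [hv, unweight, norm_mul, norm_inv, Complex.norm_real,
      Real.norm_of_nonneg (bracket_pos v).le]
    exact mul_le_of_le_one_left (norm_nonneg _) (inv_le_one_of_one_le₀ (one_le_bracket v))

namespace KernelBounds

variable {r : V → V → ℝ} {C : ℝ} (hr : KernelBounds r C)
include hr

theorem exists_mul_bracket_le_nu0 : ∃ c, 0 < c ∧ ∀ v, c * bracket v ≤ nu0 r v := by
  have hgp : ∀ v, 0 < maxwellian v / bracket v := fun v =>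
    div_pos (maxwellian_pos v) (bracket_pos v)
  have hgc : Continuous fun v => maxwellian v / bracket v :=
    continuous_maxwellian.div continuous_bracket fun v => (bracket_pos v).ne'
  have hgi : Integrable fun v => maxwellian v / bracket v := by
    refine integrable_maxwellian_real.mono' hgc.aestronglyMeasurable
      (Eventually.of_forall fun v => ?_)
    rw [Real.norm_of_nonneg (hgp v).le]
    exact div_le_self (maxwellian_pos v).le (one_le_bracket v)
  refine ⟨C⁻¹ / 2 * ∫ u, maxwellian u / bracket u,
    mul_pos (half_pos (inv_pos.2 hr.pos)) (integral_pos_of_pos hgi hgp), fun v => ?_⟩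
  have h := integral_mono ((hgi.const_mul (C⁻¹ / 2)).mul_const (bracket v)) (hr.integrable_left v)
    fun u => hr.lower_mul u v
  rwa [integral_mul_const, integral_const_mul] at h

theorem K0_add {f g : V → ℂ} (hf : WeightedIntegrable f) (hg : WeightedIntegrable g) :
    K0 r (fun v => f v + g v) =ᵐ[volume] fun v => K0 r f v + K0 r g v := by
  filter_upwards [(hr.integrable_kernel_mul hf).prod_right_ae,
    (hr.integrable_kernel_mul hg).prod_right_ae] with v h1 h2
  rw [K0, K0, K0, ← integral_add h1 h2]
  simp only [mul_add]

theorem integral_norm_K0_le {f : V → ℂ} (hf : WeightedIntegrable f) :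
    ∫ v, ‖K0 r f v‖ ≤ 2 * C * (∫ v, maxwellian v * bracket v) * ∫ v, bracket v * ‖f v‖ := by
  rw [mul_right_comm, ← integral_const_mul (2 * C * ∫ v, bracket v * ‖f v‖)]
  refine integral_mono (hr.integrable_K0 hf).norm
    (integrable_maxwellian_mul_bracket.const_mul _) fun v => ?_
  have h : ‖K0 r f v‖ ≤ ∫ u, 2 * C * (maxwellian v * bracket v) * (bracket u * ‖f u‖) := by
    refine norm_integral_le_of_norm_le (hf.integrable_bracket_mul_norm.const_mul _)
      (Eventually.of_forall fun u => ?_)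
    rw [norm_mul, Complex.norm_real, Real.norm_of_nonneg (hr.nonneg _ _), ← mul_assoc]
    exact mul_le_mul_of_nonneg_right (hr.upper_mul v u) (norm_nonneg _)
  rw [integral_const_mul] at h
  exact h.trans_eq (by ring)

/-- In the parametrization `g ↦ g / ⟨v⟩` of the weighted space the perturbation is bounded on
`L¹`. -/
theorem exists_perturbationOperator (s : ℝ) : ∃ P : L1V →L[ℂ] L1V,
    ∀ g : L1V, (P g : V → ℂ) =ᵐ[volume] perturbation r s (unweight g) := by
  obtain ⟨D, hD0, hD⟩ := exists_integral_norm_nu1_mul_add_K1_le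
  refine ⟨l1Operator (fun g => perturbation r s (unweight g))
    (fun g => hr.integrable_perturbation (weightedIntegrable_unweight g) s) (fun g h => ?_)
    (fun c g => ?_) (2 * C * (∫ v, maxwellian v * bracket v) + |s| * D) fun g => ?_,
    coeFn_l1Operator _ _ _ _ _ _⟩
  · have hg := weightedIntegrable_unweight g
    have hh := weightedIntegrable_unweight h
    filter_upwards [perturbation_congr r s (unweight_add g h), hr.K0_add hg hh,
      K1_add hg hh] with v h1 h2 h3
    rw [h1, perturbation, h2, h3, perturbation, perturbation]
    ring
  · filter_upwards [perturbation_congr r s (unweight_smul c g)] with v h1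
    rw [h1, perturbation_const_mul]
  · have hg := weightedIntegrable_unweight g
    have h1 := hr.integral_norm_K0_le hg
    have h2 := mul_le_mul_of_nonneg_left (hD _ hg) (abs_nonneg s)
    have i1 := (hr.integrable_K0 hg).norm
    have i2 := ((integrable_nu1_mul hg).add (integrable_K1 hg)).norm.const_mul |s|
    have h3 := integral_mono (hr.integrable_perturbation hg s).norm (i1.add i2) fun v => by
      simp only [perturbation, Pi.add_apply]
      refine (norm_add_le _ _).trans_eq ?_
      rw [norm_neg, norm_mul, Complex.norm_real, Real.norm_eq_abs]
    rw [integral_add' i1 i2, integral_const_mul] at h3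
    rw [integral_bracket_mul_norm_unweight] at h1 h2
    simp only [Pi.add_apply] at h3
    refine h3.trans ((add_le_add h1 h2).trans_eq ?_)
    ring

/-- Multiplication by `(l + ν₀ + i ξ · v) / ⟨v⟩` is bounded, and invertible for `l ≥ 0`. -/
theorem exists_symbolOperator (ξ : V) (l : ℝ) : ∃ T : L1V →L[ℂ] L1V,
    (∀ g : L1V, (T g : V → ℂ) =ᵐ[volume] fun v => (l + symbol r ξ v) * unweight g v) ∧
      (0 ≤ l → IsUnit T) := by
  obtain ⟨D, hD0, hD⟩ := hr.exists_norm_symbol_le ξ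
  obtain ⟨c, hc0, hc⟩ := hr.exists_mul_bracket_le_nu0
  have hbm : Measurable fun v : V => (bracket v : ℂ) :=
    Complex.measurable_ofReal.comp continuous_bracket.measurable
  have hbn : ∀ v, ‖(bracket v : ℂ)‖ = bracket v := fun v => by
    rw [Complex.norm_real, Real.norm_of_nonneg (bracket_pos v).le]
  have hsm : Measurable fun v => (l : ℂ) + symbol r ξ v := (hr.measurable_symbol ξ).const_add _
  obtain ⟨T, hT⟩ := exists_mulOperator (m := fun v => (l + symbol r ξ v) / bracket v)
    (hsm.div hbm) (D := |l| + D) fun v => by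
    rw [norm_div, hbn, div_le_iff₀ (bracket_pos v), add_mul]
    refine (norm_add_le _ _).trans (add_le_add ?_ (hD v))
    rw [Complex.norm_real, Real.norm_eq_abs]
    exact le_mul_of_one_le_right (abs_nonneg l) (one_le_bracket v)
  refine ⟨T, fun g => (hT g).trans (Eventually.of_forall fun v => ?_), fun hl => ?_⟩
  · simp only [unweight]
    rw [div_eq_mul_inv, mul_assoc]
  · have hlow : ∀ v, c * bracket v ≤ ‖(l : ℂ) + symbol r ξ v‖ := fun v => by
      refine le_trans ?_ (Complex.re_le_norm _)
      rw [Complex.add_re, symbol_re, Complex.ofReal_re]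
      linarith [hc v]
    have hne : ∀ v, (l : ℂ) + symbol r ξ v ≠ 0 := fun v =>
      norm_pos_iff.1 ((mul_pos hc0 (bracket_pos v)).trans_le (hlow v))
    have hbne : ∀ v, (bracket v : ℂ) ≠ 0 := fun v => by exact_mod_cast (bracket_pos v).ne'
    obtain ⟨R, hR⟩ := exists_mulOperator (m := fun v => bracket v / (l + symbol r ξ v))
      (hbm.div hsm) (D := c⁻¹) fun v => by
      rw [norm_div, hbn, div_le_iff₀ (norm_pos_iff.2 (hne v)), inv_mul_eq_div, le_div_iff₀ hc0,
        mul_comm]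
      exact hlow v
    have h1 : T * R = 1 := by
      ext1 g
      refine Lp.ext ?_
      filter_upwards [hT (R g), hR g] with v h1 h2
      rw [mul_apply_eq_comp, h1, h2, one_apply_eq_self]
      have e1 := hne v
      have e2 := hbne v
      field_simp
    have h2 : R * T = 1 := by
      ext1 g
      refine Lp.ext ?_
      filter_upwards [hR (T g), hT g] with v h1 h2
      rw [mul_apply_eq_comp, h1, h2, one_apply_eq_self]
      have e1 := hne v
      have e2 := hbne v
      field_simp
    exact ⟨⟨T, R, h1, h2⟩, rfl⟩

/-- The Lyapunov functional as a seminorm on `L¹`. -/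
def lyapunovSeminorm (ξ : V) {σ θ : ℝ} (hθ : 0 ≤ θ)
    (hσ : σ ≤ C⁻¹ * (∫ u, maxwellian u) / 2) : Seminorm ℂ L1V :=
  Seminorm.of (fun f => lyapunov r ξ σ θ f)
    (fun f g => by
      rw [lyapunov_congr r ξ σ θ (Lp.coeFn_add f g)]
      exact hr.lyapunov_add_le ξ hθ hσ (L1.integrable_coeFn f) (L1.integrable_coeFn g))
    (fun c f => by
      rw [lyapunov_congr r ξ σ θ (Lp.coeFn_smul c f)]
      exact lyapunov_const_mul r ξ σ θ c f)

/-- `L₀` conserves mass. -/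
theorem integral_modeExpr_zero (Cinf κ : ℝ) {f : V → ℂ} (hf : WeightedIntegrable f) :
    ∫ v, modeExpr r Cinf κ 0 f v = 0 := by
  have hsym : ∀ v, symbol r (mode 0) v = nu0 r v := fun v => by
    have : mode 0 = 0 := by
      ext i
      simp [mode]
    simp [symbol, this]
  have i0 : Integrable fun v => (nu0 r v : ℂ) * f v :=
    hf.integrable_mul (Complex.measurable_ofReal.comp hr.measurable_nu0) fun v => by
      rw [Complex.norm_real, Real.norm_of_nonneg (hr.nu0_pos v).le]
      exact hr.nu0_le v
  have i1 := hr.integrable_K0 hf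
  have i2 := integrable_nu1_mul hf
  have i3 := integrable_K1 hf
  have e : ∀ v, modeExpr r Cinf κ 0 f v = ((nu0 r v : ℂ) * f v - K0 r f v) +
      ((Cinf * κ : ℝ) : ℂ) * ((nu1 v : ℂ) * f v + K1 f v) := fun v => by
    rw [modeExpr_eq, hsym, perturbation]
    ring
  simp only [e]
  have i4 : Integrable fun v => (nu0 r v : ℂ) * f v - K0 r f v := i0.sub i1
  have i5 : Integrable fun v => (nu1 v : ℂ) * f v + K1 f v := i2.add i3
  rw [integral_add i4 (i5.const_mul _), integral_sub i0 i1, integral_const_mul, integral_add i2 i3,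
    integral_K1 hf, hr.integral_K0 hf]
  ring

end KernelBounds

theorem mass_apply (f : L1V) : mass f = ∫ v, f v := rfl

/-- The constant `π^(-3/2)` normalizes the mass of the Maxwellian. -/
theorem mass_P0 (f : L1V) : mass (P0 f) = mass f := by
  have h1 : mass (integrable_maxwellian.toL1 _) = ((Real.pi ^ (3 / 2 : ℝ) : ℝ) : ℂ) := by
    rw [mass_apply, integral_congr_ae integrable_maxwellian.coeFn_toL1, integral_complex_ofReal]
    have := GaussianFourier.integral_rexp_neg_mul_sq_norm (V := V) one_pos
    simp only [finrank_euclideanSpace, Fintype.card_fin, div_one, neg_mul, one_mul] at this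
    exact_mod_cast this
  have h2 : P0 f = mass f • (((Real.pi ^ (-(3 / 2) : ℝ) : ℝ) : ℂ) •
    integrable_maxwellian.toL1 _) := rfl
  rw [h2, map_smul, map_smul, h1, smul_eq_mul, smul_eq_mul, ← Complex.ofReal_mul,
    ← Real.rpow_add Real.pi_pos]
  simp

/-- The graph of `L_n`, parametrized by `g ↦ (g / ⟨v⟩, L_n (g / ⟨v⟩))`. -/
theorem modeOperator_eq (r : V → V → ℝ) (Cinf κ : ℝ) (n : Fin 3 → ℤ) {J B : L1V →L[ℂ] L1V}
    (hJ : ∀ g : L1V, (J g : V → ℂ) =ᵐ[volume] unweight g)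
    (hB : ∀ g : L1V, (B g : V → ℂ) =ᵐ[volume] modeExpr r Cinf κ n (unweight g)) :
    modeOperator r Cinf κ n = {p : L1V × L1V | ∃ g, J g = p.1 ∧ B g = p.2} := by
  ext ⟨x, y⟩
  simp only [modeOperator, Set.mem_ofPred_eq]
  constructor
  · rintro ⟨hx, hy⟩
    have hg : unweight (hx.toL1 _ : L1V) =ᵐ[volume] x := by
      filter_upwards [hx.coeFn_toL1] with v hv
      rw [unweight, hv, inv_mul_cancel_left₀]
      exact_mod_cast (bracket_pos v).ne'
    refine ⟨hx.toL1 _, Lp.ext ((hJ _).trans hg), Lp.ext ?_⟩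
    exact ((hB _).trans (modeExpr_congr r Cinf κ n hg)).trans hy.symm
  · rintro ⟨g, rfl, rfl⟩
    refine ⟨?_, (hB g).trans (modeExpr_congr r Cinf κ n (hJ g)).symm⟩
    refine (weightedIntegrable_unweight g).congr ?_
    filter_upwards [hJ g] with v hv
    rw [hv]

namespace KernelBounds

variable {r : V → V → ℝ} {C : ℝ} (hr : KernelBounds r C)
include hr

/-- Generation and decay. For `n = 0` the decay is restricted to functions of mass zero. -/
theorem exists_semigroup {Cinf : ℝ} (hCinf : 0 ≤ Cinf) : ∃ κ₀ ε : ℝ, 0 < κ₀ ∧ 0 < ε ∧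
    ∀ κ : ℝ, 0 < κ → κ ≤ κ₀ → ∀ n : Fin 3 → ℤ, ∃ S : ℝ → L1V →L[ℂ] L1V,
      IsExpNeg S (modeOperator r Cinf κ n) ∧
        ∀ f : L1V, (n = 0 → mass f = 0) → ∀ t, 0 ≤ t → ‖S t f‖ ≤ 2 * Real.exp (-ε * t) * ‖f‖ := by
  obtain ⟨κ₀, ε, η, θ, hκ₀, hε, hη, hθ, hσ, hdiss⟩ := hr.exists_dissipation hCinf
  refine ⟨κ₀, ε, hκ₀, hε, fun κ hκ hκκ₀ n => ?_⟩
  set a := C⁻¹ * ∫ u, maxwellian u with ha_def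
  have ha : 0 < a := hr.minorization_mass_pos
  -- `Λ` is the rate at which the mass escapes damping; `|∫ f| ≤ 2 N(f)` turns it into growth at the
  -- rate `2 Λ`, which suffices for generation
  set Λ : ℝ := if n = 0 then a else 0 with hΛ
  have hΛ0 : 0 ≤ Λ := by rw [hΛ]; split_ifs <;> linarith
  set N : Seminorm ℂ L1V := hr.lyapunovSeminorm (mode n) hθ hσ with hN_def
  have hN : ∀ {x : L1V} {f : V → ℂ}, (x : V → ℂ) =ᵐ[volume] f →
      N x = lyapunov r (mode n) (η + θ) θ f := fun {x f} h => lyapunov_congr _ _ _ _ h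
  have hNle : ∀ x, N x ≤ ‖x‖ := fun x => by
    rw [L1.norm_eq_integral_norm]
    exact hr.lyapunov_le_integral_norm (mode n) hη hθ (L1.integrable_coeFn x)
  have hleN : ∀ x, 1 / 2 * ‖x‖ ≤ N x := fun x => by
    rw [L1.norm_eq_integral_norm]
    exact hr.integral_norm_le_lyapunov (mode n) hθ hσ (L1.integrable_coeFn x)
  obtain ⟨J, hJ, hJdense, hJle⟩ := exists_unweightOperator
  obtain ⟨P, hP⟩ := hr.exists_perturbationOperator (Cinf * κ)
  choose M hM hMunit using hr.exists_symbolOperator (mode n)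
  set B := M 0 + P with hB_def
  have hB : ∀ g : L1V, (B g : V → ℂ) =ᵐ[volume] modeExpr r Cinf κ n (unweight g) := fun g => by
    filter_upwards [Lp.coeFn_add (M 0 g) (P g), hM 0 g, hP g] with v h1 h2 h3
    rw [hB_def, add_apply, h1, Pi.add_apply, h2, h3, modeExpr_eq, Complex.ofReal_zero, zero_add]
  have hMl : ∀ l : ℝ, ∀ g, M l g = (l : ℂ) • J g + M 0 g := fun l g => Lp.ext <| by
    filter_upwards [Lp.coeFn_add ((l : ℂ) • J g) (M 0 g), Lp.coeFn_smul (l : ℂ) (J g), hM l g,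
      hM 0 g, hJ g] with v h1 h2 h3 h4 h5
    rw [h1, Pi.add_apply, h2, Pi.smul_apply, h3, h4, h5, smul_eq_mul, Complex.ofReal_zero]
    ring
  have hmass : ∀ x : L1V, ‖mass x‖ ≤ ‖x‖ := fun x => by
    rw [L1.norm_eq_integral_norm]
    exact norm_integral_le_integral_norm _
  have hkey : ∀ l : ℝ, 0 ≤ l → ∀ g,
      N (P g) + l * N (J g) + ε * ‖g‖ ≤ N (M l g) + Λ * ‖mass (J g)‖ := fun l hl g => by
    have := hdiss κ hκ hκκ₀ n l hl (unweight g) (weightedIntegrable_unweight g)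
    rw [integral_bracket_mul_norm_unweight] at this
    rw [hN (hP g), hN (hJ g), hN (hM l g), mass_apply, integral_congr_ae (hJ g)]
    exact this
  have hsum : ∀ l : ℝ, ∀ g, N (M l g) - N (P g) ≤ N ((l : ℂ) • J g + B g) := fun l g => by
    have e : M l g = ((l : ℂ) • J g + B g) - P g := by
      rw [hMl, hB_def, add_apply]
      abel
    have := map_sub_le_add N ((l : ℂ) • J g + B g) (P g)
    rw [← e] at this
    linarith
  have hΛmass : ∀ g, Λ * ‖mass (J g)‖ ≤ 2 * Λ * N (J g) := fun g => by
    have h1 := (hmass (J g)).trans (show ‖J g‖ ≤ 2 * N (J g) by linarith [hleN (J g)])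
    have := mul_le_mul_of_nonneg_left h1 hΛ0
    linarith
  obtain ⟨S, hS, hSdecay⟩ := hille_yosida N (by norm_num : (0 : ℝ) < 1 / 2) hleN hNle J B hJdense
    (2 * Λ) (2 * Λ) (by linarith) (fun l hl => by
      have e : (l : ℂ) • J + B = M l + P := by
        refine ContinuousLinearMap.ext fun g => ?_
        have h1 : ((l : ℂ) • J + B) g = (l : ℂ) • J g + (M 0 g + P g) := rfl
        have h2 : (M l + P) g = M l g + P g := rfl
        rw [h1, h2, hMl l g, add_assoc]
      rw [e]
      refine isUnit_add_of_seminorm_le N (by norm_num : (0 : ℝ) < 1 / 2) hleN hNle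
        (hMunit l (by linarith)) hε fun g => ?_
      have h1 := hkey l (by linarith) g
      have h2 := hΛmass g
      nlinarith [apply_nonneg N (J g)])
    (fun l hl g => by
      have h1 := hkey l (by linarith) g
      have h2 := hΛmass g
      have h3 := hsum l g
      have h4 := mul_nonneg hε.le (norm_nonneg g)
      linarith)
  refine ⟨S, ?_, fun f hf t ht => ?_⟩
  · rw [modeOperator_eq r Cinf κ n hJ hB]
    exact hS
  · have hfinal : N (S t f) ≤ Real.exp (-ε * t) * N f := by
      have hrate : ∀ l : ℝ, 2 * Λ < l → ∀ g, Λ * ‖mass (J g)‖ = 0 →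
          (l + ε) * N (J g) ≤ N ((l : ℂ) • J g + B g) := fun l hl g hg => by
        have h1 := hkey l (by linarith) g
        have h2 := hsum l g
        have h3 := mul_le_mul_of_nonneg_left ((hNle (J g)).trans (hJle g)) hε.le
        linarith
      by_cases hn : n = 0
      · refine hSdecay (LinearMap.ker (mass : L1V →ₗ[ℂ] ℂ)) ε mass.isClosed_ker
          (fun l hl g hg => ?_) f (hf hn) t ht
        have hBmass : mass (B g) = 0 := by
          rw [mass_apply, integral_congr_ae (hB g), hn]
          exact hr.integral_modeExpr_zero Cinf κ (weightedIntegrable_unweight g)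
        have hl0 : (l : ℂ) ≠ 0 := by exact_mod_cast (by linarith : (0 : ℝ) < l).ne'
        have hJmass : mass (J g) = 0 := by
          have h1 : mass ((l : ℂ) • J g + B g) = 0 := hg
          rw [map_add, hBmass, add_zero, map_smul, smul_eq_mul] at h1
          exact (mul_eq_zero.1 h1).resolve_left hl0
        exact ⟨hJmass, hrate l hl g (by rw [hJmass, norm_zero, mul_zero])⟩
      · refine hSdecay ⊤ ε isClosed_univ (fun l hl g _ => ⟨trivial, hrate l hl g ?_⟩) f trivial t ht
        rw [hΛ, if_neg hn, zero_mul]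
    have h1 := hleN (S t f)
    have h2 := mul_le_mul_of_nonneg_left (hNle f) (Real.exp_pos (-ε * t)).le
    linarith

end KernelBounds

end LinearBoltzmann

end

theorem mainTheorem4 (r : LinearBoltzmann.V → LinearBoltzmann.V → ℝ)
    (hr : LinearBoltzmann.AdmissibleKernel r) (Cinf : ℝ) (hCinf : 0 ≤ Cinf) :
    ∃ κ₀ C₀ C₁ : ℝ, 0 < κ₀ ∧ 0 < C₀ ∧ 0 < C₁ ∧
      ∀ κ : ℝ, 0 < κ → κ ≤ κ₀ → ∀ n : Fin 3 → ℤ,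
        ∃ S : ℝ → LinearBoltzmann.L1V →L[ℂ] LinearBoltzmann.L1V,
          LinearBoltzmann.IsExpNeg S (LinearBoltzmann.modeOperator r Cinf κ n) ∧
          (n ≠ 0 → ∀ t : ℝ, 0 ≤ t →
            ‖S t‖ ≤ C₁ * (1 + ‖LinearBoltzmann.mode n‖) * Real.exp (-C₀ * t)) ∧
          (n = 0 → ∀ t : ℝ, 0 ≤ t →
            ‖S t ∘L (1 - LinearBoltzmann.P0)‖ ≤ C₁ * Real.exp (-C₀ * t)) := by
  obtain ⟨C, hC⟩ := hr.exists_kernelBounds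
  obtain ⟨κ₀, ε, hκ₀, hε, h⟩ := hC.exists_semigroup hCinf
  set Q : LinearBoltzmann.L1V →L[ℂ] LinearBoltzmann.L1V := 1 - LinearBoltzmann.P0 with hQ
  refine ⟨κ₀, ε, 2 * (1 + ‖Q‖), hκ₀, hε, by positivity, fun κ hκ hκκ₀ n => ?_⟩
  obtain ⟨S, hS, hdecay⟩ := h κ hκ hκκ₀ n
  refine ⟨S, hS, fun hn t ht => ?_, fun hn t ht => ?_⟩
  · refine ContinuousLinearMap.opNorm_le_bound _ (by positivity) fun f => ?_
    refine (hdecay f (fun h0 => absurd h0 hn) t ht).trans ?_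
    refine mul_le_mul_of_nonneg_right (mul_le_mul_of_nonneg_right ?_ (Real.exp_pos _).le)
      (norm_nonneg f)
    nlinarith [norm_nonneg Q, norm_nonneg (LinearBoltzmann.mode n),
      mul_nonneg (norm_nonneg Q) (norm_nonneg (LinearBoltzmann.mode n))]
  · refine ContinuousLinearMap.opNorm_le_bound _ (by positivity) fun f => ?_
    have hmass : LinearBoltzmann.mass (Q f) = 0 := by
      rw [hQ, sub_apply, one_apply_eq_self, map_sub, LinearBoltzmann.mass_P0, sub_self]
    rw [ContinuousLinearMap.comp_apply]
    refine (hdecay (Q f) (fun _ => hmass) t ht).trans ?_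
    have h1 : ‖Q f‖ ≤ (1 + ‖Q‖) * ‖f‖ :=
      (Q.le_opNorm f).trans (mul_le_mul_of_nonneg_right (by linarith) (norm_nonneg f))
    calc 2 * Real.exp (-ε * t) * ‖Q f‖ ≤ 2 * Real.exp (-ε * t) * ((1 + ‖Q‖) * ‖f‖) := by gcongr
      _ = 2 * (1 + ‖Q‖) * Real.exp (-ε * t) * ‖f‖ := by ring
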